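/- Let $\mathscr C$ be the space of smooth conics in $\mathbb P^2_{\mathbb Z}$. Let $\mathrm{Cam}_2$ be the stack over schemes whose objects over $S$ are Zariski forms $\mathbb P\to S$ of $\mathbb P^3_S$ with two relative pinhole cameras $\phi_1,\phi_2:\mathbb P\dashrightarrow\mathbb P^2_S$ (locally on $S$ given by $3\times4$ matrices of rank $3$ in every fibre) whose centers $Z_1,Z_2$ (sections of $\mathbb P\to S$) are disjoint. Given relative smooth conics $C_1,C_2\subset\mathbb P^2_S$, let $X_i\subset\mathbb P$ be the cone over $C_i$, that is, the scheme-theoretic closure of $\phi_i^{-1}(C_i)\subset\mathbb P\setminus Z_i$. Let $\mathrm{CalCam}_2$ be the stack of tuples $(\mathbb P,\phi_1,\phi_2,C_1,C_2,C)$ where $(\mathbb P,\phi_1,\phi_2)$ is an object of $\mathrm{Cam}_2$, $C_1,C_2$ are relative smooth conics in $\mathbb P^2_S$, and $C\subset\mathbb P$ is a relative degree-two curve (a plane conic in every fibre, possibly degenerate: locally on $S$ cut out in linear coordinates by a linear form and a quadratic form, the quadric containing the plane in no fibre) with $C\subset X_1\cap X_2$. Let $\nu_2:\mathrm{CalCam}_2\to\mathrm{Cam}_2\times\mathscr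 C^2$ be the morphism that forgets $C$. Then there is a morphism $\chi:\mathrm{CalCam}_2\to\mathrm{CalCam}_2$ with $\nu_2\circ\chi=\nu_2$ and $\chi\circ\chi=\mathrm{id}$, which fixes the cameras and the plane conics and replaces $C$ by the residual curve $C'$ of $C$ in $F=X_1\cap X_2$, i.e. the closed subscheme with ideal sheaf $(I_F:I_C)$; in particular $C'$ is again a relative degree-two curve contained in $X_1\cap X_2$. Moreover, $\chi$ has no fixed points with values in a field in which $2\neq0$: for such a field $K$ and every object $x$ of $\mathrm{CalCam}_2$ over $\operatorname{Spec}K$, the objects $\chi(x)$ and $x$ are not isomorphic over $\operatorname{Spec}K$. -/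

import Mathlib

open CategoryTheory CategoryTheory.Limits AlgebraicGeometry

universe u

noncomputable section

namespace CalibratedCameras

attribute [local instance] MvPolynomial.gradedAlgebra

/-! ### Projective space and homogeneous coordinates -/

/-- Projective `n`-space over `Spec ℤ` (in the universe `u`). -/
abbrev ProjZ (n : ℕ) : Scheme.{u} :=
  Proj (MvPolynomial.homogeneousSubmodule (Fin (n + 1)) (ULift.{u} ℤ))

/-- A tuple of global functions without common zeros. -/
def Unimodular {n : ℕ} {T : Scheme.{u}} (x : Fin n → Γ(T, ⊤)) : Prop :=
  Ideal.span (Set.range x) = ⊤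

/-- Evaluation of integral polynomials at a tuple of global functions. -/
def evalZ {n : ℕ} {T : Scheme.{u}} (x : Fin n → Γ(T, ⊤)) :
    MvPolynomial (Fin n) (ULift.{u} ℤ) →+* Γ(T, ⊤) :=
  MvPolynomial.eval₂Hom ((Int.castRingHom Γ(T, ⊤)).comp ULift.ringEquiv.toRingHom) x

theorem map_irrelevant_eq_top {n : ℕ} {T : Scheme.{u}} (x : Fin (n + 1) → Γ(T, ⊤))
    (hx : Unimodular x) :
    (HomogeneousIdeal.irrelevant
      (MvPolynomial.homogeneousSubmodule (Fin (n + 1)) (ULift.{u} ℤ))).toIdeal.map (evalZ x)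
      = ⊤ := by
  rw [eq_top_iff, ← hx, Ideal.span_le]
  rintro _ ⟨i, rfl⟩
  have h : evalZ x (MvPolynomial.X i) = x i := by simp [evalZ]
  rw [← h]
  refine Ideal.mem_map_of_mem _ ?_
  refine (HomogeneousIdeal.mem_irrelevant_iff _ _).mpr ?_
  have hX : (MvPolynomial.X i : MvPolynomial (Fin (n + 1)) (ULift.{u} ℤ)) ∈
      MvPolynomial.homogeneousSubmodule (Fin (n + 1)) (ULift.{u} ℤ) 1 :=
    (MvPolynomial.mem_homogeneousSubmodule _ _).mpr (MvPolynomial.isHomogeneous_X _ i)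
  rw [GradedRing.proj_apply]
  exact DirectSum.decompose_of_mem_ne _ hX one_ne_zero

/-- The point `[x₀ : ... : xₙ]` of projective space with values in `T`. -/
def homogPoint {n : ℕ} {T : Scheme.{u}} (x : Fin (n + 1) → Γ(T, ⊤)) (hx : Unimodular x) :
    T ⟶ ProjZ.{u} n :=
  Proj.fromOfGlobalSections _ (evalZ x) (map_irrelevant_eq_top x hx)

/-- Projective `n`-space over `S`. -/
abbrev ProjOver (n : ℕ) (S : Scheme.{u}) : Scheme.{u} :=
  pullback (terminal.from S) (terminal.from (ProjZ.{u} n))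

/-- The morphism to `ℙⁿ_S` given by a morphism to `S` and a morphism to `ℙⁿ`. -/
def toProjOver {n : ℕ} {S T : Scheme.{u}} (a : T ⟶ S) (b : T ⟶ ProjZ.{u} n) :
    T ⟶ ProjOver n S :=
  pullback.lift a b (Subsingleton.elim _ _)

/-- The morphism `ℙⁿ_S ⟶ ℙⁿ_T` induced by `S ⟶ T`. -/
def projOverMap (n : ℕ) {S T : Scheme.{u}} (f : S ⟶ T) : ProjOver n S ⟶ ProjOver n T :=
  toProjOver (pullback.fst _ _ ≫ f) (pullback.snd _ _)

theorem projOverMap_id (n : ℕ) (S : Scheme.{u}) : projOverMap n (𝟙 S) = 𝟙 _ := by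
  apply pullback.hom_ext <;> simp [projOverMap, toProjOver]

theorem projOverMap_comp (n : ℕ) {S T R : Scheme.{u}} (f : S ⟶ T) (g : T ⟶ R) :
    projOverMap n (f ≫ g) = projOverMap n f ≫ projOverMap n g := by
  have h₁ {X Y : Scheme.{u}} (a : X ⟶ Y) :
      projOverMap n a ≫ pullback.fst _ _ = pullback.fst _ _ ≫ a := pullback.lift_fst _ _ _
  have h₂ {X Y : Scheme.{u}} (a : X ⟶ Y) :
      projOverMap n a ≫ pullback.snd _ _ = pullback.snd _ _ := pullback.lift_snd _ _ _
  apply pullback.hom_ext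
  · rw [h₁, Category.assoc, h₁, ← Category.assoc (projOverMap n f), h₁, Category.assoc]
  · rw [h₂, Category.assoc, h₂, h₂]

/-! ### Relative smooth conics in the plane -/

/-- A ternary quadratic form over a ring whose zero locus is a smooth conic in every fibre
(Jacobian criterion; note that `q = 0` in a fibre is excluded). -/
def IsSmoothQuadratic {R : Type u} [CommRing R] (q : MvPolynomial (Fin 3) R) : Prop :=
  q.IsHomogeneous 2 ∧
  ∀ (K : Type u) [Field K] (f : R →+* K) (v : Fin 3 → K),
    MvPolynomial.eval₂ f v q = 0 →
    (∀ i, MvPolynomial.eval₂ f v (MvPolynomial.pderiv i q) = 0) → v = 0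

/-- The closed subscheme of `ℙ²_S` with ideal sheaf `D` is a relative smooth conic:
Zariski-locally on `S` it is the zero scheme of a smooth ternary quadratic form. -/
def IsSmoothConic {S : Scheme.{u}} (D : (ProjOver 2 S).IdealSheafData) : Prop :=
  ∀ s : S, ∃ U : S.Opens, s ∈ U ∧ IsAffineOpen U ∧
    ∃ q : MvPolynomial (Fin 3) Γ((U : Scheme.{u}), ⊤), IsSmoothQuadratic q ∧
      ∀ (T : Scheme.{u}) [IsAffine T] (a : T ⟶ (U : Scheme.{u})) (y : Fin 3 → Γ(T, ⊤))
        (hy : Unimodular y),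
        D.comap (toProjOver (a ≫ U.ι) (homogPoint y hy)) =
          Scheme.IdealSheafData.ofIdealTop
            (Ideal.span {MvPolynomial.eval₂ a.appTop.hom y q})

/-! ### Forms of projective three-space, cameras -/

/-- An identification of `P` with `ℙ³` over the open `U ⊆ S`; it is given by the projection
of `π ⁻¹ᵁ U` to `ℙ³`. -/
structure Trivialization {P S : Scheme.{u}} (π : P ⟶ S) (U : S.Opens) where
  coord : (π ⁻¹ᵁ U : Scheme.{u}) ⟶ ProjZ.{u} 3
  isPullback : IsPullback (π ∣_ U) coord (terminal.from _) (terminal.from _)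

/-- The coefficient map from functions on `U` to functions on a scheme mapping to `π ⁻¹ᵁ U`. -/
def coeffMap {P S T : Scheme.{u}} (π : P ⟶ S) (U : S.Opens)
    (t : T ⟶ (π ⁻¹ᵁ U : Scheme.{u})) : Γ((U : Scheme.{u}), ⊤) →+* Γ(T, ⊤) :=
  (t ≫ π ∣_ U).appTop.hom

/-- The data underlying a relative pinhole camera `P ⇢ ℙ²_S`: its centre, a section of
`π`, and a morphism over `S` to `ℙ²_S` (that is, a morphism to `ℙ²`) on the complement of
the centre. -/
structure CameraData {P S : Scheme.{u}} (π : P ⟶ S) where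
  center : S ⟶ P
  center_π : center ≫ π = 𝟙 S
  dom : P.Opens
  coe_dom : (dom : Set P) = (Set.range center)ᶜ
  map : (dom : Scheme.{u}) ⟶ ProjZ.{u} 2

/-- In the coordinates `e` over `U` the camera is `x ↦ A x`, for a `3 × 4` matrix `A` of
functions on `U` with rank three in every fibre, and the centre is the kernel of `A`. -/
structure CameraData.IsGivenBy {P S : Scheme.{u}} {π : P ⟶ S} (φ : CameraData π)
    {U : S.Opens} (e : Trivialization π U)
    (A : Matrix (Fin 3) (Fin 4) Γ((U : Scheme.{u}), ⊤)) : Prop where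
  surjective : Function.Surjective (fun v => A.mulVec v)
  center : ∃ (c : Fin 4 → Γ((U : Scheme.{u}), ⊤)) (hc : Unimodular c)
    (t : (U : Scheme.{u}) ⟶ (π ⁻¹ᵁ U : Scheme.{u})),
      A.mulVec c = 0 ∧ t ≫ (π ⁻¹ᵁ U).ι = U.ι ≫ φ.center ∧ t ≫ e.coord = homogPoint c hc
  map : ∀ (T : Scheme.{u}) [IsAffine T] (t : T ⟶ (π ⁻¹ᵁ U : Scheme.{u}))
    (x : Fin 4 → Γ(T, ⊤)) (hx : Unimodular x) (t' : T ⟶ (φ.dom : Scheme.{u})),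
      t ≫ e.coord = homogPoint x hx → t' ≫ φ.dom.ι = t ≫ (π ⁻¹ᵁ U).ι →
      ∃ hy : Unimodular ((A.map (coeffMap π U t)).mulVec x),
        t' ≫ φ.map = homogPoint ((A.map (coeffMap π U t)).mulVec x) hy

/-- A trivialization in which all the given cameras are linear. -/
def IsAdapted {n : ℕ} {P S : Scheme.{u}} {π : P ⟶ S} (φ : Fin n → CameraData π)
    {U : S.Opens} (e : Trivialization π U) : Prop :=
  ∀ i, ∃ A, (φ i).IsGivenBy e A

/-! ### The stack of camera configurations -/

/-- An object of `Cam_n`: a base scheme `base`, a Zariski form `P` of `ℙ³` over it, and `n`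
relative pinhole cameras on `P` with pairwise disjoint centres. -/
structure Cam (n : ℕ) where
  base : Scheme.{u}
  P : Scheme.{u}
  π : P ⟶ base
  camera : Fin n → CameraData π
  locally_linear : ∀ s : base, ∃ U : base.Opens, s ∈ U ∧ IsAffineOpen U ∧
    ∃ e : Trivialization π U, IsAdapted camera e
  general : ∀ i j, i ≠ j →
    Disjoint (Set.range (camera i).center) (Set.range (camera j).center)

/-- A morphism of the fibred category `Cam_n` over a morphism of base schemes: a cartesian
square compatible with the centres and with the cameras. -/
@[ext]
structure Cam.Hom {n : ℕ} (X Y : Cam.{u} n) where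
  base : X.base ⟶ Y.base
  hom : X.P ⟶ Y.P
  isPullback : IsPullback hom X.π Y.π base
  center : ∀ i, (X.camera i).center ≫ hom = base ≫ (Y.camera i).center
  map : ∀ i, ∃ r : ((X.camera i).dom : Scheme.{u}) ⟶ ((Y.camera i).dom : Scheme.{u}),
    r ≫ (Y.camera i).dom.ι = (X.camera i).dom.ι ≫ hom ∧
    r ≫ (Y.camera i).map = (X.camera i).map

instance (n : ℕ) : Category (Cam.{u} n) where
  Hom := Cam.Hom
  id X :=
    { base := 𝟙 _
      hom := 𝟙 _
      isPullback := IsPullback.of_horiz_isIso ⟨by simp⟩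
      center := fun i => by simp
      map := fun i => ⟨𝟙 _, by simp, by simp⟩ }
  comp f g :=
    { base := f.base ≫ g.base
      hom := f.hom ≫ g.hom
      isPullback := f.isPullback.paste_horiz g.isPullback
      center := fun i => by
        rw [← Category.assoc, f.center i, Category.assoc, g.center i, Category.assoc]
      map := fun i => by
        obtain ⟨r, hr, hr'⟩ := f.map i
        obtain ⟨t, ht, ht'⟩ := g.map i
        refine ⟨r ≫ t, ?_, ?_⟩
        · rw [Category.assoc, ht, ← Category.assoc, hr, Category.assoc]
        · rw [Category.assoc, ht', hr'] }
  id_comp f := by apply Cam.Hom.ext <;> simp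
  comp_id f := by apply Cam.Hom.ext <;> simp
  assoc f g h := by apply Cam.Hom.ext <;> simp

/-! ### Camera configurations with calibrated image planes: `Cam_n × 𝒞ⁿ` -/

/-- An object of `Cam_n × 𝒞ⁿ`, where `𝒞` is the space of smooth plane conics. -/
structure CamConics (n : ℕ) where
  toCam : Cam.{u} n
  conic : Fin n → (ProjOver 2 toCam.base).IdealSheafData
  smooth : ∀ i, IsSmoothConic (conic i)

/-- Morphisms of `Cam_n × 𝒞ⁿ`: the plane conics have to be pulled back along the base. -/
@[ext]
structure CamConics.Hom {n : ℕ} (X Y : CamConics.{u} n) where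
  toCam : X.toCam ⟶ Y.toCam
  conic : ∀ i, X.conic i = (Y.conic i).comap (projOverMap 2 toCam.base)

instance (n : ℕ) : Category (CamConics.{u} n) where
  Hom := CamConics.Hom
  id X :=
    { toCam := 𝟙 _
      conic := fun i => by
        change _ = (X.conic i).comap (projOverMap 2 (𝟙 _))
        rw [projOverMap_id, Scheme.IdealSheafData.comap_id] }
  comp f g :=
    { toCam := f.toCam ≫ g.toCam
      conic := fun i => by
        change _ = Scheme.IdealSheafData.comap _ (projOverMap 2 (f.toCam.base ≫ g.toCam.base))
        rw [projOverMap_comp, Scheme.IdealSheafData.comap_comp, ← g.conic i, ← f.conic i] }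
  id_comp f := by apply CamConics.Hom.ext; simp
  comp_id f := by apply CamConics.Hom.ext; simp
  assoc f g h := by apply CamConics.Hom.ext; simp

/-- The (closed) cone `X_i ⊆ P` over the `i`-th plane conic: the scheme-theoretic closure in
`P` of the preimage of the conic under the `i`-th camera. -/
def CamConics.cone {n : ℕ} (X : CamConics.{u} n) (i : Fin n) : X.toCam.P.IdealSheafData :=
  ((X.conic i).comap
    (toProjOver ((X.toCam.camera i).dom.ι ≫ X.toCam.π) (X.toCam.camera i).map)).map
      (X.toCam.camera i).dom.ι

/-- The ideal sheaf of the scheme-theoretic intersection of all the cones. -/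
def CamConics.coneInter {n : ℕ} (X : CamConics.{u} n) : X.toCam.P.IdealSheafData :=
  ⨆ i, X.cone i

/-! ### Degree two curves in `P` and calibrated configurations -/

/-- In the coordinates `e` over `U`, the closed subscheme with ideal sheaf `I` is the zero
scheme of the polynomials in `s`. -/
def IsCutOutBy {P S : Scheme.{u}} {π : P ⟶ S} {U : S.Opens} (e : Trivialization π U)
    (I : P.IdealSheafData) (s : Set (MvPolynomial (Fin 4) Γ((U : Scheme.{u}), ⊤))) : Prop :=
  ∀ (T : Scheme.{u}) [IsAffine T] (t : T ⟶ (π ⁻¹ᵁ U : Scheme.{u}))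
    (x : Fin 4 → Γ(T, ⊤)) (hx : Unimodular x), t ≫ e.coord = homogPoint x hx →
      I.comap (t ≫ (π ⁻¹ᵁ U).ι) = Scheme.IdealSheafData.ofIdealTop
        (Ideal.span ((fun p => MvPolynomial.eval₂ (coeffMap π U t) x p) '' s))

/-- Equations of a relative (possibly degenerate) conic in `ℙ³`: a plane `h = 0` and a quadric
`q = 0` that contains the plane in no fibre. -/
def IsConicEquations {R : Type u} [CommRing R] (h q : MvPolynomial (Fin 4) R) : Prop :=
  h.IsHomogeneous 1 ∧ q.IsHomogeneous 2 ∧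
  ∀ (K : Type u) [Field K] (f : R →+* K),
    MvPolynomial.map f h ≠ 0 ∧ ¬ MvPolynomial.map f h ∣ MvPolynomial.map f q

/-- The closed subscheme of `P` with ideal sheaf `C` is a relative curve of degree two, that
is, a plane conic, smooth or not: Zariski-locally on the base it is given by a linear and a
quadratic equation in linear coordinates. -/
def Cam.IsDegreeTwoCurve {n : ℕ} (X : Cam.{u} n) (C : X.P.IdealSheafData) : Prop :=
  ∀ s : X.base, ∃ U : X.base.Opens, s ∈ U ∧ IsAffineOpen U ∧
    ∃ e : Trivialization X.π U, IsAdapted X.camera e ∧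
      ∃ h q, IsConicEquations h q ∧ IsCutOutBy e C {h, q}

/-- A relative calibration datum: a degree two curve contained in all the cones. -/
structure CamConics.IsCalibration {n : ℕ} (X : CamConics.{u} n)
    (C : X.toCam.P.IdealSheafData) : Prop where
  degree_two : X.toCam.IsDegreeTwoCurve C
  subset_cone : ∀ i, X.cone i ≤ C

/-- An object of `CalCam_n`. -/
structure CalCam (n : ℕ) where
  toCamConics : CamConics.{u} n
  curve : toCamConics.toCam.P.IdealSheafData
  isCalibration : toCamConics.IsCalibration curve

/-- Morphisms of `CalCam_n`: the calibrating curve has to be pulled back as well. -/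
@[ext]
structure CalCam.Hom {n : ℕ} (X Y : CalCam.{u} n) where
  toCamConics : X.toCamConics ⟶ Y.toCamConics
  curve : X.curve = Y.curve.comap toCamConics.toCam.hom

instance (n : ℕ) : Category (CalCam.{u} n) where
  Hom := CalCam.Hom
  id X :=
    { toCamConics := 𝟙 _
      curve := by
        change _ = X.curve.comap (𝟙 _)
        rw [Scheme.IdealSheafData.comap_id] }
  comp f g :=
    { toCamConics := f.toCamConics ≫ g.toCamConics
      curve := by
        change _ = Scheme.IdealSheafData.comap _
          (f.toCamConics.toCam.hom ≫ g.toCamConics.toCam.hom)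
        rw [Scheme.IdealSheafData.comap_comp, ← g.curve, ← f.curve] }
  id_comp f := by apply CalCam.Hom.ext; simp
  comp_id f := by apply CalCam.Hom.ext; simp
  assoc f g h := by apply CalCam.Hom.ext; simp

/-- The decalibration morphism `ν_n : CalCam_n ⟶ Cam_n × 𝒞ⁿ`, a functor of categories fibred
over schemes. -/
def decalibration (n : ℕ) : CalCam.{u} n ⥤ CamConics.{u} n where
  obj X := X.toCamConics
  map f := f.toCamConics

/-- The projection `Cam_n × 𝒞ⁿ ⟶ Cam_n`. -/
def forgetConics (n : ℕ) : CamConics.{u} n ⥤ Cam.{u} n where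
  obj X := X.toCam
  map f := f.toCam

/-- The structure functor from `Cam_n` to schemes. -/
def camBase (n : ℕ) : Cam.{u} n ⥤ Scheme.{u} where
  obj X := X.base
  map f := f.base

/-- The structure functor from `CalCam_n` to schemes. -/
def calCamBase (n : ℕ) : CalCam.{u} n ⥤ Scheme.{u} :=
  decalibration n ⋙ forgetConics n ⋙ camBase n

/-! ### Residual curves -/

/-- The residual scheme to `C` in `F`: its ideal sheaf is the quotient `(I_F : I_C)`, the
largest ideal sheaf whose product with `I_C` is contained in `I_F`. -/
def residualIdeal {X : Scheme.{u}} (F C : X.IdealSheafData) : X.IdealSheafData :=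
  sSup {J | J * C ≤ F}

end CalibratedCameras

end

open CalibratedCameras

/-! Everything is local on the base. Over a small affine open, in coordinates where both cameras are
linear, the cone `X_i` is the quadric `Q_i(x) = q_i(A_i x)`
(`CameraData.IsGivenBy.isCutOutBy_cone`). Let `C` be cut out by a linear form `h` and a quadratic
form `p`. The ideal `(h, p)` is saturated (`IsConicEquations.mem_of_pow_mul_mem`), so the inclusions
`C ⊆ X_i` become polynomial identities `Q_i = l_i h + a_i p`. A cone over a smooth conic contains no
plane, hence `a_i` vanishes in no fibre and is a unit. Therefore `(h, p) = (h, Q_0)`, and `a_1 Q_0 -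
a_0 Q_1 = h h'` with `h' = a_1 l_0 - a_0 l_1`. If `h'` vanished in a fibre, the two cones would be
proportional there and would share their vertex, although the centres are disjoint. This is
`exists_isResidualPair`.

Since `h` is a nonzerodivisor modulo `Q_0`, the quotient `((Q_0, Q_1) : (h, Q_0))` is `(h', Q_0)`
(`mem_span_pair_iff_mul_mem`). So the residual curve is again a plane conic lying on both cones. The
description is symmetric in `h` and `h'`, which makes `χ` an involution, and the equations pull back
along the base, which makes it a functor. The residual ideal is defined as a supremum of ideal
sheaves; it can be computed on affine charts because `C` is of finite type
(`residualIdeal_eq_colonIdeal`). The structure `IsLocalModel` collects the local data.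

For the absence of fixed points, an isomorphism `χ(x) ≅ x` over `Spec K` induces an endomorphism of
`P` over the base that respects both cameras. A point off the line joining the centres is determined
by its two images, so this endomorphism is the identity (`chart_comp_eq`), and `C' = C`. Then `h' =
r h`, whence `Q_0 = α Q_1 + β h²` with `α ≠ 0`. Each `Q_i` is invariant under translation by its
vertex `c_i`; evaluating at the vertices and at their sum gives `2 β h(c_0) h(c_1) = 0`. As `2 ≠ 0`,
either `β = 0` or the plane `h = 0` passes through a vertex, and in each case a vertex of one cone
is a singular vector of the other. The vertices then coincide, which is excluded
(`IsSmoothQuadratic.exists_common_vertex`). -/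

noncomputable section

namespace CalibratedCameras

attribute [local instance] MvPolynomial.gradedAlgebra

/-! ### Polynomials that are nonzero in every fibre -/

section Local

open MvPolynomial

variable {n : ℕ}

/-- Over a local ring, a polynomial with nonzero reduction is a nonzerodivisor. -/
theorem eq_zero_of_mul_eq_zero_of_map_residue_ne_zero {L : Type*} [CommRing L] [IsLocalRing L]
    {q g : MvPolynomial (Fin n) L} (hq : map (IsLocalRing.residue L) q ≠ 0) (h : q * g = 0) :
    g = 0 := by
  classical
  let m : MonomialOrder (Fin n) := MonomialOrder.lex
  let 𝔪 := IsLocalRing.maximalIdeal L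
  let J : Ideal L := Ideal.span (g.coeff '' g.support)
  have hgJ (d) : g.coeff d ∈ J := by
    by_cases hd : d ∈ g.support
    · exact Ideal.subset_span ⟨d, hd, rfl⟩
    · rw [notMem_support_iff.mp hd]; exact zero_mem _
  obtain ⟨e₀, he₀⟩ : ∃ e, q.coeff e ∉ 𝔪 := by
    by_contra! hcon
    refine hq (MvPolynomial.ext _ _ fun d => ?_)
    rw [coeff_map, coeff_zero, IsLocalRing.residue_eq_zero_iff]
    exact hcon d
  have hne (p : Ideal L) (f : MvPolynomial (Fin n) L) (d) (hd : f.coeff d ∉ p) :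
      d ∈ f.support := mem_support_iff.mpr fun h0 => hd (h0 ▸ zero_mem _)
  -- Gauss's argument: `e` is the lex-largest exponent of `q` with unit coefficient, and `d` below
  -- the lex-largest one of `g` with coefficient outside `𝔪 * J`. In the coefficient of `q * g` at
  -- `e + d`, all terms but `q_e g_d` lie in `𝔪 * J`.
  obtain ⟨e, he, hemax⟩ := Finset.exists_max_image
    (q.support.filter fun e => q.coeff e ∉ 𝔪) m.toSyn
    ⟨e₀, Finset.mem_filter.mpr ⟨hne _ _ _ he₀, he₀⟩⟩
  rw [Finset.mem_filter] at he
  have key : ∀ d, g.coeff d ∈ 𝔪 * J := by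
    by_contra! hcon
    obtain ⟨d₀, hd₀⟩ := hcon
    obtain ⟨d, hd, hdmax⟩ := Finset.exists_max_image
      (g.support.filter fun e => g.coeff e ∉ 𝔪 * J) m.toSyn
      ⟨d₀, Finset.mem_filter.mpr ⟨hne _ _ _ hd₀, hd₀⟩⟩
    rw [Finset.mem_filter] at hd
    have hc : coeff (e + d) (q * g) = 0 := by rw [h, coeff_zero]
    rw [coeff_mul, ← Finset.add_sum_erase _ _
      (show (e, d) ∈ Finset.HasAntidiagonal.antidiagonal (e + d) by simp)] at hc
    have hmem : ∑ x ∈ (Finset.HasAntidiagonal.antidiagonal (e + d)).erase (e, d), coeff x.1 q * coeff x.2 g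
        ∈ 𝔪 * J := by
      refine Ideal.sum_mem _ fun x hx => ?_
      obtain ⟨hx1, hx2⟩ := Finset.mem_erase.mp hx
      rw [Finset.HasAntidiagonal.mem_antidiagonal] at hx2
      by_cases hxm : q.coeff x.1 ∈ 𝔪
      · exact Ideal.mul_mem_mul hxm (hgJ _)
      · refine Ideal.mul_mem_left _ _ ?_
        by_contra hg
        have h1 := hemax x.1 (Finset.mem_filter.mpr ⟨hne _ _ _ hxm, hxm⟩)
        have h2 := hdmax x.2 (Finset.mem_filter.mpr ⟨hne _ _ _ hg, hg⟩)
        have h3 : m.toSyn x.1 + m.toSyn x.2 = m.toSyn e + m.toSyn d := by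
          rw [← map_add, ← map_add, hx2]
        have h4 : m.toSyn x.1 = m.toSyn e := by
          refine le_antisymm h1 ?_
          by_contra hlt
          exact absurd h3 (add_lt_add_of_lt_of_le (not_le.mp hlt) h2).ne
        rw [h4] at h3
        exact hx1 (Prod.ext (m.toSyn.injective h4) (m.toSyn.injective (add_left_cancel h3)))
    have hunit : IsUnit (q.coeff e) := by
      by_contra hnu
      exact he.2 ((IsLocalRing.mem_maximalIdeal _).mpr hnu)
    refine hd.2 ((Ideal.unit_mul_mem_iff_mem _ hunit).mp ?_)
    rw [eq_neg_of_add_eq_zero_left hc]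
    exact neg_mem hmem
  -- Now `J = 𝔪 J`, and Nakayama applies since `J` is generated by finitely many coefficients; `L`
  -- need not be noetherian.
  have hJ : J = ⊥ := by
    refine Submodule.eq_bot_of_le_smul_of_le_jacobson_bot 𝔪 J
      (Submodule.fg_span (g.support.finite_toSet.image _)) ?_
      (IsLocalRing.maximalIdeal_le_jacobson _)
    rw [Ideal.span_le]
    rintro _ ⟨d, -, rfl⟩
    exact key d
  refine MvPolynomial.ext _ _ fun d => ?_
  have := hgJ d
  rwa [hJ, Ideal.mem_bot] at this

theorem isHomogeneous_one_eq_sum {R : Type*} [CommRing R] {h : MvPolynomial (Fin n) R}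
    (hh : h.IsHomogeneous 1) :
    h = ∑ i, C (h.coeff (Finsupp.single i 1)) * X i := by
  classical
  refine MvPolynomial.ext _ _ fun d => ?_
  simp only [coeff_sum, coeff_C_mul, coeff_X, mul_ite, mul_one, mul_zero]
  by_cases hd : d.degree = 1
  · obtain ⟨i, rfl⟩ : ∃ i, d = Finsupp.single i 1 := by
      have hd0 : d ≠ 0 := by rintro rfl; simp at hd
      obtain ⟨i, hi⟩ := Finsupp.ne_iff.mp hd0
      rw [Finsupp.coe_zero, Pi.zero_apply] at hi
      refine ⟨i, ?_⟩
      have h1 : Finsupp.single i 1 ≤ d := by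
        rw [Finsupp.single_le_iff]; omega
      have h2 := congrArg Finsupp.degree (add_tsub_cancel_of_le h1)
      rw [map_add, hd, Finsupp.degree_single, Nat.add_eq_left, Finsupp.degree_eq_zero_iff] at h2
      rw [← add_tsub_cancel_of_le h1, h2, add_zero]
    rw [Finset.sum_eq_single i]
    · simp
    · intro j _ hj
      simp [Finsupp.single_left_inj, hj]
    · simp
  · rw [hh.coeff_eq_zero hd, Finset.sum_eq_zero]
    intro i _
    rw [if_neg]
    rintro rfl
    simp at hd

/-- The substitution that eliminates the variable `X k` by means of the linear form `h`, where
`u` is the inverse of the coefficient of `X k` in `h`. -/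
def elimVar {R : Type*} [CommRing R] (h : MvPolynomial (Fin n) R) (k : Fin n) (u : R) :
    MvPolynomial (Fin n) R →ₐ[R] MvPolynomial (Fin n) R :=
  aeval fun i => if i = k then X k - C u * h else X i

theorem elimVar_X_of_ne {R : Type*} [CommRing R] (h : MvPolynomial (Fin n) R) {k i : Fin n}
    (u : R) (hi : i ≠ k) : elimVar h k u (X i) = X i := by
  simp [elimVar, hi]

theorem elimVar_self {R : Type*} [CommRing R] {h : MvPolynomial (Fin n) R}
    (hh : h.IsHomogeneous 1) {k : Fin n} {u : R} (hu : u * h.coeff (Finsupp.single k 1) = 1) :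
    elimVar h k u h = 0 := by
  have h1 : elimVar h k u h =
      ∑ i, C (h.coeff (Finsupp.single i 1)) * elimVar h k u (X i) := by
    conv_lhs => rw [isHomogeneous_one_eq_sum hh]
    simp only [map_sum, map_mul, algHom_C, algebraMap_eq]
    rw [← isHomogeneous_one_eq_sum hh]
  have h2 : ∀ i, C (h.coeff (Finsupp.single i 1)) * elimVar h k u (X i) =
      C (h.coeff (Finsupp.single i 1)) * X i - if i = k then h else 0 := by
    intro i
    by_cases hi : i = k
    · subst hi
      simp only [elimVar, aeval_X, if_true, mul_sub]
      rw [← mul_assoc, ← C_mul, mul_comm _ u, hu, C_1, one_mul]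
    · simp [elimVar_X_of_ne h u hi, hi]
  rw [h1, Finset.sum_congr rfl fun i _ => h2 i, Finset.sum_sub_distrib,
    ← isHomogeneous_one_eq_sum hh]
  simp

/-- Modulo `h` the substitution fixes every variable, so it induces the identity on the quotient. -/
theorem dvd_sub_elimVar {R : Type*} [CommRing R] (h : MvPolynomial (Fin n) R) (k : Fin n) (u : R)
    (f : MvPolynomial (Fin n) R) : h ∣ f - elimVar h k u f := by
  rw [← Ideal.mem_span_singleton, ← Ideal.Quotient.mk_eq_mk_iff_sub_mem]
  have : (Ideal.Quotient.mkₐ R (Ideal.span {h})) =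
      (Ideal.Quotient.mkₐ R (Ideal.span {h})).comp (elimVar h k u) := by
    refine MvPolynomial.algHom_ext fun i => ?_
    by_cases hi : i = k
    · subst hi
      simp only [AlgHom.comp_apply, elimVar, aeval_X, if_true, Ideal.Quotient.mkₐ_eq_mk]
      rw [Ideal.Quotient.mk_eq_mk_iff_sub_mem, sub_sub_cancel]
      exact Ideal.mul_mem_left _ _ (Ideal.mem_span_singleton_self _)
    · simp [elimVar_X_of_ne h u hi]
  exact DFunLike.congr_fun this f

/-- `elimVar` is a ring endomorphism with kernel `(h)`. It turns questions modulo `h` into questions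
in the polynomial ring itself, where the nonzerodivisor criterion above is available. -/
theorem dvd_iff_elimVar_eq_zero {R : Type*} [CommRing R] {h : MvPolynomial (Fin n) R}
    (hh : h.IsHomogeneous 1) {k : Fin n} {u : R} (hu : u * h.coeff (Finsupp.single k 1) = 1)
    (f : MvPolynomial (Fin n) R) : h ∣ f ↔ elimVar h k u f = 0 := by
  constructor
  · rintro ⟨g, rfl⟩
    rw [map_mul, elimVar_self hh hu, zero_mul]
  · intro hf
    simpa [hf] using dvd_sub_elimVar h k u f

theorem map_elimVar {R S : Type*} [CommRing R] [CommRing S] (φ : R →+* S)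
    (h : MvPolynomial (Fin n) R) (k : Fin n) (u : R) (f : MvPolynomial (Fin n) R) :
    map φ (elimVar h k u f) = elimVar (map φ h) k (φ u) (map φ f) := by
  induction f using MvPolynomial.induction_on with
  | C a => simp only [elimVar, algHom_C, algebraMap_eq, map_C]
  | add p q hp hq => simp only [map_add, hp, hq]
  | mul_X p i hp =>
    simp only [map_mul, hp, map_X]
    congr 1
    by_cases hi : i = k
    · subst hi; simp [elimVar]
    · simp [elimVar, hi]

/-- Over a local ring a coefficient with nonzero residue is a unit; this is what allows a variable
to be eliminated. -/
theorem exists_mul_coeff_eq_one {L : Type*} [CommRing L] [IsLocalRing L]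
    {h : MvPolynomial (Fin n) L} (hh : h.IsHomogeneous 1)
    (h0 : map (IsLocalRing.residue L) h ≠ 0) :
    ∃ k u, u * h.coeff (Finsupp.single k 1) = 1 := by
  by_contra! hcon
  refine h0 ?_
  rw [isHomogeneous_one_eq_sum (hh.map _)]
  refine Finset.sum_eq_zero fun k _ => ?_
  have : ¬ IsUnit (h.coeff (Finsupp.single k 1)) := fun hu => by
    obtain ⟨u, hu⟩ := hu.exists_left_inv
    exact hcon k u hu
  rw [coeff_map, (IsLocalRing.residue_eq_zero_iff _).mpr
    ((IsLocalRing.mem_maximalIdeal _).mpr this), C_0, zero_mul]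

theorem dvd_of_dvd_mul_of_isLocalRing {L : Type*} [CommRing L] [IsLocalRing L]
    {h q f : MvPolynomial (Fin n) L} (hh : h.IsHomogeneous 1)
    (h0 : map (IsLocalRing.residue L) h ≠ 0)
    (hq : ¬ map (IsLocalRing.residue L) h ∣ map (IsLocalRing.residue L) q)
    (hf : h ∣ q * f) : h ∣ f := by
  obtain ⟨k, u, hu⟩ := exists_mul_coeff_eq_one hh h0
  rw [dvd_iff_elimVar_eq_zero hh hu] at hf ⊢
  rw [map_mul] at hf
  refine eq_zero_of_mul_eq_zero_of_map_residue_ne_zero (fun h1 => hq ?_) hf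
  rw [map_elimVar] at h1
  rwa [dvd_iff_elimVar_eq_zero (hh.map _)]
  rw [coeff_map, ← map_mul, hu, map_one]

/-- Saturation over a local ring: a polynomial that lies in `(h, q)` after multiplication by
powers of all the variables lies in `(h, q)`. -/
theorem mem_span_pair_of_pow_mul_mem_of_isLocalRing {L : Type*} [CommRing L] [IsLocalRing L]
    {h q f : MvPolynomial (Fin 4) L} (hh : h.IsHomogeneous 1) (hqh : q.IsHomogeneous 2)
    (h0 : map (IsLocalRing.residue L) h ≠ 0)
    (hq : ¬ map (IsLocalRing.residue L) h ∣ map (IsLocalRing.residue L) q)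
    (hf : ∀ j, ∃ N : ℕ, X j ^ N * f ∈ Ideal.span {h, q}) : f ∈ Ideal.span {h, q} := by
  classical
  obtain ⟨k, u, hu⟩ := exists_mul_coeff_eq_one hh h0
  set φ := IsLocalRing.residue L
  have hu' : φ u * (map φ h).coeff (Finsupp.single k 1) = 1 := by
    rw [coeff_map, ← map_mul, hu, map_one]
  have hσ : map φ (elimVar h k u q) ≠ 0 := by
    rwa [map_elimVar, ne_eq, ← dvd_iff_elimVar_eq_zero (hh.map _) hu']
  have hσh : (map φ (elimVar h k u q)).IsHomogeneous 2 := by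
    rw [map_elimVar]
    refine ((hqh.map φ).eval₂ _ _ (fun r => isHomogeneous_C _ _) (n := 1) fun i => ?_)

    split_ifs
    · exact (isHomogeneous_X _ _).sub (by simpa using (hh.map φ).C_mul (φ u))
    · exact isHomogeneous_X _ _
  -- If all three variables other than `X k` divided the eliminated quadric, each of its monomials
  -- would have degree at least three.
  obtain ⟨j, hjk, hj⟩ : ∃ j, j ≠ k ∧ ¬ X j ∣ map φ (elimVar h k u q) := by
    by_contra! hcon
    obtain ⟨d, hd⟩ := support_nonempty.mpr hσ
    have hdeg : d.degree = 2 := by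
      by_contra hne
      exact mem_support_iff.mp hd (hσh.coeff_eq_zero hne)
    have hd1 : ∀ j, j ≠ k → 1 ≤ d j := by
      intro j hjk
      obtain ⟨g, hg⟩ := hcon j hjk
      rw [mem_support_iff, hg, mul_comm, coeff_mul_X'] at hd
      by_contra h0
      rw [if_neg (by simp; omega)] at hd
      exact hd rfl
    have hsum : d.degree = ∑ i, d i := by
      rw [Finsupp.degree_eq_sum]
    rw [hsum, Fin.sum_univ_four] at hdeg
    have h4 := fun j hj => hd1 j hj
    have a0 := h4 0; have a1 := h4 1; have a2 := h4 2; have a3 := h4 3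
    fin_cases k <;> simp at a0 a1 a2 a3 <;> omega
  have hX : map φ (X j : MvPolynomial (Fin 4) L) ≠ 0 := by rw [map_X]; exact X_ne_zero j
  -- `X j` is a nonzerodivisor modulo `(h, q)`: after elimination `X j * g = b * q`, and as `X j`
  -- does not divide the reduction of `q` it divides `b` and cancels.
  have step : ∀ g, X j * g ∈ Ideal.span {h, q} → g ∈ Ideal.span {h, q} := by
    intro g hg
    obtain ⟨a, b, hab⟩ := Ideal.mem_span_pair.mp hg
    have h1 := congrArg (elimVar h k u) hab
    rw [map_add, map_mul, map_mul, map_mul, elimVar_self hh hu, mul_zero, zero_add,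
      elimVar_X_of_ne _ _ hjk] at h1
    obtain ⟨b', hb'⟩ : X j ∣ elimVar h k u b :=
      dvd_of_dvd_mul_of_isLocalRing (q := elimVar h k u q) (isHomogeneous_X _ _) hX
        (by rwa [map_X]) ⟨_, by rw [mul_comm, h1]⟩
    have h2 : elimVar h k u g = b' * elimVar h k u q := by
      rw [← sub_eq_zero]
      refine eq_zero_of_mul_eq_zero_of_map_residue_ne_zero hX ?_
      rw [mul_sub, ← h1, hb']
      ring
    obtain ⟨r, hr⟩ := dvd_sub_elimVar h k u g
    obtain ⟨s, hs⟩ := dvd_sub_elimVar h k u q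
    refine Ideal.mem_span_pair.mpr ⟨r - b' * s, b', ?_⟩
    linear_combination b' * hs - hr - h2
  obtain ⟨N, hN⟩ := hf j
  clear hf
  induction N with
  | zero => simpa using hN
  | succ N ih => exact ih (step _ (by rwa [← mul_assoc, ← pow_succ']))

end Local

/-! ### From local rings to arbitrary rings: regular sequences, saturation, graded pieces -/

section Global

open MvPolynomial

variable {n : ℕ}

/-- A polynomial lies in an ideal of a polynomial ring over `R` if it does so over the local
rings of `R`. -/
theorem mem_of_forall_atPrime {R : Type u} [CommRing R] {σ : Type} (I : Ideal (MvPolynomial σ R))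
    (f : MvPolynomial σ R)
    (H : ∀ (𝔪 : Ideal R) [𝔪.IsPrime],
      map (algebraMap R (Localization.AtPrime 𝔪)) f ∈
        I.map (map (algebraMap R (Localization.AtPrime 𝔪)))) : f ∈ I := by
  -- The scalars carrying `f` into `I` form an ideal; if it were proper, localizing at a maximal
  -- ideal above it would give a contradiction.
  let J : Ideal R := (Submodule.colon I {f}).comap C
  have hJ : J = ⊤ := by
    by_contra hne
    obtain ⟨𝔪, hm, hJm⟩ := J.exists_le_maximal hne
    have := hm.isPrime
    have h1 := H 𝔪
    let : Algebra (MvPolynomial σ R) (MvPolynomial σ (Localization.AtPrime 𝔪)) :=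
      MvPolynomial.algebraMvPolynomial
    have h2 : algebraMap (MvPolynomial σ R) (MvPolynomial σ (Localization.AtPrime 𝔪)) f ∈
        I.map (algebraMap (MvPolynomial σ R) (MvPolynomial σ (Localization.AtPrime 𝔪))) := h1
    rw [← IsLocalization.mk'_one (M := 𝔪.primeCompl.map (C (σ := σ))),
      IsLocalization.mk'_mem_map_algebraMap_iff] at h2
    obtain ⟨_, ⟨s, hs, rfl⟩, hsf⟩ := h2
    refine hs (hJm ?_)
    simpa [J, Ideal.mem_comap, Submodule.mem_colon_singleton] using hsf
  have h1 : (1 : R) ∈ J := hJ ▸ Submodule.mem_top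
  simpa [J, Ideal.mem_comap, Submodule.mem_colon_singleton] using h1

/-- The reduction of a polynomial at a prime ideal. -/
theorem map_residue_map_algebraMap {R : Type u} [CommRing R] {σ : Type} (𝔪 : Ideal R)
    [𝔪.IsPrime] (f : MvPolynomial σ R) :
    map (IsLocalRing.residue (Localization.AtPrime 𝔪))
      (map (algebraMap R (Localization.AtPrime 𝔪)) f) =
    map ((IsLocalRing.residue (Localization.AtPrime 𝔪)).comp
      (algebraMap R (Localization.AtPrime 𝔪))) f := map_map _ _ _

theorem eq_zero_of_mul_eq_zero_of_forall_map_ne_zero {R : Type u} [CommRing R]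
    {q g : MvPolynomial (Fin n) R}
    (hq : ∀ (K : Type u) [Field K] (f : R →+* K), map f q ≠ 0) (h : q * g = 0) : g = 0 := by
  rw [← Ideal.mem_bot]
  refine mem_of_forall_atPrime _ _ fun 𝔪 _ => ?_
  rw [Ideal.map_bot, Ideal.mem_bot]
  refine eq_zero_of_mul_eq_zero_of_map_residue_ne_zero
    (q := map (algebraMap R (Localization.AtPrime 𝔪)) q) ?_ (by rw [← map_mul, h, map_zero])
  rw [map_residue_map_algebraMap]
  exact hq _ _

/-- If a linear form `h` is nonzero and does not divide `q` in any fibre, then `q` is a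
nonzerodivisor modulo `h`. -/
theorem dvd_of_dvd_mul_of_forall_not_dvd {R : Type u} [CommRing R]
    {h q f : MvPolynomial (Fin n) R} (hh : h.IsHomogeneous 1)
    (hq : ∀ (K : Type u) [Field K] (f : R →+* K), map f h ≠ 0 ∧ ¬ map f h ∣ map f q)
    (hf : h ∣ q * f) : h ∣ f := by
  rw [← Ideal.mem_span_singleton]
  refine mem_of_forall_atPrime _ _ fun 𝔪 _ => ?_
  rw [Ideal.map_span, Set.image_singleton, Ideal.mem_span_singleton]
  refine dvd_of_dvd_mul_of_isLocalRing (q := map (algebraMap R (Localization.AtPrime 𝔪)) q)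
    (hh.map _) ?_ ?_ (by rw [← map_mul]; exact map_dvd _ hf)
  all_goals simp only [map_residue_map_algebraMap]
  exacts [(hq _ _).1, (hq _ _).2]

/-- If a linear form `h` is nonzero and does not divide `q` in any fibre, then `h` is a
nonzerodivisor modulo `q`. -/
theorem dvd_of_dvd_linear_mul_of_forall_not_dvd {R : Type u} [CommRing R]
    {h q f : MvPolynomial (Fin n) R} (hh : h.IsHomogeneous 1)
    (hq : ∀ (K : Type u) [Field K] (f : R →+* K), map f h ≠ 0 ∧ ¬ map f h ∣ map f q)
    (hf : q ∣ h * f) : q ∣ f := by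
  obtain ⟨g, hg⟩ := hf
  -- The regular sequence `h, q` is permuted: `h f = q g` forces `h ∣ g`, and then `h` cancels.
  obtain ⟨g', rfl⟩ := dvd_of_dvd_mul_of_forall_not_dvd (f := g) hh hq ⟨f, hg.symm⟩
  refine ⟨g', ?_⟩
  rw [← sub_eq_zero]
  refine eq_zero_of_mul_eq_zero_of_forall_map_ne_zero (q := h) (fun K _ φ => (hq K φ).1) ?_
  rw [mul_sub, hg]
  ring

/-- The ideal of a relative conic in `ℙ³` is saturated. -/
theorem IsConicEquations.mem_of_pow_mul_mem {R : Type u} [CommRing R]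
    {h q f : MvPolynomial (Fin 4) R} (H : IsConicEquations h q)
    (hf : ∀ j, ∃ N : ℕ, X j ^ N * f ∈ Ideal.span {h, q}) : f ∈ Ideal.span {h, q} := by
  refine mem_of_forall_atPrime _ _ fun 𝔪 _ => ?_
  rw [Ideal.map_span, Set.image_pair]
  refine mem_span_pair_of_pow_mul_mem_of_isLocalRing (H.1.map _) (H.2.1.map _) ?_ ?_ fun j => ?_
  · rw [map_residue_map_algebraMap]; exact (H.2.2 _ _).1
  · rw [map_residue_map_algebraMap, map_residue_map_algebraMap]; exact (H.2.2 _ _).2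
  · obtain ⟨N, hN⟩ := hf j
    refine ⟨N, ?_⟩
    have := Ideal.mem_map_of_mem (map (algebraMap R (Localization.AtPrime 𝔪))) hN
    rwa [map_mul, map_pow, map_X, Ideal.map_span, Set.image_pair] at this

theorem homogeneousComponent_mul_of_isHomogeneous {R σ : Type*} [CommRing R]
    {p : MvPolynomial σ R} {m : ℕ} (hp : p.IsHomogeneous m) (f : MvPolynomial σ R) (k : ℕ) :
    homogeneousComponent (k + m) (f * p) = homogeneousComponent k f * p := by
  classical
  conv_lhs => rw [← sum_homogeneousComponent f, Finset.sum_mul, map_sum]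
  by_cases hk : k ∈ Finset.range (f.totalDegree + 1)
  · rw [Finset.sum_eq_single_of_mem k hk]
    · exact homogeneousComponent_eq_self
        ((mem_homogeneousSubmodule _ _).mpr ((homogeneousComponent_isHomogeneous k f).mul hp))
    · intro i _ hik
      rw [homogeneousComponent_of_mem ((mem_homogeneousSubmodule _ _).mpr
        ((homogeneousComponent_isHomogeneous i f).mul hp)), if_neg (by omega)]
  · rw [homogeneousComponent_eq_zero _ f (by simpa [Nat.lt_succ_iff] using hk), zero_mul]
    refine Finset.sum_eq_zero fun i hi => ?_
    rw [homogeneousComponent_of_mem ((mem_homogeneousSubmodule _ _).mpr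
        ((homogeneousComponent_isHomogeneous i f).mul hp)), if_neg]
    rintro h
    exact hk (by rwa [show k = i by omega])

/-- In degree two only the linear part of the multiplier of `h` and the constant term of the
multiplier of `q` contribute. -/
theorem exists_of_quadratic_mem_span {R σ : Type*} [CommRing R] {h q f : MvPolynomial σ R}
    (hh : h.IsHomogeneous 1) (hq : q.IsHomogeneous 2) (hf : f.IsHomogeneous 2)
    (hmem : f ∈ Ideal.span {h, q}) :
    ∃ l : MvPolynomial σ R, l.IsHomogeneous 1 ∧ ∃ a : R, f = l * h + C a * q := by
  obtain ⟨u, v, huv⟩ := Ideal.mem_span_pair.mp hmem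
  refine ⟨homogeneousComponent 1 u, homogeneousComponent_isHomogeneous _ _, coeff 0 v, ?_⟩
  have := congrArg (homogeneousComponent 2) huv
  rw [homogeneousComponent_eq_self ((mem_homogeneousSubmodule _ _).mpr hf), map_add,
    homogeneousComponent_mul_of_isHomogeneous hh u 1,
    homogeneousComponent_mul_of_isHomogeneous hq v 0, homogeneousComponent_zero] at this
  exact this.symm

theorem exists_of_linear_mem_span {R σ : Type*} [CommRing R] {h q f : MvPolynomial σ R}
    (hh : h.IsHomogeneous 1) (hq : q.IsHomogeneous 2) (hf : f.IsHomogeneous 1)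
    (hmem : f ∈ Ideal.span {h, q}) : ∃ a : R, f = C a * h := by
  obtain ⟨u, v, huv⟩ := Ideal.mem_span_pair.mp hmem
  refine ⟨coeff 0 u, ?_⟩
  have := congrArg (homogeneousComponent 1) huv
  have h0 : homogeneousComponent 1 (v * q) = 0 := by
    conv_lhs => rw [← sum_homogeneousComponent v, Finset.sum_mul, map_sum]
    refine Finset.sum_eq_zero fun i _ => ?_
    rw [homogeneousComponent_of_mem ((mem_homogeneousSubmodule _ _).mpr
        ((homogeneousComponent_isHomogeneous i v).mul hq)), if_neg (by omega)]
  rw [homogeneousComponent_eq_self ((mem_homogeneousSubmodule _ _).mpr hf), map_add, h0, add_zero,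
    homogeneousComponent_mul_of_isHomogeneous hh u 0, homogeneousComponent_zero] at this
  exact this.symm

theorem isUnit_of_forall_map_ne_zero {R : Type u} [CommRing R] {a : R}
    (h : ∀ (K : Type u) [Field K] (f : R →+* K), f a ≠ 0) : IsUnit a := by
  by_contra ha
  obtain ⟨𝔪, hm, ham⟩ := exists_max_ideal_of_mem_nonunits ha
  let := Ideal.Quotient.field 𝔪
  exact h (R ⧸ 𝔪) (Ideal.Quotient.mk 𝔪) (Ideal.Quotient.eq_zero_iff_mem.mpr ham)

end Global

/-! ### Quadratic cones over smooth conics and their vertices -/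

section Quadratic

open MvPolynomial

/-- The quadratic form defining the cone over the conic `q = 0` with respect to the camera with
matrix `A`. -/
def coneForm {R : Type*} [CommRing R] (A : Matrix (Fin 3) (Fin 4) R) (q : MvPolynomial (Fin 3) R) :
    MvPolynomial (Fin 4) R :=
  aeval (fun i => ∑ j, C (A i j) * X j) q

theorem eval₂_coneForm {R S : Type*} [CommRing R] [CommRing S] (f : R →+* S) (x : Fin 4 → S)
    (A : Matrix (Fin 3) (Fin 4) R) (q : MvPolynomial (Fin 3) R) :
    eval₂ f x (coneForm A q) = eval₂ f ((A.map f).mulVec x) q := by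
  rw [← coe_eval₂Hom, ← coe_eval₂Hom, coneForm, aeval_def, algebraMap_eq, ← coe_eval₂Hom,
    ← RingHom.comp_apply]
  congr 1
  refine MvPolynomial.ringHom_ext (fun r => by simp) fun i => ?_
  simp [Matrix.mulVec, dotProduct]

theorem map_coneForm {R S : Type*} [CommRing R] [CommRing S] (f : R →+* S)
    (A : Matrix (Fin 3) (Fin 4) R) (q : MvPolynomial (Fin 3) R) :
    map f (coneForm A q) = coneForm (A.map f) (map f q) := by
  rw [coneForm, coneForm, aeval_def, aeval_def, algebraMap_eq, algebraMap_eq,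
    ← coe_eval₂Hom, ← coe_eval₂Hom, ← RingHom.comp_apply, ← RingHom.comp_apply]
  congr 1
  refine MvPolynomial.ringHom_ext (fun r => by simp) fun i => ?_
  simp

theorem isHomogeneous_coneForm {R : Type*} [CommRing R] {A : Matrix (Fin 3) (Fin 4) R}
    {q : MvPolynomial (Fin 3) R} (hq : q.IsHomogeneous 2) : (coneForm A q).IsHomogeneous 2 := by
  refine hq.eval₂ _ _ (fun r => isHomogeneous_C _ _) (n := 1) fun i => ?_
  exact IsHomogeneous.sum _ _ _ fun j _ => isHomogeneous_C_mul_X _ _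

theorem surjective_mulVec_map {R S : Type*} [CommRing R] [CommRing S] (f : R →+* S)
    {m n : ℕ} {A : Matrix (Fin m) (Fin n) R} (hA : Function.Surjective fun v => A.mulVec v) :
    Function.Surjective fun v => (A.map f).mulVec v := by
  obtain ⟨B, hB⟩ := (Matrix.mulVec_surjective_iff_exists_right_inverse).mp hA
  refine (Matrix.mulVec_surjective_iff_exists_right_inverse).mpr ⟨B.map f, ?_⟩
  rw [← Matrix.map_mul, hB, Matrix.map_one _ f.map_zero f.map_one]

/-- Expansion of a quadratic form at a sum. -/
theorem eval_add_of_isHomogeneous_two {R : Type*} [CommRing R] {n : ℕ}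
    {q : MvPolynomial (Fin n) R} (hq : q.IsHomogeneous 2) (v w : Fin n → R) :
    eval (v + w) q = eval v q + ∑ i, w i * eval v (pderiv i q) + eval w q := by
  -- Both sides are additive and `R`-linear in `q`, so products of two variables suffice. The linear
  -- term is the polarization, obtained without dividing by two.
  have hmem : q ∈ homogeneousSubmodule (Fin n) R 1 ^ 2 := by
    rw [homogeneousSubmodule_one_pow]; exact (mem_homogeneousSubmodule _ _).mpr hq
  rw [pow_two, homogeneousSubmodule_one_eq_span_X, Submodule.span_mul_span] at hmem
  refine Submodule.span_induction ?_ (by simp) ?_ ?_ hmem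
  · rintro _ ⟨_, ⟨a, rfl⟩, _, ⟨b, rfl⟩, rfl⟩
    have hs (a : Fin n) (c : R) :
        ∑ i, w i * (c * eval v (Pi.single (M := fun _ => MvPolynomial (Fin n) R) i 1 a)) = w a * c := by
      rw [Finset.sum_eq_single a]
      · simp
      · intro i _ hi
        simp [Pi.single_eq_of_ne' hi]
      · simp
    simp only [map_mul, eval_X, Derivation.leibniz, pderiv_X, map_add, smul_eq_mul, mul_add,
      Finset.sum_add_distrib, hs, Pi.add_apply]
    ring
  · intro p q _ _ hp hq
    simp only [map_add, hp, hq, mul_add, Finset.sum_add_distrib]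
    ring
  · intro r p _ hp
    simp only [smul_eval, Derivation.map_smul, hp, mul_add, Finset.mul_sum]
    simp [mul_left_comm]

theorem eval_map_coneForm {R S : Type*} [CommRing R] [CommRing S] (f : R →+* S) (x : Fin 4 → S)
    (A : Matrix (Fin 3) (Fin 4) R) (q : MvPolynomial (Fin 3) R) :
    eval x (map f (coneForm A q)) = eval ((A.map f).mulVec x) (map f q) := by
  rw [MvPolynomial.eval_map, MvPolynomial.eval_map, eval₂_coneForm]

/-- A singular vector of a smooth ternary quadratic form vanishes. -/
theorem IsSmoothQuadratic.eq_zero {R : Type u} [CommRing R] {q : MvPolynomial (Fin 3) R}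
    (hq : IsSmoothQuadratic q) {K : Type u} [Field K] (f : R →+* K) {v : Fin 3 → K}
    (h0 : eval v (map f q) = 0) (h : ∀ w, eval (v + w) (map f q) = eval w (map f q)) :
    v = 0 := by
  refine hq.2 K f v (by rwa [← MvPolynomial.eval_map]) fun i => ?_
  -- Translation invariance along the `i`-th basis vector says that the `i`-th partial derivative
  -- vanishes at `v`.
  have := h (Pi.single i 1)
  rw [eval_add_of_isHomogeneous_two (hq.1.map f), h0, zero_add, add_eq_right] at this
  rw [← MvPolynomial.eval_map, ← pderiv_map]
  simpa [Pi.single_apply] using this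

/-- A singular vector of a cone over a smooth conic lies over zero. -/
theorem IsSmoothQuadratic.mulVec_eq_zero {R : Type u} [CommRing R] {q : MvPolynomial (Fin 3) R}
    (hq : IsSmoothQuadratic q) {A : Matrix (Fin 3) (Fin 4) R}
    (hA : Function.Surjective fun v => A.mulVec v)
    {K : Type u} [Field K] (f : R →+* K) {v : Fin 4 → K}
    (h0 : eval v (map f (coneForm A q)) = 0)
    (h : ∀ w, eval (v + w) (map f (coneForm A q)) = eval w (map f (coneForm A q))) :
    (A.map f).mulVec v = 0 := by
  simp only [eval_map_coneForm, Matrix.mulVec_add] at h0 h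
  refine hq.eq_zero f h0 fun w => ?_
  obtain ⟨w, rfl⟩ := surjective_mulVec_map f hA w
  exact h w

theorem eval_coneForm_add_of_mulVec_eq_zero {R K : Type*} [CommRing R] [CommRing K]
    {q : MvPolynomial (Fin 3) R} {A : Matrix (Fin 3) (Fin 4) R} (f : R →+* K) {v : Fin 4 → K}
    (hv : (A.map f).mulVec v = 0) (w : Fin 4 → K) :
    eval (v + w) (map f (coneForm A q)) = eval w (map f (coneForm A q)) := by
  simp only [MvPolynomial.eval_map, eval₂_coneForm, Matrix.mulVec_add, hv, zero_add]

/-- By translation invariance the value at a vertex is the value at the origin, that is, the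
constant term. -/
theorem eval_coneForm_of_mulVec_eq_zero {R K : Type*} [CommRing R] [CommRing K]
    {q : MvPolynomial (Fin 3) R} (hq : q.IsHomogeneous 2)
    {A : Matrix (Fin 3) (Fin 4) R} (f : R →+* K) {v : Fin 4 → K}
    (hv : (A.map f).mulVec v = 0) : eval v (map f (coneForm A q)) = 0 := by
  have h := eval_coneForm_add_of_mulVec_eq_zero (q := q) f hv 0
  rw [add_zero] at h
  rw [h]
  have h2 : constantCoeff (map f (coneForm A q)) = 0 := by
    rw [constantCoeff_eq]
    exact ((isHomogeneous_coneForm (A := A) hq).map f).coeff_eq_zero (by simp)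
  rw [← h2, eval_zero]

theorem eval_linear_add {R : Type*} [CommRing R] {n : ℕ} {h : MvPolynomial (Fin n) R}
    (hh : h.IsHomogeneous 1) (v w : Fin n → R) : eval (v + w) h = eval v h + eval w h := by
  rw [isHomogeneous_one_eq_sum hh]
  simp [mul_add, Finset.sum_add_distrib]

theorem eval_linear_eq_dotProduct {R : Type*} [CommRing R] {n : ℕ} {h : MvPolynomial (Fin n) R}
    (hh : h.IsHomogeneous 1) (v : Fin n → R) :
    eval v h = ∑ i, h.coeff (Finsupp.single i 1) * v i := by
  conv_lhs => rw [isHomogeneous_one_eq_sum hh]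
  simp

/-- The kernel of a camera matrix over a field is a line. -/
theorem finrank_ker_of_surjective {K : Type*} [Field K] {A : Matrix (Fin 3) (Fin 4) K}
    (hA : Function.Surjective fun v => A.mulVec v) :
    Module.finrank K (LinearMap.ker A.mulVecLin) = 1 := by
  have h1 := A.mulVecLin.finrank_range_add_finrank_ker
  have h2 : LinearMap.range A.mulVecLin = ⊤ := LinearMap.range_eq_top.mpr hA
  rw [h2, finrank_top] at h1
  simp at h1
  omega

theorem exists_smul_eq_of_mulVec_eq_zero {K : Type*} [Field K] {A : Matrix (Fin 3) (Fin 4) K}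
    (hA : Function.Surjective fun v => A.mulVec v) {c v : Fin 4 → K} (hc : c ≠ 0)
    (hAc : A.mulVec c = 0) (hv : A.mulVec v = 0) : ∃ a : K, a • c = v := by
  have h := (finrank_eq_one_iff_of_nonzero' (⟨c, hAc⟩ : LinearMap.ker A.mulVecLin)
    (fun h0 => hc (congrArg Subtype.val h0))).mp (finrank_ker_of_surjective hA) ⟨v, hv⟩
  obtain ⟨a, ha⟩ := h
  exact ⟨a, congrArg Subtype.val ha⟩

/-- A cone over a smooth conic contains no plane. -/
theorem IsSmoothQuadratic.not_dvd_coneForm {R : Type u} [CommRing R] {q : MvPolynomial (Fin 3) R}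
    (hq : IsSmoothQuadratic q) {A : Matrix (Fin 3) (Fin 4) R}
    (hA : Function.Surjective fun v => A.mulVec v)
    {K : Type u} [Field K] (f : R →+* K) {h : MvPolynomial (Fin 4) K} (hh : h.IsHomogeneous 1) :
    ¬ h ∣ map f (coneForm A q) := by
  rintro ⟨l, hl⟩
  -- The cofactor is not assumed homogeneous; comparing degrees replaces it by its linear part.
  have hl' : map f (coneForm A q) = homogeneousComponent 1 l * h := by
    rw [← homogeneousComponent_mul_of_isHomogeneous hh, mul_comm l, ← hl]
    exact (homogeneousComponent_eq_self ((mem_homogeneousSubmodule _ _).mpr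
      ((isHomogeneous_coneForm hq.1).map f))).symm
  have hl1 := homogeneousComponent_isHomogeneous 1 l
  set l' := homogeneousComponent 1 l
  let Φ : (Fin 4 → K) →ₗ[K] (Fin 2 → K) := LinearMap.pi
    ![∑ i, (h.coeff (Finsupp.single i 1)) • LinearMap.proj i,
      ∑ i, (l'.coeff (Finsupp.single i 1)) • LinearMap.proj i]
  have hΦ : ∀ v, Φ v = 0 → eval v h = 0 ∧ eval v l' = 0 := by
    intro v hv
    have h0 := congrFun hv 0
    have h1 := congrFun hv 1
    rw [eval_linear_eq_dotProduct hh, eval_linear_eq_dotProduct hl1]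
    simp [Φ] at h0 h1
    exact ⟨h0, h1⟩
  -- A product of two linear forms is singular along their common zeros, a space of dimension at
  -- least two, whereas the singular vectors of the cone lie in the one-dimensional kernel of the
  -- camera.
  have hsub : LinearMap.ker Φ ≤ LinearMap.ker (A.map f).mulVecLin := by
    intro v hv
    obtain ⟨h0, h1⟩ := hΦ v hv
    refine hq.mulVec_eq_zero hA f ?_ fun w => ?_
    · rw [hl', map_mul, h0, mul_zero]
    · rw [hl', map_mul, map_mul, eval_linear_add hh, eval_linear_add hl1, h0, h1, zero_add,
        zero_add]
  have h1 := Submodule.finrank_mono hsub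
  rw [finrank_ker_of_surjective (surjective_mulVec_map f hA)] at h1
  have h2 := Φ.finrank_range_add_finrank_ker
  have h3 := Submodule.finrank_le (LinearMap.range Φ)
  simp at h2 h3
  omega

/-- Two proportional cones over smooth conics have the same vertex. -/
theorem IsSmoothQuadratic.mulVec_eq_zero_of_proportional {R : Type u} [CommRing R]
    {q₁ q₂ : MvPolynomial (Fin 3) R} (hq₁ : IsSmoothQuadratic q₁) (hq₂ : IsSmoothQuadratic q₂)
    {A₁ A₂ : Matrix (Fin 3) (Fin 4) R} (hA₁ : Function.Surjective fun v => A₁.mulVec v)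
    {K : Type u} [Field K] (f : R →+* K) {a : K}
    (h : map f (coneForm A₁ q₁) = C a * map f (coneForm A₂ q₂))
    {c : Fin 4 → K} (hc : (A₂.map f).mulVec c = 0) : (A₁.map f).mulVec c = 0 := by
  refine hq₁.mulVec_eq_zero hA₁ f ?_ fun w => ?_
  · rw [h, map_mul, eval_coneForm_of_mulVec_eq_zero hq₂.1 f hc, mul_zero]
  · rw [h, map_mul, map_mul, eval_coneForm_add_of_mulVec_eq_zero f hc, eval_C, eval_C]

/-- In characteristic different from two, the difference of two cones over smooth conics with
different vertices is not the square of a linear form. -/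
theorem IsSmoothQuadratic.exists_common_vertex {R : Type u} [CommRing R]
    {q₁ q₂ : MvPolynomial (Fin 3) R} (hq₁ : IsSmoothQuadratic q₁) (hq₂ : IsSmoothQuadratic q₂)
    {A₁ A₂ : Matrix (Fin 3) (Fin 4) R} (hA₁ : Function.Surjective fun v => A₁.mulVec v)
    (hA₂ : Function.Surjective fun v => A₂.mulVec v)
    {K : Type u} [Field K] (h2 : (2 : K) ≠ 0) (f : R →+* K) {a b : K} (ha : a ≠ 0)
    {h : MvPolynomial (Fin 4) K} (hh : h.IsHomogeneous 1)
    (H : map f (coneForm A₁ q₁) = C a * map f (coneForm A₂ q₂) + C b * (h * h))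
    {c₁ c₂ : Fin 4 → K} (hc₁ : (A₁.map f).mulVec c₁ = 0) (hc₂ : (A₂.map f).mulVec c₂ = 0) :
    (A₁.map f).mulVec c₂ = 0 ∨ (A₂.map f).mulVec c₁ = 0 := by
  have e (v) : eval v (map f (coneForm A₁ q₁)) =
      a * eval v (map f (coneForm A₂ q₂)) + b * (eval v h * eval v h) := by
    rw [H]; simp
  have v1 := eval_coneForm_of_mulVec_eq_zero hq₁.1 f hc₁
  have v2 := eval_coneForm_of_mulVec_eq_zero hq₂.1 f hc₂
  have t1 := eval_coneForm_add_of_mulVec_eq_zero (q := q₁) f hc₁ c₂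
  have t2 := eval_coneForm_add_of_mulVec_eq_zero (q := q₂) f hc₂ c₁
  rw [add_comm c₂ c₁] at t2
  rw [e, e, v2, t2, eval_linear_add hh] at t1
  have t3 := e c₁
  rw [v1] at t3
  -- Substituting `Q₁ = a Q₂ + b h²` into `Q₁(c₁ + c₂) = Q₁(c₂)` and `Q₁(c₁) = 0`, with `Q₂(c₁ + c₂)
  -- = Q₂(c₁)`, leaves only the cross term of `h(c₁ + c₂)²`. The characteristic enters here alone.
  have key : 2 * (b * (eval c₁ h * eval c₂ h)) = 0 := by linear_combination t1 + t3
  rw [mul_eq_zero, mul_eq_zero, mul_eq_zero] at key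
  rcases key with h0 | hb | h1 | h1
  · exact absurd h0 h2
  · left
    refine hq₁.mulVec_eq_zero_of_proportional hq₂ hA₁ f (a := a) ?_ hc₂
    rw [H, hb]; simp
  · right
    have e' (v) : eval v (map f (coneForm A₂ q₂)) =
        a⁻¹ * (eval v (map f (coneForm A₁ q₁)) - b * (eval v h * eval v h)) := by
      rw [e]; field_simp; ring
    refine hq₂.mulVec_eq_zero hA₂ f ?_ fun w => ?_
    · rw [e', v1, h1]; ring
    · rw [e', e', eval_coneForm_add_of_mulVec_eq_zero f hc₁, eval_linear_add hh, h1, zero_add]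
  · left
    refine hq₁.mulVec_eq_zero hA₁ f ?_ fun w => ?_
    · rw [e, v2, h1]; ring
    · rw [e, e, eval_coneForm_add_of_mulVec_eq_zero f hc₂, eval_linear_add hh, h1, zero_add]

end Quadratic

/-! ### The equations of the residual conic -/

section ResidualEquations

open MvPolynomial

theorem IsConicEquations.map {R S : Type u} [CommRing R] [CommRing S] (φ : R →+* S)
    {h q : MvPolynomial (Fin 4) R} (H : IsConicEquations h q) :
    IsConicEquations (MvPolynomial.map φ h) (MvPolynomial.map φ q) := by
  refine ⟨H.1.map _, H.2.1.map _, fun K _ f => ?_⟩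
  rw [map_map, map_map]
  exact H.2.2 K _

theorem IsSmoothQuadratic.map {R S : Type u} [CommRing R] [CommRing S] (φ : R →+* S)
    {q : MvPolynomial (Fin 3) R} (H : IsSmoothQuadratic q) :
    IsSmoothQuadratic (MvPolynomial.map φ q) := by
  refine ⟨H.1.map _, fun K _ f v h0 h1 => ?_⟩
  rw [eval₂_map] at h0
  refine H.2 K (f.comp φ) v h0 fun i => ?_
  have := h1 i
  rwa [pderiv_map, eval₂_map] at this

/-- The planes `h = 0` and `h' = 0` cut out, together with the quadric `Q 0 = 0`, two relative
conics whose union is the intersection of the quadrics `Q 0 = 0` and `Q 1 = 0`. -/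
structure IsResidualPair {R : Type u} [CommRing R] (Q : Fin 2 → MvPolynomial (Fin 4) R)
    (h h' : MvPolynomial (Fin 4) R) : Prop where
  left : IsConicEquations h (Q 0)
  right : IsConicEquations h' (Q 0)
  mul_eq : ∃ a b : R, IsUnit a ∧ IsUnit b ∧ h * h' = C a * Q 0 - C b * Q 1

theorem IsResidualPair.symm {R : Type u} [CommRing R] {Q : Fin 2 → MvPolynomial (Fin 4) R}
    {h h' : MvPolynomial (Fin 4) R} (H : IsResidualPair Q h h') : IsResidualPair Q h' h where
  left := H.right
  right := H.left
  mul_eq := by rw [mul_comm]; exact H.mul_eq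

theorem IsResidualPair.map {R S : Type u} [CommRing R] [CommRing S] (φ : R →+* S)
    {Q : Fin 2 → MvPolynomial (Fin 4) R} {h h' : MvPolynomial (Fin 4) R}
    (H : IsResidualPair Q h h') :
    IsResidualPair (fun i => MvPolynomial.map φ (Q i)) (MvPolynomial.map φ h)
      (MvPolynomial.map φ h') where
  left := H.left.map φ
  right := H.right.map φ
  mul_eq := by
    obtain ⟨a, b, ha, hb, hab⟩ := H.mul_eq
    refine ⟨φ a, φ b, ha.map φ, hb.map φ, ?_⟩
    rw [← map_mul, hab]
    simp

/-- Writing `Q_i = l_i h + a_i p`, the units `a_i` allow `p` to be replaced by `Q_0`, and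
eliminating `p` from the two identities leaves a multiple of `h`; the cofactor is the residual
plane. The last two hypotheses say that the vertex `c` of the second cone is in no fibre a vertex of
the first. -/
theorem exists_isResidualPair {R : Type u} [CommRing R] {A : Fin 2 → Matrix (Fin 3) (Fin 4) R}
    {q : Fin 2 → MvPolynomial (Fin 3) R} {h p : MvPolynomial (Fin 4) R}
    (hA : ∀ i, Function.Surjective fun v => (A i).mulVec v)
    (hq : ∀ i, IsSmoothQuadratic (q i)) (hp : IsConicEquations h p)
    (hmem : ∀ i, coneForm (A i) (q i) ∈ Ideal.span {h, p})
    {c : Fin 4 → R} (hc : (A 1).mulVec c = 0)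
    (hc' : ∀ (K : Type u) [Field K] (f : R →+* K), ((A 0).map f).mulVec (f ∘ c) ≠ 0) :
    Ideal.span {h, p} = Ideal.span {h, coneForm (A 0) (q 0)} ∧
      ∃ h', IsResidualPair (fun i => coneForm (A i) (q i)) h h' := by
  have key (i) : ∃ l : MvPolynomial (Fin 4) R, l.IsHomogeneous 1 ∧ ∃ a : R, IsUnit a ∧
      coneForm (A i) (q i) = l * h + C a * p := by
    obtain ⟨l, hl, a, ha⟩ := exists_of_quadratic_mem_span hp.1 hp.2.1
      (isHomogeneous_coneForm (hq i).1) (hmem i)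
    refine ⟨l, hl, a, isUnit_of_forall_map_ne_zero fun K _ f h0 => ?_, ha⟩
    refine (hq i).not_dvd_coneForm (hA i) f (hp.1.map f) ⟨MvPolynomial.map f l, ?_⟩
    rw [ha]
    simp [h0, mul_comm]
  choose l hl a ha hla using key
  have hleft : IsConicEquations h (coneForm (A 0) (q 0)) :=
    ⟨hp.1, isHomogeneous_coneForm (hq 0).1, fun K _ f =>
      ⟨(hp.2.2 K f).1, (hq 0).not_dvd_coneForm (hA 0) f (hp.1.map f)⟩⟩
  obtain ⟨b, hb⟩ := (ha 0).exists_left_inv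
  have hCb : (C b * C (a 0) : MvPolynomial (Fin 4) R) = 1 := by rw [← C_mul, hb, C_1]
  refine ⟨?_, C (a 1) * l 0 - C (a 0) * l 1, hleft, ?_, a 1, a 0, ha 1, ha 0, ?_⟩
  · apply le_antisymm
    · rw [Ideal.span_le, Set.insert_subset_iff, Set.singleton_subset_iff]
      refine ⟨Ideal.subset_span (Set.mem_insert _ _), Ideal.mem_span_pair.mpr
        ⟨- C b * l 0, C b, ?_⟩⟩
      rw [hla 0]
      linear_combination p * hCb
    · rw [Ideal.span_le, Set.insert_subset_iff, Set.singleton_subset_iff]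
      exact ⟨Ideal.subset_span (Set.mem_insert _ _), hmem 0⟩
  · have hh' : (C (a 1) * l 0 - C (a 0) * l 1).IsHomogeneous 1 :=
      ((hl 0).C_mul _).sub ((hl 1).C_mul _)
    refine ⟨hh', isHomogeneous_coneForm (hq 0).1, fun K _ f =>
      ⟨fun h0 => ?_, (hq 0).not_dvd_coneForm (hA 0) f (hh'.map f)⟩⟩
    -- If `h'` vanished in a fibre, then `a₁ Q₀ = a₀ Q₁` there, so the cones would be proportional
    -- with ratio `a₀ / a₁`; the factor `b * a 0` equals one.
    refine hc' K f ((hq 0).mulVec_eq_zero_of_proportional (hq 1) (hA 0) f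
      (a := f (b * a 0) * f (a 0) * f (Ring.inverse (a 1))) ?_ (A₂ := A 1) (c := f ∘ c) ?_)
    · have h1 : MvPolynomial.map f (C (a 1) * coneForm (A 0) (q 0)) =
          MvPolynomial.map f (C (a 0) * coneForm (A 1) (q 1)) := by
        have : C (a 1) * coneForm (A 0) (q 0) - C (a 0) * coneForm (A 1) (q 1) =
            h * (C (a 1) * l 0 - C (a 0) * l 1) := by
          rw [hla 0, hla 1]; ring
        rw [← sub_eq_zero, ← map_sub, this, map_mul, h0, mul_zero]
      rw [map_mul, map_mul, map_C, map_C] at h1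
      have h2 : f (a 1) * f (Ring.inverse (a 1)) = 1 := by
        rw [← map_mul, Ring.mul_inverse_cancel _ (ha 1), map_one]
      have h3 : (C (f (a 1)) * C (f (Ring.inverse (a 1))) : MvPolynomial (Fin 4) K) = 1 := by
        rw [← C_mul, h2, C_1]
      rw [hb, map_one, one_mul, C_mul]
      linear_combination C (f (Ring.inverse (a 1))) * h1 - MvPolynomial.map f (coneForm (A 0) (q 0)) * h3
    · have := congrArg (fun v => f ∘ v) hc
      ext i
      have h1 := congrFun this i
      simp only [Function.comp_apply, Pi.zero_apply, map_zero] at h1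
      rw [Pi.zero_apply, ← h1, RingHom.map_mulVec]
  · rw [hla 0, hla 1]; ring

/-- In a ring where `h'` is a nonzerodivisor modulo `Q₀` and `h`, `h * h' = a * Q₀ - b * Q₁`
with units `a` and `b`, the ideal `(h', Q₀)` is the residual of `(h, Q₀)` in `(Q₀, Q₁)`. -/
theorem mem_span_pair_iff_mul_mem {B : Type*} [CommRing B] {Q₀ Q₁ h h' a b : B}
    (hb : IsUnit b) (hmul : h * h' = a * Q₀ - b * Q₁)
    (hreg : ∀ f, Q₀ ∣ h * f → Q₀ ∣ f) (f : B) :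
    f ∈ Ideal.span {h', Q₀} ↔ ∀ g ∈ Ideal.span {h, Q₀}, f * g ∈ Ideal.span {Q₀, Q₁} := by
  obtain ⟨b', hb'⟩ := hb.exists_left_inv
  have hspan : h * h' ∈ Ideal.span {Q₀, Q₁} := Ideal.mem_span_pair.mpr ⟨a, -b, by rw [hmul]; ring⟩
  have hQ : Q₀ ∈ Ideal.span {Q₀, Q₁} := Ideal.subset_span (Set.mem_insert _ _)
  constructor
  · intro hf g hg
    obtain ⟨u, v, rfl⟩ := Ideal.mem_span_pair.mp hf
    obtain ⟨s, t, rfl⟩ := Ideal.mem_span_pair.mp hg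
    have : (u * h' + v * Q₀) * (s * h + t * Q₀) =
        (u * s) * (h * h') + (u * h' * t + v * s * h + v * t * Q₀) * Q₀ := by ring
    rw [this]
    exact add_mem (Ideal.mul_mem_left _ _ hspan) (Ideal.mul_mem_left _ _ hQ)
  · intro H
    -- Testing against `g = h` is enough. In `f h = u Q₀ + v Q₁` the form `Q₁` is replaced by `b' (a
    -- Q₀ - h h')`, which gives `h (f + v b' h') = (u + v b' a) Q₀`.
    obtain ⟨u, v, huv⟩ := Ideal.mem_span_pair.mp (H h (Ideal.subset_span (Set.mem_insert _ _)))
    obtain ⟨w, hw⟩ := hreg (f + v * b' * h') ⟨u + v * b' * a, by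
      linear_combination -huv - v * Q₁ * hb' + v * b' * hmul⟩
    exact Ideal.mem_span_pair.mpr ⟨-(v * b'), w, by linear_combination -hw⟩

end ResidualEquations

/-! ### Maps to projective space through a single affine chart -/

section ProjectivePoints

open MvPolynomial

variable {n : ℕ}

theorem X_mem_homogeneousSubmodule (j : Fin (n + 1)) :
    (X j : MvPolynomial (Fin (n + 1)) (ULift.{u} ℤ)) ∈ homogeneousSubmodule (Fin (n + 1)) _ 1 :=
  (mem_homogeneousSubmodule _ _).mpr (isHomogeneous_X _ j)

/-- Evaluation of functions on the chart `D₊(r)` along a homomorphism that inverts `r`. -/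
def awayEval {σ A : Type u} [CommRing A] [SetLike σ A] [AddSubgroupClass σ A] (𝒜 : ℕ → σ)
    [GradedRing 𝒜] {B : Type u} [CommRing B] {r : A} (f : A →+* B) (hf : IsUnit (f r)) :
    HomogeneousLocalization.Away 𝒜 r →+* B :=
  (IsLocalization.Away.lift (S := Localization.Away r) r hf).comp
    (algebraMap (HomogeneousLocalization.Away 𝒜 r) (Localization.Away r))

theorem ι_fromOfGlobalSections {σ A : Type u} [CommRing A] [SetLike σ A] [AddSubgroupClass σ A]
    (𝒜 : ℕ → σ) [GradedRing 𝒜] {T : Scheme.{u}} (f : A →+* Γ(T, ⊤))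
    (hf : (HomogeneousIdeal.irrelevant 𝒜).toIdeal.map f = ⊤) {r : A} (hr : r ∈ 𝒜 1) :
    (T.basicOpen (f r)).ι ≫ Proj.fromOfGlobalSections 𝒜 f hf =
      Proj.toBasicOpenOfGlobalSections 𝒜 f rfl one_pos hr ≫ (Proj.basicOpen 𝒜 r).ι := by
  rw [← Proj.fromOfGlobalSections_resLE 𝒜 f hf one_pos hr, Scheme.Hom.resLE_comp_ι]

/-- The map from the spectrum of the localization to `Spec Γ(T, ⊤)` is a monomorphism, so the
identity may be tested after composing with it, where both sides become the canonical map. -/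
theorem comp_basicOpenIsoSpecAway_hom {V T : Scheme.{u}} (g : Γ(T, ⊤))
    (a : V ⟶ (T.basicOpen g : Scheme.{u})) (hu : IsUnit ((a ≫ (T.basicOpen g).ι).appTop.hom g)) :
    a ≫ (T.isoOfEq (T.toSpecΓ_preimage_basicOpen g)).inv ≫
      T.toSpecΓ ∣_ _ ≫ (basicOpenIsoSpecAway g).hom = V.toSpecΓ ≫ Spec.map (CommRingCat.ofHom
        (IsLocalization.Away.lift (S := Localization.Away g) g hu)) := by
  rw [← cancel_mono (Spec.map (CommRingCat.ofHom (algebraMap Γ(T, ⊤) (Localization.Away g))))]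
  have h1 : V.toSpecΓ ≫ Spec.map (CommRingCat.ofHom
        (IsLocalization.Away.lift (S := Localization.Away g) g hu)) ≫
        Spec.map (CommRingCat.ofHom (algebraMap Γ(T, ⊤) (Localization.Away g))) =
      V.toSpecΓ ≫ Spec.map (a ≫ (T.basicOpen g).ι).appTop := by
    rw [← Spec.map_comp, ← CommRingCat.ofHom_comp, IsLocalization.Away.lift_comp]
    rfl
  have h2 := basicOpenIsoSpecAway_hom_SpecMap (R := Γ(T, ⊤)) g
  have h3 : T.toSpecΓ ∣_ PrimeSpectrum.basicOpen g ≫ (basicOpenIsoSpecAway g).hom ≫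
      Spec.map (CommRingCat.ofHom (algebraMap Γ(T, ⊤) (Localization.Away g))) =
      (T.toSpecΓ ⁻¹ᵁ PrimeSpectrum.basicOpen g).ι ≫ T.toSpecΓ :=
    (congrArg (fun z => T.toSpecΓ ∣_ PrimeSpectrum.basicOpen g ≫ z) h2).trans
      (morphismRestrict_ι _ _)
  simp only [Category.assoc]
  refine Eq.trans ?_ h1.symm
  refine Eq.trans (congrArg (fun z => a ≫ (T.isoOfEq (T.toSpecΓ_preimage_basicOpen g)).inv ≫ z) h3)
    ?_
  rw [Scheme.isoOfEq_inv_ι_assoc, ← Scheme.toSpecΓ_naturality, Category.assoc]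

/-- Once `r` becomes invertible on `V`, the map to `Proj` factors through the affine chart of `r`
and is encoded by a ring homomorphism. Identities between points of projective space thereby reduce
to identities of functions. -/
theorem comp_fromOfGlobalSections_eq {σ A : Type u} [CommRing A] [SetLike σ A]
    [AddSubgroupClass σ A]
    (𝒜 : ℕ → σ) [GradedRing 𝒜] {V T : Scheme.{u}} (a : V ⟶ T) (f : A →+* Γ(T, ⊤))
    (hf : (HomogeneousIdeal.irrelevant 𝒜).toIdeal.map f = ⊤) {r : A} (hr : r ∈ 𝒜 1)
    (hu : IsUnit ((a.appTop.hom.comp f) r)) :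
    a ≫ Proj.fromOfGlobalSections 𝒜 f hf = V.toSpecΓ ≫
      Spec.map (CommRingCat.ofHom (awayEval 𝒜 (a.appTop.hom.comp f) hu)) ≫
        Proj.awayι 𝒜 r hr one_pos := by
  let D := T.basicOpen (f r)
  have hrange : Set.range a ⊆ Set.range D.ι := by
    rw [Scheme.Opens.range_ι]
    rintro _ ⟨v, rfl⟩
    have h1 : v ∈ a ⁻¹ᵁ D := by
      rw [Scheme.preimage_basicOpen_top]
      rw [show V.basicOpen (a.appTop (f r)) = ⊤ from Scheme.basicOpen_of_isUnit _ hu]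
      trivial
    exact h1
  let a' := IsOpenImmersion.lift D.ι a hrange
  have ha' : a' ≫ D.ι = a := IsOpenImmersion.lift_fac _ _ _
  conv_lhs => rw [← ha', Category.assoc, ι_fromOfGlobalSections 𝒜 f hf hr]
  simp only [Proj.toBasicOpenOfGlobalSections, Category.assoc, Proj.basicOpenIsoSpec_inv_ι]
  have hu' : IsUnit ((a' ≫ D.ι).appTop.hom (f r)) := by rw [ha']; exact hu
  have key := comp_basicOpenIsoSpecAway_hom (f r) a' hu'
  have key' := congrArg (fun z => z ≫ Spec.map (CommRingCat.ofHom ((IsLocalization.map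
    (M := .powers r) (T := .powers (f r)) (S := Localization.Away r)
    (Localization.Away (f r)) f
    (by rw [← Submonoid.map_le_iff_le_comap, Submonoid.map_powers])).comp
      (algebraMap (HomogeneousLocalization.Away 𝒜 r) (Localization.Away r)))) ≫
        Proj.awayι 𝒜 r hr one_pos) key
  simp only [Category.assoc] at key'
  refine key'.trans ?_
  have h2 : (awayEval 𝒜 (a.appTop.hom.comp f) hu) =
      (IsLocalization.Away.lift (S := Localization.Away (f r)) (f r) hu').comp
      ((IsLocalization.map (M := .powers r) (T := .powers (f r)) (S := Localization.Away r)
      (Localization.Away (f r)) f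
      (by rw [← Submonoid.map_le_iff_le_comap, Submonoid.map_powers])).comp
      (algebraMap (HomogeneousLocalization.Away 𝒜 r) (Localization.Away r))) := by
    rw [awayEval, ← RingHom.comp_assoc]
    congr 1
    refine IsLocalization.ringHom_ext (Submonoid.powers r) ?_
    rw [RingHom.comp_assoc, IsLocalization.map_comp, IsLocalization.Away.lift_comp,
      ← RingHom.comp_assoc, IsLocalization.Away.lift_comp, ha']
  rw [h2, CommRingCat.ofHom_comp _ (IsLocalization.Away.lift (f r) hu'), Spec.map_comp,
    Category.assoc]

/-- The ring of functions on the `j`-th standard chart of projective space. -/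
abbrev ChartRing (n : ℕ) (j : Fin (n + 1)) : Type u :=
  HomogeneousLocalization.Away (homogeneousSubmodule (Fin (n + 1)) (ULift.{u} ℤ)) (X j)

/-- The inclusion of the `j`-th standard chart of projective space. -/
def stdChart (n : ℕ) (j : Fin (n + 1)) : Spec (CommRingCat.of (ChartRing.{u} n j)) ⟶ ProjZ.{u} n :=
  Proj.awayι _ (X j) (X_mem_homogeneousSubmodule j) one_pos

instance (j : Fin (n + 1)) : IsOpenImmersion (stdChart.{u} n j) :=
  inferInstanceAs (IsOpenImmersion (Proj.awayι _ _ _ _))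

/-- Evaluation of functions on the `j`-th chart at homogeneous coordinates. -/
abbrev chartEval {B : Type u} [CommRing B] {j : Fin (n + 1)}
    (f : MvPolynomial (Fin (n + 1)) (ULift.{u} ℤ) →+* B) (hf : IsUnit (f (X j))) :
    ChartRing.{u} n j →+* B :=
  awayEval _ f hf

theorem evalZ_X {T : Scheme.{u}} (x : Fin n → Γ(T, ⊤)) (i : Fin n) : evalZ x (X i : MvPolynomial (Fin n) (ULift.{u} ℤ)) = x i := by
  simp [evalZ]

theorem comp_homogPoint_eq {V T : Scheme.{u}} (a : V ⟶ T) (x : Fin (n + 1) → Γ(T, ⊤))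
    (hx : Unimodular x) (j : Fin (n + 1))
    (hu : IsUnit ((a.appTop.hom.comp (evalZ x)) (X j))) :
    a ≫ homogPoint x hx = V.toSpecΓ ≫
      Spec.map (CommRingCat.ofHom (chartEval (a.appTop.hom.comp (evalZ x)) hu)) ≫
        stdChart n j := by
  exact comp_fromOfGlobalSections_eq _ a (evalZ x) _ (X_mem_homogeneousSubmodule j) hu

end ProjectivePoints

/-! ### Homogeneous coordinates: functoriality, uniqueness, existence -/

section ProjectivePoints

open MvPolynomial

variable {n : ℕ}

theorem eval₂_mul_of_isHomogeneous {R S σ : Type*} [CommRing R] [CommRing S] (f : R →+* S) (s : S)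
    (x : σ → S) {p : MvPolynomial σ R} {m : ℕ} (hp : p.IsHomogeneous m) :
    eval₂ f (fun i => s * x i) p = s ^ m * eval₂ f x p := by
  rw [eval₂_eq, eval₂_eq, Finset.mul_sum]
  refine Finset.sum_congr rfl fun d hd => ?_
  have hdeg : d.degree = m := by
    by_contra hne
    exact mem_support_iff.mp hd (hp.coeff_eq_zero hne)
  simp only [mul_pow, Finset.prod_mul_distrib]
  rw [Finset.prod_pow_eq_pow_sum, ← hdeg, Finsupp.degree_apply]
  ring

theorem evalZ_ext {B : Type u} [CommRing B]
    {f g : MvPolynomial (Fin n) (ULift.{u} ℤ) →+* B} (h : ∀ i, f (X i) = g (X i)) : f = g := by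
  refine MvPolynomial.ringHom_ext' ?_ h
  have : (f.comp C).comp ULift.ringEquiv.symm.toRingHom =
      (g.comp C).comp ULift.ringEquiv.symm.toRingHom := Subsingleton.elim _ _
  refine RingHom.ext fun r => ?_
  exact RingHom.congr_fun this r.down

theorem comp_evalZ {V T : Scheme.{u}} (a : V ⟶ T) (x : Fin n → Γ(T, ⊤)) :
    a.appTop.hom.comp (evalZ x) = evalZ (fun i => a.appTop.hom (x i)) :=
  evalZ_ext fun i => by rw [RingHom.comp_apply, evalZ_X, evalZ_X]

theorem Unimodular.map {V T : Scheme.{u}} (a : V ⟶ T) {x : Fin n → Γ(T, ⊤)} (hx : Unimodular x) :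
    Unimodular (fun i => a.appTop.hom (x i)) := by
  have := congrArg (Ideal.map a.appTop.hom) hx
  rw [Ideal.map_span, Ideal.map_top, ← Set.range_comp] at this
  exact this

theorem Unimodular.of_isUnit {T : Scheme.{u}} {x : Fin n → Γ(T, ⊤)} {j : Fin n}
    (hx : IsUnit (x j)) : Unimodular x :=
  Ideal.eq_top_of_isUnit_mem _ (Ideal.subset_span ⟨j, rfl⟩) hx

/-- At a point where no `x j` is invertible, the unit ideal would be contained in the preimage of
the maximal ideal of the stalk. -/
theorem Unimodular.iSup_basicOpen {T : Scheme.{u}} {x : Fin n → Γ(T, ⊤)} (hx : Unimodular x) :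
    ⨆ j, T.basicOpen (x j) = ⊤ := by
  refine top_le_iff.mp fun p _ => ?_
  by_contra hcon
  simp only [TopologicalSpace.Opens.mem_iSup, not_exists] at hcon
  have h1 : ∀ j, x j ∈ (IsLocalRing.maximalIdeal (T.presheaf.stalk p)).comap
      (T.presheaf.germ ⊤ p trivial).hom := by
    intro j
    rw [Ideal.mem_comap, IsLocalRing.mem_maximalIdeal]
    exact fun hu => hcon j ((T.mem_basicOpen_top (x j) p).mpr hu)
  have h2 : Ideal.span (Set.range x) ≤ (IsLocalRing.maximalIdeal (T.presheaf.stalk p)).comap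
      (T.presheaf.germ ⊤ p trivial).hom := Ideal.span_le.mpr (by rintro _ ⟨j, rfl⟩; exact h1 j)
  rw [hx] at h2
  exact (Ideal.IsPrime.comap (K := IsLocalRing.maximalIdeal (T.presheaf.stalk p))
    (T.presheaf.germ ⊤ p trivial).hom).ne_top (top_le_iff.mp h2)

theorem isUnit_of_basicOpen_eq_top {T : Scheme.{u}} (f : Γ(T, ⊤)) (h : T.basicOpen f = ⊤) :
    IsUnit f := by
  refine RingedSpace.isUnit_of_isUnit_germ T.toRingedSpace ⊤ f fun p hp => ?_
  exact (T.mem_basicOpen_top f p).mp (by rw [h]; exact hp)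

theorem isUnit_appTop_basicOpen_ι {T : Scheme.{u}} (f : Γ(T, ⊤)) :
    IsUnit ((T.basicOpen f).ι.appTop.hom f) := by
  have h1 := Scheme.preimage_basicOpen_top (T.basicOpen f).ι f
  have h2 : (T.basicOpen f).ι ⁻¹ᵁ T.basicOpen f = ⊤ := (T.basicOpen f).ι_preimage_self
  rw [h2] at h1
  exact isUnit_of_basicOpen_eq_top _ h1.symm

theorem Unimodular.hom_ext {T Y : Scheme.{u}} {x : Fin n → Γ(T, ⊤)} (hx : Unimodular x)
    {f g : T ⟶ Y} (h : ∀ j, (T.basicOpen (x j)).ι ≫ f = (T.basicOpen (x j)).ι ≫ g) : f = g :=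
  (T.openCoverOfIsOpenCover _ hx.iSup_basicOpen).hom_ext _ _ h

/-- The function `X i / X j` on the `j`-th standard chart. -/
def chartCoord (j i : Fin (n + 1)) : ChartRing.{u} n j :=
  HomogeneousLocalization.Away.mk _ (X_mem_homogeneousSubmodule j) 1 (X i)
    (X_mem_homogeneousSubmodule i)

theorem awayEval_mk {σ A : Type u} [CommRing A] [SetLike σ A] [AddSubgroupClass σ A] (𝒜 : ℕ → σ)
    [GradedRing 𝒜] {B : Type u} [CommRing B] {r : A} (f : A →+* B) (hf : IsUnit (f r)) {d : ℕ}
    (hr : r ∈ 𝒜 d) (m : ℕ) (a : A) (ha : a ∈ 𝒜 (m • d)) :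
    awayEval 𝒜 f hf (HomogeneousLocalization.Away.mk 𝒜 hr m a ha) * f r ^ m = f a := by
  rw [awayEval, RingHom.comp_apply, HomogeneousLocalization.algebraMap_apply,
    HomogeneousLocalization.Away.val_mk, Localization.mk_eq_mk']
  have h1 : f r ^ m = IsLocalization.Away.lift (S := Localization.Away r) r hf
      (algebraMap A (Localization.Away r) (r ^ m)) := by
    rw [IsLocalization.Away.lift_eq, map_pow]
  rw [h1, ← map_mul]
  have h2 := IsLocalization.mk'_spec (Localization.Away r) a
    (⟨r ^ m, m, rfl⟩ : Submonoid.powers r)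
  rw [h2, IsLocalization.Away.lift_eq]

theorem chartEval_chartCoord {B : Type u} [CommRing B] {j : Fin (n + 1)}
    (f : MvPolynomial (Fin (n + 1)) (ULift.{u} ℤ) →+* B) (hf : IsUnit (f (X j)))
    (i : Fin (n + 1)) : chartEval f hf (chartCoord j i) * f (X j) = f (X i) := by
  have := awayEval_mk _ f hf (X_mem_homogeneousSubmodule j) 1 (X i) (X_mem_homogeneousSubmodule i)
  rwa [pow_one] at this

theorem chartCoord_self (j : Fin (n + 1)) : (chartCoord j j : ChartRing.{u} n j) = 1 := by
  refine HomogeneousLocalization.val_injective _ ?_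
  rw [chartCoord, HomogeneousLocalization.Away.val_mk, HomogeneousLocalization.val_one]
  simp only [pow_one]
  exact Localization.mk_self
    (⟨X j, 1, pow_one _⟩ : Submonoid.powers (X j : MvPolynomial (Fin (n + 1)) (ULift.{u} ℤ)))

/-- The ratios `X i / X j` generate the chart ring: a fraction `a / X j ^ m` with `a` homogeneous of
degree `m` is the value of `a` at these ratios. -/
theorem chartRing_hom_ext {B : Type u} [CommRing B] {j : Fin (n + 1)}
    {φ ψ : ChartRing.{u} n j →+* B} (h : ∀ i, φ (chartCoord j i) = ψ (chartCoord j i)) :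
    φ = ψ := by
  let ε : MvPolynomial (Fin (n + 1)) (ULift.{u} ℤ) →+* ChartRing.{u} n j :=
    eval₂Hom ((Int.castRingHom (ChartRing.{u} n j)).comp
      (ULift.ringEquiv.toRingHom : ULift.{u} ℤ →+* ℤ)) (chartCoord j)
  have hε : φ.comp ε = ψ.comp ε := evalZ_ext fun i => by simpa [ε] using h i
  refine RingHom.ext fun z => ?_
  obtain ⟨m, a, ha, rfl⟩ :=
    HomogeneousLocalization.Away.mk_surjective _ (X_mem_homogeneousSubmodule j) z
  suffices hsuff : HomogeneousLocalization.Away.mk _ (X_mem_homogeneousSubmodule j) m a ha = ε a by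
    rw [hsuff]; exact RingHom.congr_fun hε a
  refine HomogeneousLocalization.val_injective _ ?_
  rw [HomogeneousLocalization.Away.val_mk, Localization.mk_eq_mk',
    IsLocalization.mk'_eq_iff_eq_mul]
  let L := Localization.Away (X j : MvPolynomial (Fin (n + 1)) (ULift.{u} ℤ))
  let α : ChartRing.{u} n j →+* L := algebraMap (ChartRing.{u} n j) L
  let β : MvPolynomial (Fin (n + 1)) (ULift.{u} ℤ) →+* L := algebraMap _ L
  rw [show (ε a).val = α (ε a) from (HomogeneousLocalization.algebraMap_apply _).symm]
  have h2 : α (ε a) = eval₂ (α.comp ((Int.castRingHom (ChartRing.{u} n j)).comp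
      (ULift.ringEquiv.toRingHom : ULift.{u} ℤ →+* ℤ)))
      (fun i => α (chartCoord j i)) a := by
    simp only [ε, coe_eval₂Hom]
    rw [hom_eval₂]
  have h3 : β a = eval₂ (α.comp ((Int.castRingHom (ChartRing.{u} n j)).comp
      (ULift.ringEquiv.toRingHom : ULift.{u} ℤ →+* ℤ)))
      (fun i => β (X j) * α (chartCoord j i)) a := by
    rw [← coe_eval₂Hom]
    refine RingHom.congr_fun (evalZ_ext fun i => ?_) a
    rw [eval₂Hom_X', mul_comm]
    change β (X i) = (chartCoord j i).val * β (X j)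
    rw [chartCoord, HomogeneousLocalization.Away.val_mk, Localization.mk_eq_mk']
    have h4 := IsLocalization.mk'_spec L (X i)
      (⟨X j ^ 1, 1, rfl⟩ : Submonoid.powers (X j : MvPolynomial (Fin (n + 1)) (ULift.{u} ℤ)))
    simp only [pow_one] at h4 ⊢
    exact h4.symm
  have ha' : a.IsHomogeneous m := by simpa using ha
  rw [eval₂_mul_of_isHomogeneous _ _ _ ha', ← h2] at h3
  change β a = α (ε a) * β (X j ^ m)
  rw [h3, map_pow, mul_comm]

/-- On the locus where `x j` becomes invertible both maps go through the `j`-th chart and are given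
by the same ring homomorphism; these loci cover `V`. -/
theorem comp_homogPoint {V T : Scheme.{u}} (a : V ⟶ T) (x : Fin (n + 1) → Γ(T, ⊤))
    (hx : Unimodular x) :
    a ≫ homogPoint x hx = homogPoint (fun i => a.appTop.hom (x i)) (hx.map a) := by
  refine (hx.map a).hom_ext fun j => ?_
  set b := (V.basicOpen (a.appTop.hom (x j))).ι
  have hu := isUnit_appTop_basicOpen_ι (a.appTop.hom (x j))
  have e : (b ≫ a).appTop.hom.comp (evalZ x) =
      b.appTop.hom.comp (evalZ (fun i => a.appTop.hom (x i))) := by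
    rw [← comp_evalZ, ← RingHom.comp_assoc, Scheme.Hom.comp_appTop, CommRingCat.hom_comp]
  have hu2 : IsUnit ((b.appTop.hom.comp (evalZ (fun i => a.appTop.hom (x i)))) (X j)) := by
    rw [RingHom.comp_apply, evalZ_X]; exact hu
  have hu1 : IsUnit (((b ≫ a).appTop.hom.comp (evalZ x)) (X j)) := by rw [e]; exact hu2
  rw [← Category.assoc, comp_homogPoint_eq (b ≫ a) x hx j hu1,
    comp_homogPoint_eq b _ (hx.map a) j hu2]
  congr 5

theorem homogPoint_eq {T : Scheme.{u}} (x : Fin (n + 1) → Γ(T, ⊤)) (hx : Unimodular x)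
    (j : Fin (n + 1)) (hu : IsUnit (evalZ x (X j))) :
    homogPoint x hx = T.toSpecΓ ≫ Spec.map (CommRingCat.ofHom (chartEval (evalZ x) hu)) ≫
      stdChart n j := by
  have h := comp_homogPoint_eq (𝟙 T) x hx j (by simpa using hu)
  rw [Category.id_comp] at h
  rw [h]
  congr 5

theorem chartEval_eq_of_mul_eq {B : Type u} [CommRing B] {j : Fin (n + 1)}
    {f g : MvPolynomial (Fin (n + 1)) (ULift.{u} ℤ) →+* B} (hf : IsUnit (f (X j)))
    (hg : IsUnit (g (X j))) (h : ∀ i, f (X i) * g (X j) = g (X i) * f (X j)) :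
    chartEval f hf = chartEval g hg := by
  refine chartRing_hom_ext fun i => ?_
  refine (hf.mul hg).mul_right_cancel ?_
  have h1 := chartEval_chartCoord f hf i
  have h2 := chartEval_chartCoord g hg i
  linear_combination g (X j) * h1 + h i - f (X j) * h2

theorem homogPoint_eq_of_isUnit {T : Scheme.{u}} {x y : Fin (n + 1) → Γ(T, ⊤)}
    (hx : Unimodular x) (hy : Unimodular y) {j : Fin (n + 1)} (hxj : IsUnit (x j))
    (hyj : IsUnit (y j)) (h : ∀ i, x i * y j = y i * x j) : homogPoint x hx = homogPoint y hy := by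
  rw [homogPoint_eq x hx j (by rwa [evalZ_X]), homogPoint_eq y hy j (by rwa [evalZ_X])]
  congr 4
  exact chartEval_eq_of_mul_eq _ _ fun i => by simpa only [evalZ_X] using h i

theorem toSpecΓ_comp_SpecMap_injective {T : Scheme.{u}} {B : Type u} [CommRing B]
    {φ ψ : B →+* Γ(T, ⊤)}
    (h : T.toSpecΓ ≫ Spec.map (CommRingCat.ofHom φ) = T.toSpecΓ ≫ Spec.map (CommRingCat.ofHom ψ)) :
    φ = ψ := by
  have h1 := congrArg (fun f => (Scheme.ΓSpecIso (CommRingCat.of B)).inv ≫ f.appTop) h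
  have key (φ : B →+* Γ(T, ⊤)) : (Scheme.ΓSpecIso (CommRingCat.of B)).inv ≫
      (T.toSpecΓ ≫ Spec.map (CommRingCat.ofHom φ)).appTop = CommRingCat.ofHom φ := by
    rw [Scheme.Hom.comp_appTop, ← Scheme.ΓSpecIso_inv_naturality_assoc, Scheme.toSpecΓ_appTop,
      Iso.inv_hom_id, Category.comp_id]
  simp only [key] at h1
  exact congrArg CommRingCat.Hom.hom h1

/-- Homogeneous coordinates of a point are unique up to scaling. -/
theorem mul_eq_mul_of_homogPoint_eq {T : Scheme.{u}} {x y : Fin (n + 1) → Γ(T, ⊤)}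
    {hx : Unimodular x} {hy : Unimodular y} (h : homogPoint x hx = homogPoint y hy)
    {j : Fin (n + 1)} (hxj : IsUnit (x j)) :
    IsUnit (y j) ∧ ∀ i, x i * y j = y i * x j := by
  have hpre (z : Fin (n + 1) → Γ(T, ⊤)) (hz : Unimodular z) :
      homogPoint z hz ⁻¹ᵁ (Proj.basicOpen _ (X j)) = T.basicOpen (evalZ z (X j)) :=
    Proj.fromOfGlobalSections_preimage_basicOpen _ _ _ one_pos (X_mem_homogeneousSubmodule j)
  -- The locus where a coordinate is invertible is the preimage of a standard open, hence depends
  -- only on the morphism.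
  have hyj : IsUnit (y j) := by
    refine isUnit_of_basicOpen_eq_top _ ?_
    rw [← evalZ_X y j, ← hpre y hy, ← h, hpre x hx, evalZ_X]
    exact Scheme.basicOpen_of_isUnit _ hxj
  refine ⟨hyj, fun i => ?_⟩
  have hxj' : IsUnit (evalZ x (X j)) := by rwa [evalZ_X]
  have hyj' : IsUnit (evalZ y (X j)) := by rwa [evalZ_X]
  rw [homogPoint_eq x hx j hxj', homogPoint_eq y hy j hyj', ← Category.assoc, ← Category.assoc,
    cancel_mono] at h
  have h1 := toSpecΓ_comp_SpecMap_injective h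
  have h2 := chartEval_chartCoord (evalZ x) hxj' i
  have h3 := chartEval_chartCoord (evalZ y) hyj' i
  rw [h1] at h2
  rw [evalZ_X, evalZ_X] at h2 h3
  linear_combination x j * h3 - y j * h2

/-- The coordinates `X i / X j` on the spectrum of the `j`-th chart ring. -/
def specChartCoord (j i : Fin (n + 1)) : Γ(Spec (CommRingCat.of (ChartRing.{u} n j)), ⊤) :=
  (Scheme.ΓSpecIso (CommRingCat.of (ChartRing.{u} n j))).inv.hom (chartCoord j i)

theorem specChartCoord_self (j : Fin (n + 1)) : specChartCoord.{u} j j = 1 := by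
  rw [specChartCoord, chartCoord_self, map_one]

theorem unimodular_specChartCoord (j : Fin (n + 1)) : Unimodular (specChartCoord.{u} j) :=
  Unimodular.of_isUnit (j := j) (by rw [specChartCoord_self]; exact isUnit_one)

theorem stdChart_eq_homogPoint (j : Fin (n + 1)) :
    stdChart.{u} n j = homogPoint (specChartCoord j) (unimodular_specChartCoord j) := by
  have h2 : IsUnit (evalZ (specChartCoord.{u} j) (X j)) := by
    rw [evalZ_X, specChartCoord_self]; exact isUnit_one
  rw [homogPoint_eq _ _ j h2]
  have h3 : chartEval _ h2 = (Scheme.ΓSpecIso (CommRingCat.of (ChartRing.{u} n j))).inv.hom := by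
    refine chartRing_hom_ext fun i => ?_
    have := chartEval_chartCoord _ h2 i
    rw [evalZ_X, evalZ_X, specChartCoord_self, mul_one] at this
    exact this
  rw [h3, CommRingCat.ofHom_hom, ← Category.assoc, toSpecΓ_SpecMap_ΓSpecIso_inv]
  exact (Category.id_comp _).symm

theorem iSup_opensRange_stdChart : ⨆ j, (stdChart.{u} n j).opensRange = ⊤ := by
  have h1 (j) : (stdChart.{u} n j).opensRange =
      Proj.basicOpen (homogeneousSubmodule (Fin (n + 1)) (ULift.{u} ℤ)) (X j) :=
    Proj.opensRange_awayι _ _ _ _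
  simp only [h1]
  refine Proj.iSup_basicOpen_eq_top' _ _ (fun i => ⟨1, X_mem_homogeneousSubmodule i⟩) ?_
  refine top_le_iff.mp fun p _ => ?_
  induction p using MvPolynomial.induction_on with
  | C a =>
    exact Subalgebra.algebraMap_mem (Algebra.adjoin
      (homogeneousSubmodule (Fin (n + 1)) (ULift.{u} ℤ) 0) _)
      (⟨C a, (mem_homogeneousSubmodule _ _).mpr (isHomogeneous_C _ _)⟩ :
        homogeneousSubmodule (Fin (n + 1)) (ULift.{u} ℤ) 0)
  | add p q hp hq => exact add_mem (hp trivial) (hq trivial)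
  | mul_X p i hp => exact mul_mem (hp trivial) (Algebra.subset_adjoin ⟨i, rfl⟩)

/-- A point of projective space with values in a scheme with one point has homogeneous
coordinates. -/
theorem exists_eq_homogPoint {T : Scheme.{u}} [Subsingleton T] [Nonempty T]
    (b : T ⟶ ProjZ.{u} n) : ∃ x hx, b = homogPoint x hx := by
  obtain ⟨p⟩ := ‹Nonempty T›
  have hp : b p ∈ (⨆ j, (stdChart.{u} n j).opensRange : (ProjZ.{u} n).Opens) := by
    rw [iSup_opensRange_stdChart]; trivial
  obtain ⟨j, hj⟩ := TopologicalSpace.Opens.mem_iSup.mp hp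
  have hr : Set.range b ⊆ Set.range (stdChart.{u} n j) := by
    rintro _ ⟨p', rfl⟩
    rw [Subsingleton.elim p' p]
    exact hj
  refine ⟨_, (unimodular_specChartCoord j).map (IsOpenImmersion.lift (stdChart.{u} n j) b hr), ?_⟩
  rw [← comp_homogPoint _ _ (unimodular_specChartCoord j), ← stdChart_eq_homogPoint, IsOpenImmersion.lift_fac]

end ProjectivePoints

/-! ### Ideal sheaves on affine charts, pushforward, and ideal quotients -/

section IdealSheaves

open Scheme.IdealSheafData

theorem ofIdealTop_le_iff {X : Scheme.{u}} [IsAffine X] {I : Ideal Γ(X, ⊤)}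
    {J : X.IdealSheafData} :
    ofIdealTop I ≤ J ↔ I ≤ J.ideal ⟨⊤, isAffineOpen_top X⟩ := by
  constructor
  · intro h
    simpa using h ⟨⊤, isAffineOpen_top X⟩
  · intro h
    exact le_of_isAffine (by simpa using h)

theorem ofIdealTop_ideal_top {X : Scheme.{u}} [IsAffine X] (J : X.IdealSheafData) :
    ofIdealTop (J.ideal ⟨⊤, isAffineOpen_top X⟩) = J :=
  ext_of_isAffine (by simp)

theorem ideal_top_ofIdealTop {X : Scheme.{u}} [IsAffine X] (I : Ideal Γ(X, ⊤)) :
    (ofIdealTop I).ideal ⟨⊤, isAffineOpen_top X⟩ = I := by simp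

theorem ofIdealTop_le_ofIdealTop {X : Scheme.{u}} [IsAffine X] {I J : Ideal Γ(X, ⊤)} :
    ofIdealTop I ≤ ofIdealTop J ↔ I ≤ J := by
  rw [ofIdealTop_le_iff, ideal_top_ofIdealTop]

theorem ofIdealTop_injective {X : Scheme.{u}} [IsAffine X] :
    Function.Injective (ofIdealTop (X := X)) := fun I J h => by
  rw [← ideal_top_ofIdealTop I, h, ideal_top_ofIdealTop]

theorem comap_ofIdealTop {X Y : Scheme.{u}} [IsAffine X] [IsAffine Y] (f : X ⟶ Y)
    (I : Ideal Γ(Y, ⊤)) :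
    (ofIdealTop I).comap f = ofIdealTop (I.map f.appTop.hom) := by
  refine eq_of_forall_ge_iff fun J => ?_
  rw [← le_map_iff_comap_le, ofIdealTop_le_iff, ofIdealTop_le_iff,
    ideal_map J f ⟨⊤, isAffineOpen_top Y⟩ (isAffineOpen_top X), Ideal.map_le_iff_le_comap]
  rfl

theorem iSup_ofIdealTop {X : Scheme.{u}} [IsAffine X] {ι : Type*} (I : ι → Ideal Γ(X, ⊤)) :
    ⨆ i, ofIdealTop (I i) = ofIdealTop (⨆ i, I i) := by
  refine eq_of_forall_ge_iff fun J => ?_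
  rw [iSup_le_iff, ofIdealTop_le_iff, iSup_le_iff]
  simp only [ofIdealTop_le_iff]

theorem comap_iSup {X Y : Scheme.{u}} {ι : Type*} (f : X ⟶ Y) (I : ι → Y.IdealSheafData) :
    (⨆ i, I i).comap f = ⨆ i, (I i).comap f := (map_gc f).l_iSup

/-- The image of an open immersion from an affine scheme, as an affine open. -/
def affineRange {T P : Scheme.{u}} [IsAffine T] (t : T ⟶ P) [IsOpenImmersion t] : P.affineOpens :=
  ⟨t ''ᵁ ⊤, (isAffineOpen_top T).image_of_isOpenImmersion t⟩

theorem comap_ideal_top {T P : Scheme.{u}} [IsAffine T] (t : T ⟶ P) [IsOpenImmersion t]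
    (I : P.IdealSheafData) :
    (I.comap t).ideal ⟨⊤, isAffineOpen_top T⟩ =
      (I.ideal (affineRange t)).comap (t.appIso ⊤).inv.hom :=
  ideal_comap_of_isOpenImmersion I t _

theorem comap_le_comap_iff {T P : Scheme.{u}} [IsAffine T] (t : T ⟶ P) [IsOpenImmersion t]
    {I J : P.IdealSheafData} :
    I.comap t ≤ J.comap t ↔ I.ideal (affineRange t) ≤ J.ideal (affineRange t) := by
  have hsurj : Function.Surjective (t.appIso ⊤).inv.hom :=
    (t.appIso ⊤).symm.commRingCatIsoToRingEquiv.surjective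
  constructor
  · intro h f hf
    obtain ⟨g, rfl⟩ := hsurj f
    have h1 := h ⟨⊤, isAffineOpen_top T⟩
    rw [comap_ideal_top, comap_ideal_top] at h1
    exact h1 hf
  · intro h
    refine le_of_isAffine ?_
    rw [comap_ideal_top, comap_ideal_top]
    exact Ideal.comap_mono h

/-- Inclusions of ideal sheaves can be checked on an affine open cover. -/
theorem le_of_forall_comap_le {P : Scheme.{u}} {I J : P.IdealSheafData}
    (H : ∀ p : P, ∃ (T : Scheme.{u}) (_ : IsAffine T) (t : T ⟶ P) (_ : IsOpenImmersion t),
      p ∈ Set.range t ∧ I.comap t ≤ J.comap t) : I ≤ J := by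
  choose T hT t ht hp hle using H
  refine le_of_iSup_eq_top (fun p => affineRange (t p)) ?_ fun p =>
    (comap_le_comap_iff (t p)).mp (hle p)
  refine top_le_iff.mp fun p _ => TopologicalSpace.Opens.mem_iSup.mpr ⟨p, ?_⟩
  obtain ⟨z, hz⟩ := hp p
  exact ⟨z, trivial, hz⟩

theorem eq_of_forall_comap_eq {P : Scheme.{u}} {I J : P.IdealSheafData}
    (H : ∀ p : P, ∃ (T : Scheme.{u}) (_ : IsAffine T) (t : T ⟶ P) (_ : IsOpenImmersion t),
      p ∈ Set.range t ∧ I.comap t = J.comap t) : I = J := by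
  refine le_antisymm (le_of_forall_comap_le fun p => ?_) (le_of_forall_comap_le fun p => ?_)
  all_goals
    obtain ⟨T, hT, t, ht, hp, he⟩ := H p
    refine ⟨T, hT, t, ht, hp, ?_⟩
    rw [he]

/-- The pushforward of an ideal sheaf commutes with restriction to an open subscheme. -/
theorem comap_map_of_isPullback {E X T P : Scheme.{u}} {e₁ : E ⟶ X} {e₂ : E ⟶ T} {f : X ⟶ P}
    {t : T ⟶ P} (h : IsPullback e₂ e₁ t f) [IsOpenImmersion t] [QuasiCompact f]
    (D : X.IdealSheafData) : (D.map f).comap t = (D.comap e₁).map e₂ := by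
  -- The pushforward is the kernel of the composite of the closed subscheme of `D` with `f`; for a
  -- quasi-compact morphism this kernel commutes with restriction to opens.
  have h1 : IsPullback (pullback.fst e₁ D.subschemeι ≫ e₂) (pullback.snd e₁ D.subschemeι) t
      (D.subschemeι ≫ f) :=
    ((IsPullback.of_hasPullback e₁ D.subschemeι).flip.paste_vert h.flip).flip
  have h2 : (D.comap e₁).map e₂ = (pullback.fst e₁ D.subschemeι ≫ e₂).ker := by
    rw [Scheme.Hom.ker_comp]
    rfl
  rw [h2]
  refine Scheme.IdealSheafData.ext (funext fun W => ?_)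
  rw [ideal_comap_of_isOpenImmersion]
  exact (Scheme.ker_ideal_of_isPullback_of_isOpenImmersion _ _ _ _ h1 W).symm

/-- Each generator of `J` needs its own power of `r` to clear denominators; finite generation lets
one power serve them all. -/
theorem map_colon_of_isLocalization {R S : Type u} [CommRing R] [CommRing S] [Algebra R S] (r : R)
    [IsLocalization.Away r S] (I J : Ideal R) (hJ : J.FG) :
    (Submodule.colon I (J : Set R)).map (algebraMap R S) =
      Submodule.colon (I.map (algebraMap R S)) ((J.map (algebraMap R S) : Ideal S) : Set S) := by
  apply le_antisymm
  · rw [Ideal.map_le_iff_le_comap]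
    intro f hf
    rw [Ideal.mem_comap, Submodule.mem_colon]
    have h1 : J.map (algebraMap R S) ≤
        Submodule.colon (I.map (algebraMap R S)) {algebraMap R S f} := by
      rw [Ideal.map_le_iff_le_comap]
      intro g hg
      rw [Ideal.mem_comap, Submodule.mem_colon_singleton, smul_eq_mul, ← map_mul, mul_comm]
      exact Ideal.mem_map_of_mem _ (Submodule.mem_colon.mp hf g hg)
    intro p hp
    have := Submodule.mem_colon_singleton.mp (h1 hp)
    rwa [smul_eq_mul, mul_comm] at this
  · intro z hz
    obtain ⟨f, s, rfl⟩ := IsLocalization.exists_mk'_eq (Submonoid.powers r) z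
    rw [IsLocalization.mk'_mem_map_algebraMap_iff]
    obtain ⟨t, rfl⟩ := hJ
    have key : ∀ g ∈ t, ∃ N : ℕ, r ^ N * f * g ∈ I := by
      intro g hg
      have h1 := Submodule.mem_colon.mp hz (algebraMap R S g)
        (Ideal.mem_map_of_mem _ (Ideal.subset_span hg))
      rw [smul_eq_mul, mul_comm, IsLocalization.mul_mk'_eq_mk'_of_mul,
        IsLocalization.mk'_mem_map_algebraMap_iff] at h1
      obtain ⟨_, ⟨N, rfl⟩, h2⟩ := h1
      exact ⟨N, by rw [mul_assoc, mul_comm f]; exact h2⟩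
    choose! N hN using key
    refine ⟨r ^ (t.sup N), ⟨_, rfl⟩, ?_⟩
    rw [Submodule.mem_colon]
    intro p hp
    have h2 : Submodule.span R (t : Set R) ≤ Submodule.colon I {r ^ (t.sup N) * f} := by
      rw [Submodule.span_le]
      intro g hg
      rw [SetLike.mem_coe, Submodule.mem_colon_singleton, smul_eq_mul]
      obtain ⟨k, hk⟩ := Nat.exists_eq_add_of_le (Finset.le_sup (f := N) hg)
      rw [hk, pow_add]
      have := I.mul_mem_left (r ^ k) (hN g hg)
      convert this using 1
      ring
    have := Submodule.mem_colon_singleton.mp (h2 hp)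
    rwa [smul_eq_mul, mul_comm] at this

/-- Finite generation passes to basic opens and can be checked on a finite cover by them, so it
spreads from one affine cover to every affine open. -/
theorem fg_ideal_of_forall_fg_comap {P : Scheme.{u}} {C : P.IdealSheafData}
    (H : ∀ p : P, ∃ (T : Scheme.{u}) (_ : IsAffine T) (t : T ⟶ P) (_ : IsOpenImmersion t),
      p ∈ Set.range t ∧ ((C.comap t).ideal ⟨⊤, isAffineOpen_top T⟩).FG) (V : P.affineOpens) :
    (C.ideal V).FG := by
  choose T hT t ht hp hfg using H
  refine of_affine_open_cover (P := fun V => (C.ideal V).FG) (fun p => affineRange (t p)) ?_ V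
    ?_ ?_ ?_
  · refine top_le_iff.mp fun p _ => TopologicalSpace.Opens.mem_iSup.mpr ⟨p, ?_⟩
    obtain ⟨z, hz⟩ := hp p
    exact ⟨z, trivial, hz⟩
  · intro U f hU
    rw [← C.map_ideal_basicOpen U f]
    exact hU.map _
  · intro U s hs hU
    refine Ideal.fg_of_localizationSpan _ hs fun g => ?_
    have h1 := hU g
    rw [← C.map_ideal_basicOpen U g] at h1
    let := (P.presheaf.map (homOfLE (P.basicOpen_le g.1)).op).hom.toAlgebra
    have : IsLocalization.Away g.1 Γ(P, P.basicOpen g.1) := U.2.isLocalization_basicOpen g.1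
    let e := IsLocalization.algEquiv (Submonoid.powers g.1) Γ(P, P.basicOpen g.1)
      (Localization.Away g.1)
    have h2 : (algebraMap Γ(P, U.1) (Localization.Away g.1)) =
        e.toRingEquiv.toRingHom.comp (P.presheaf.map (homOfLE (P.basicOpen_le g.1)).op).hom :=
      (e.toAlgHom.comp_algebraMap).symm
    rw [h2, ← Ideal.map_map]
    exact h1.map _
  · intro p
    have h1 := hfg p
    rw [comap_ideal_top] at h1
    let e := ((t p).appIso ⊤).symm.commRingCatIsoToRingEquiv
    have h2 : (((C.ideal (affineRange (t p))).comap ((t p).appIso ⊤).inv.hom).map e).FG :=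
      h1.map _
    have h3 := Ideal.map_comap_of_surjective e.toRingHom e.surjective (C.ideal (affineRange (t p)))
    exact h3 ▸ h2

/-- The ideal sheaf quotient of an ideal sheaf by an ideal sheaf of finite type. -/
def colonIdeal {P : Scheme.{u}} (F C : P.IdealSheafData) (hC : ∀ V, (C.ideal V).FG) :
    P.IdealSheafData where
  ideal V := Submodule.colon (F.ideal V) (C.ideal V : Set Γ(P, V))
  map_ideal_basicOpen U f := by
    let := (P.presheaf.map (homOfLE (P.basicOpen_le f)).op).hom.toAlgebra
    have : IsLocalization.Away f Γ(P, P.basicOpen f) := U.2.isLocalization_basicOpen f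
    rw [← F.map_ideal_basicOpen U f, ← C.map_ideal_basicOpen U f]
    exact map_colon_of_isLocalization f _ _ (hC U)

/-- The sectionwise quotients form an ideal sheaf because `C` is of finite type, and this sheaf is
then the largest competitor in the supremum. -/
theorem residualIdeal_eq_colonIdeal {P : Scheme.{u}} (F C : P.IdealSheafData)
    (hC : ∀ V, (C.ideal V).FG) : residualIdeal F C = colonIdeal F C hC := by
  apply le_antisymm
  · refine sSup_le fun J hJ V f hf => Submodule.mem_colon.mpr fun g hg => hJ V ?_
    rw [ideal_mul]
    exact Ideal.mul_mem_mul hf hg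
  · refine le_sSup fun V => ?_
    rw [ideal_mul]
    refine Ideal.mul_le.mpr fun f hf g hg => ?_
    exact Submodule.mem_colon.mp hf g hg

theorem mem_comap_colon_iff {R S : Type*} [CommRing R] [CommRing S] {φ : R →+* S}
    (hφ : Function.Surjective φ) {I J : Ideal S} (f : R) :
    f ∈ (Submodule.colon I (J : Set S) : Ideal S).comap φ ↔
      ∀ g ∈ J.comap φ, f * g ∈ I.comap φ := by
  constructor
  · intro hf g hg
    rw [Ideal.mem_comap, map_mul]
    exact Submodule.mem_colon.mp hf _ hg
  · intro hf
    refine Submodule.mem_colon.mpr fun g hg => ?_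
    obtain ⟨g, rfl⟩ := hφ g
    have := hf g hg
    rwa [Ideal.mem_comap, map_mul] at this

theorem comap_residualIdeal {P T : Scheme.{u}} [IsAffine T] (t : T ⟶ P) [IsOpenImmersion t]
    {F C : P.IdealSheafData} (hC : ∀ V, (C.ideal V).FG) {I J K : Ideal Γ(T, ⊤)}
    (hF : F.comap t = ofIdealTop I) (hCt : C.comap t = ofIdealTop J)
    (hK : ∀ f, f ∈ K ↔ ∀ g ∈ J, f * g ∈ I) : (residualIdeal F C).comap t = ofIdealTop K := by
  have hI := comap_ideal_top t F
  have hJ := comap_ideal_top t C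
  rw [hF, ideal_top_ofIdealTop] at hI
  rw [hCt, ideal_top_ofIdealTop] at hJ
  refine ext_of_isAffine ?_
  rw [residualIdeal_eq_colonIdeal F C hC, comap_ideal_top, ideal_top_ofIdealTop]
  have hsurj : Function.Surjective (t.appIso ⊤).inv.hom :=
    (t.appIso ⊤).symm.commRingCatIsoToRingEquiv.surjective
  ext f
  rw [hK, hI, hJ]
  exact mem_comap_colon_iff hsurj f

end IdealSheaves

/-! ### Standard charts of relative projective space and local equations -/

section Charts

open MvPolynomial Scheme.IdealSheafData

theorem exists_appTop_eq {U T : Scheme.{u}} [IsAffine U] (φ : Γ(U, ⊤) →+* Γ(T, ⊤)) :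
    ∃ a : T ⟶ U, a.appTop.hom = φ := by
  refine ⟨T.toSpecΓ ≫ Spec.map (CommRingCat.ofHom φ) ≫ U.isoSpec.inv, ?_⟩
  set a := T.toSpecΓ ≫ Spec.map (CommRingCat.ofHom φ) ≫ U.isoSpec.inv with ha
  have h1 : a ≫ U.toSpecΓ = T.toSpecΓ ≫ Spec.map (CommRingCat.ofHom φ) := by
    simp only [ha, Category.assoc, Scheme.isoSpec_inv_toSpecΓ]
    exact congrArg (T.toSpecΓ ≫ ·) (Category.comp_id _)
  clear_value a
  have h2 := congrArg Scheme.Hom.appTop h1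
  rw [Scheme.Hom.comp_appTop, Scheme.Hom.comp_appTop, Scheme.toSpecΓ_appTop,
    Scheme.toSpecΓ_appTop, Scheme.ΓSpecIso_naturality] at h2
  exact congrArg CommRingCat.Hom.hom ((cancel_epi (Scheme.ΓSpecIso Γ(U, ⊤)).hom).mp h2)

namespace Trivialization

variable {P S : Scheme.{u}} {π : P ⟶ S} {U : S.Opens} (e : Trivialization π U)

theorem hom_ext {T : Scheme.{u}} {f g : T ⟶ (π ⁻¹ᵁ U : Scheme.{u})} (h₁ : f ≫ π ∣_ U = g ≫ π ∣_ U)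
    (h₂ : f ≫ e.coord = g ≫ e.coord) : f = g :=
  e.isPullback.hom_ext h₁ h₂

end Trivialization

/-- The `j`-th standard chart of projective space over `U`. -/
abbrev RelChart (n : ℕ) (U : Scheme.{u}) (j : Fin (n + 1)) : Scheme.{u} :=
  pullback (terminal.from U) (terminal.from (Spec (CommRingCat.of (ChartRing.{u} n j))))

/-- The functions `X i / X j` on the `j`-th standard chart. -/
def relChartCoord {n : ℕ} (U : Scheme.{u}) (j i : Fin (n + 1)) : Γ(RelChart n U j, ⊤) :=
  (pullback.snd (terminal.from U) _).appTop.hom (specChartCoord j i)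

theorem relChartCoord_self {n : ℕ} (U : Scheme.{u}) (j : Fin (n + 1)) :
    relChartCoord U j j = 1 := by
  rw [relChartCoord, specChartCoord_self, map_one]

theorem unimodular_relChartCoord {n : ℕ} (U : Scheme.{u}) (j : Fin (n + 1)) :
    Unimodular (relChartCoord U j) :=
  Unimodular.of_isUnit (j := j) (by rw [relChartCoord_self]; exact isUnit_one)

theorem snd_comp_stdChart {n : ℕ} (U : Scheme.{u}) (j : Fin (n + 1)) :
    pullback.snd (terminal.from U) _ ≫ stdChart n j =
      homogPoint (relChartCoord U j) (unimodular_relChartCoord U j) := by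
  rw [stdChart_eq_homogPoint, comp_homogPoint]
  rfl

theorem RelChart.hom_ext {n : ℕ} {U T : Scheme.{u}} {j : Fin (n + 1)} {f g : T ⟶ RelChart n U j}
    (h₁ : f ≫ pullback.fst _ _ = g ≫ pullback.fst _ _)
    (h₂ : ∀ i, f.appTop.hom (relChartCoord U j i) = g.appTop.hom (relChartCoord U j i)) :
    f = g := by
  refine pullback.hom_ext h₁ (ext_of_isAffine ?_)
  rw [← cancel_epi (Scheme.ΓSpecIso (CommRingCat.of (ChartRing.{u} n j))).inv]
  refine CommRingCat.hom_ext (chartRing_hom_ext fun i => ?_)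
  exact h₂ i

theorem RelChart.exists_lift {n : ℕ} {U T : Scheme.{u}} (a : T ⟶ U) (x : Fin (n + 1) → Γ(T, ⊤))
    {j : Fin (n + 1)} (hj : IsUnit (x j)) :
    ∃ b : T ⟶ RelChart n U j, b ≫ pullback.fst _ _ = a ∧
      ∀ i, b.appTop.hom (relChartCoord U j i) * x j = x i := by
  have hu : IsUnit (evalZ x (X j)) := by rwa [evalZ_X]
  let c := T.toSpecΓ ≫ Spec.map (CommRingCat.ofHom (chartEval (evalZ x) hu))
  refine ⟨pullback.lift a c (Subsingleton.elim _ _), pullback.lift_fst _ _ _, fun i => ?_⟩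
  have h1 : (pullback.lift a c (Subsingleton.elim _ _)).appTop.hom (relChartCoord U j i) =
      c.appTop.hom (specChartCoord j i) := by
    rw [relChartCoord, ← RingHom.comp_apply, ← CommRingCat.hom_comp, ← Scheme.Hom.comp_appTop,
      pullback.lift_snd]
  have h2 : c.appTop.hom (specChartCoord j i) = chartEval (evalZ x) hu (chartCoord j i) := by
    have key : (Scheme.ΓSpecIso (CommRingCat.of (ChartRing.{u} n j))).inv ≫ c.appTop =
        CommRingCat.ofHom (chartEval (evalZ x) hu) := by
      rw [Scheme.Hom.comp_appTop, ← Scheme.ΓSpecIso_inv_naturality_assoc, Scheme.toSpecΓ_appTop,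
        Iso.inv_hom_id, Category.comp_id]
    exact RingHom.congr_fun (congrArg CommRingCat.Hom.hom key) _
  have h3 := chartEval_chartCoord (evalZ x) hu i
  rw [evalZ_X, evalZ_X] at h3
  rw [h1, h2, h3]

/-- Evaluation of polynomials on the `j`-th standard chart. -/
def relChartEval {n : ℕ} (U : Scheme.{u}) (j : Fin (n + 1)) :
    MvPolynomial (Fin (n + 1)) Γ(U, ⊤) →+* Γ(RelChart n U j, ⊤) :=
  eval₂Hom (pullback.fst (terminal.from U) _).appTop.hom (relChartCoord U j)

theorem relChartEval_X_self {n : ℕ} (U : Scheme.{u}) (j : Fin (n + 1)) :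
    relChartEval U j (X j) = 1 := by
  simp [relChartEval, relChartCoord_self]

/-- The map from the functions on a standard chart to the localization of the polynomial ring. -/
theorem exists_relChart_retraction {n : ℕ} (U : Scheme.{u}) [IsAffine U] (j : Fin (n + 1)) :
    ∃ (σ : Γ(RelChart n U j, ⊤) →+* Localization.Away (X j : MvPolynomial (Fin (n + 1)) Γ(U, ⊤)))
      (ρ : Localization.Away (X j : MvPolynomial (Fin (n + 1)) Γ(U, ⊤)) →+* Γ(RelChart n U j, ⊤)),
      (∀ z, ρ (σ z) = z) ∧ (∀ p : MvPolynomial (Fin (n + 1)) Γ(U, ⊤), ρ (algebraMap _ _ p) = relChartEval U j p) ∧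
      ∀ (p : MvPolynomial (Fin (n + 1)) Γ(U, ⊤)) m, p.IsHomogeneous m →
        algebraMap _ (Localization.Away (X j : MvPolynomial (Fin (n + 1)) Γ(U, ⊤))) p =
          algebraMap (MvPolynomial (Fin (n + 1)) Γ(U, ⊤)) _ (X j) ^ m * σ (relChartEval U j p) := by
  set L := Localization.Away (X j : MvPolynomial (Fin (n + 1)) Γ(U, ⊤)) with hL
  let W := Spec (CommRingCat.of L)
  let α : MvPolynomial (Fin (n + 1)) Γ(U, ⊤) →+* L := algebraMap _ L
  let γ := Scheme.ΓSpecIso (CommRingCat.of L)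
  have hγ (z : L) : γ.hom.hom (γ.inv.hom z) = z :=
    RingHom.congr_fun (congrArg CommRingCat.Hom.hom γ.inv_hom_id) z
  obtain ⟨a, ha⟩ := exists_appTop_eq (T := W) (γ.inv.hom.comp (α.comp C))
  have hX : IsUnit (α (X j)) := IsLocalization.Away.algebraMap_isUnit (X j)
  -- The point `[X 0 : ... : X n]` over the localization lies in the `j`-th chart and gives `σ`;
  -- setting `X j = 1` gives `ρ`. That `ρ` retracts `σ` is all that is needed later, so `σ` need not
  -- be identified with the inclusion of the degree-zero part.
  obtain ⟨b, hb₁, hb₂⟩ := RelChart.exists_lift a (fun i => γ.inv.hom (α (X i))) (j := j)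
    (hX.map _)
  let ρ : L →+* Γ(RelChart n U j, ⊤) := IsLocalization.Away.lift (X j)
    (g := relChartEval U j) (by rw [relChartEval_X_self]; exact isUnit_one)
  have hρ (p) : ρ (α p) = relChartEval U j p := IsLocalization.Away.lift_eq _ _ _
  let σ : Γ(RelChart n U j, ⊤) →+* L := γ.hom.hom.comp b.appTop.hom
  have hσ (i) : σ (relChartCoord U j i) * α (X j) = α (X i) := by
    have := congrArg γ.hom.hom (hb₂ i)
    rwa [map_mul, hγ, hγ] at this
  have hσC : σ.comp (pullback.fst (terminal.from U) _).appTop.hom = α.comp C := by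
    have h1 : b.appTop.hom.comp (pullback.fst (terminal.from U) _).appTop.hom = a.appTop.hom := by
      rw [← CommRingCat.hom_comp, ← Scheme.Hom.comp_appTop, hb₁]
    refine RingHom.ext fun r => ?_
    have h2 := congrArg γ.hom.hom ((RingHom.congr_fun h1 r).trans (RingHom.congr_fun ha r))
    exact h2.trans (hγ _)
  refine ⟨σ, ρ, ?_, hρ, ?_⟩
  · obtain ⟨b', hb'⟩ := exists_appTop_eq (U := W) (ρ.comp γ.hom.hom)
    have h1 (z) : (b' ≫ b).appTop.hom z = ρ (σ z) := by
      rw [Scheme.Hom.comp_appTop, CommRingCat.hom_comp, RingHom.comp_apply, hb']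
      rfl
    -- An endomorphism of the chart is determined by its base component and by the images of the
    -- coordinate functions.
    have h2 : b' ≫ b = 𝟙 _ := by
      refine RelChart.hom_ext ?_ fun i => ?_
      · refine ext_of_isAffine (CommRingCat.hom_ext (RingHom.ext fun r => ?_))
        rw [Scheme.Hom.comp_appTop, CommRingCat.hom_comp, RingHom.comp_apply, h1]
        have h3 := RingHom.congr_fun hσC r
        rw [RingHom.comp_apply] at h3
        rw [h3, RingHom.comp_apply, hρ, Category.id_comp]
        simp [relChartEval]
      · have h3 := congrArg ρ (hσ i)
        rw [map_mul, hρ, hρ, relChartEval_X_self, mul_one] at h3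
        rw [h1, h3]
        simp [relChartEval]
    intro z
    rw [← h1, h2]
    simp
  · intro p m hp
    change α p = α (X j) ^ m * σ (eval₂ _ _ p)
    rw [hom_eval₂, hσC, ← eval₂_mul_of_isHomogeneous _ _ _ hp]
    simp only [mul_comm (α (X j)), hσ]
    rw [← RingHom.comp_id (α.comp C), ← coe_eval₂Hom]
    refine RingHom.congr_fun (f := α) (MvPolynomial.ringHom_ext' ?_ ?_) p
    · ext; simp
    · intro i; simp

/-- `σ` carries the relation to the localized polynomial ring; after denominators are cleared by
powers of `X j`, regularity applies to genuine polynomials, and setting `X j = 1` returns to the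
chart. -/
theorem relChart_dvd_of_dvd_mul {n : ℕ} {U : Scheme.{u}} [IsAffine U] (j : Fin (n + 1))
    {g Q : MvPolynomial (Fin (n + 1)) Γ(U, ⊤)} {k m : ℕ} (hg : g.IsHomogeneous k)
    (hQ : Q.IsHomogeneous m) (hreg : ∀ f, Q ∣ g * f → Q ∣ f) {z : Γ(RelChart n U j, ⊤)}
    (h : relChartEval U j Q ∣ relChartEval U j g * z) : relChartEval U j Q ∣ z := by
  obtain ⟨σ, ρ, hρσ, hρ, hσ⟩ := exists_relChart_retraction U j
  obtain ⟨w, hw⟩ := h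
  obtain ⟨N₁, f, hf⟩ := IsLocalization.Away.surj (X j : MvPolynomial (Fin (n + 1)) Γ(U, ⊤)) (σ z)
  obtain ⟨N₂, v, hv⟩ := IsLocalization.Away.surj (X j : MvPolynomial (Fin (n + 1)) Γ(U, ⊤)) (σ w)
  have h1 := congrArg σ hw
  rw [map_mul, map_mul] at h1
  have h2 : algebraMap _ (Localization.Away (X j : MvPolynomial (Fin (n + 1)) Γ(U, ⊤)))
      (X j ^ m * X j ^ N₂ * (g * f)) = algebraMap _ _ (X j ^ k * X j ^ N₁ * (Q * v)) := by
    simp only [map_mul, map_pow, ← hf, ← hv, hσ g k hg, hσ Q m hQ]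
    linear_combination (algebraMap (MvPolynomial (Fin (n + 1)) Γ(U, ⊤))
      (Localization.Away (X j : MvPolynomial (Fin (n + 1)) Γ(U, ⊤))) (X j)) ^ (m + N₂ + k + N₁) * h1
  obtain ⟨⟨_, N, rfl⟩, hN⟩ := IsLocalization.exists_of_eq
    (M := Submonoid.powers (X j : MvPolynomial (Fin (n + 1)) Γ(U, ⊤))) h2
  have h3 : Q ∣ X j ^ N * (X j ^ m * X j ^ N₂ * f) := by
    refine hreg _ ⟨X j ^ N * (X j ^ k * X j ^ N₁ * v), ?_⟩
    linear_combination hN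
  have h4 := map_dvd (relChartEval U j) h3
  simp only [map_mul, map_pow, relChartEval_X_self, one_pow, one_mul] at h4
  have h5 := congrArg ρ hf
  simp only [map_mul, map_pow, hρ, hρσ, relChartEval_X_self, one_pow, mul_one] at h5
  rwa [h5]

/-- In the localization a homogeneous form differs from its dehomogenization by a power of the unit
`X j`, so membership on the chart is membership after inverting `X j`. -/
theorem exists_pow_mul_mem_span_of_relChartEval_mem {n : ℕ} {U : Scheme.{u}} [IsAffine U]
    (j : Fin (n + 1)) {s : Set (MvPolynomial (Fin (n + 1)) Γ(U, ⊤))}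
    (hs : ∀ q ∈ s, ∃ m, q.IsHomogeneous m) {p : MvPolynomial (Fin (n + 1)) Γ(U, ⊤)} {k : ℕ}
    (hp : p.IsHomogeneous k)
    (h : relChartEval U j p ∈ Ideal.span (relChartEval U j '' s)) :
    ∃ N, X j ^ N * p ∈ Ideal.span s := by
  obtain ⟨σ, -, -, -, hσ⟩ := exists_relChart_retraction U j
  set α := algebraMap (MvPolynomial (Fin (n + 1)) Γ(U, ⊤))
    (Localization.Away (X j : MvPolynomial (Fin (n + 1)) Γ(U, ⊤))) with hα
  have hX : IsUnit (α (X j)) := IsLocalization.Away.algebraMap_isUnit (X j)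
  have h1 : σ (relChartEval U j p) ∈ (Ideal.span s).map α := by
    have h2 := Ideal.mem_map_of_mem σ h
    rw [Ideal.map_span] at h2
    refine Ideal.span_le.mpr ?_ h2
    rintro _ ⟨_, ⟨q, hq, rfl⟩, rfl⟩
    obtain ⟨m, hm⟩ := hs q hq
    refine (Ideal.unit_mul_mem_iff_mem _ (hX.pow m)).mp ?_
    rw [← hσ q m hm]
    exact Ideal.mem_map_of_mem _ (Ideal.subset_span hq)
  have h2 : α p ∈ (Ideal.span s).map α := by
    rw [hσ p k hp]
    exact Ideal.mul_mem_left _ _ h1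
  rw [IsLocalization.algebraMap_mem_map_algebraMap_iff
    (Submonoid.powers (X j : MvPolynomial (Fin (n + 1)) Γ(U, ⊤)))] at h2
  obtain ⟨_, ⟨N, rfl⟩, h3⟩ := h2
  exact ⟨N, h3⟩

theorem isDomain_relChart {n : ℕ} (U : Scheme.{u}) [IsAffine U] [IsDomain Γ(U, ⊤)]
    (j : Fin (n + 1)) : IsDomain Γ(RelChart n U j, ⊤) := by
  obtain ⟨σ, ρ, hρσ, -, -⟩ := exists_relChart_retraction U j
  have : IsDomain (Localization.Away (X j : MvPolynomial (Fin (n + 1)) Γ(U, ⊤))) :=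
    IsLocalization.isDomain_localization (powers_le_nonZeroDivisors_of_noZeroDivisors (X_ne_zero j))
  exact Function.Injective.isDomain σ (Function.LeftInverse.injective hρσ)

theorem span_image_eq_of_isUnit_mul {A B : Type*} [CommRing B] (f g : A → B) (s : Set A)
    (h : ∀ p ∈ s, ∃ c, IsUnit c ∧ f p = c * g p) : Ideal.span (f '' s) = Ideal.span (g '' s) := by
  apply le_antisymm
  · refine Ideal.span_le.mpr ?_
    rintro _ ⟨p, hp, rfl⟩
    obtain ⟨c, -, hc⟩ := h p hp
    rw [hc]
    exact Ideal.mul_mem_left _ _ (Ideal.subset_span ⟨p, hp, rfl⟩)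
  · refine Ideal.span_le.mpr ?_
    rintro _ ⟨p, hp, rfl⟩
    obtain ⟨c, hu, hc⟩ := h p hp
    refine (Ideal.unit_mul_mem_iff_mem _ hu).mp ?_
    rw [← hc]
    exact Ideal.subset_span ⟨p, hp, rfl⟩

namespace Trivialization

variable {P S : Scheme.{u}} {π : P ⟶ S} {U : S.Opens} (e : Trivialization π U)

/-- The `j`-th standard chart in the coordinates `e`. -/
def chart (j : Fin 4) : RelChart 3 U j ⟶ (π ⁻¹ᵁ U : Scheme.{u}) :=
  e.isPullback.lift (pullback.fst _ _) (pullback.snd _ _ ≫ stdChart 3 j) (Subsingleton.elim _ _)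

theorem chart_π (j : Fin 4) : e.chart j ≫ π ∣_ U = pullback.fst _ _ :=
  e.isPullback.lift_fst _ _ _

theorem chart_coord (j : Fin 4) :
    e.chart j ≫ e.coord = homogPoint (relChartCoord U j) (unimodular_relChartCoord _ j) := by
  rw [← snd_comp_stdChart]
  exact e.isPullback.lift_snd _ _ _

theorem isPullback_chart (j : Fin 4) :
    IsPullback (e.chart j) (pullback.snd _ _) e.coord (stdChart 3 j) := by
  refine IsPullback.of_right (h₁₂ := π ∣_ U) (h₂₂ := terminal.from _) ?_
    (e.isPullback.lift_snd _ _ _) e.isPullback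
  rw [chart_π, Subsingleton.elim (stdChart 3 j ≫ terminal.from _) (terminal.from _)]
  exact IsPullback.of_hasPullback _ _

instance (j : Fin 4) : IsOpenImmersion (e.chart j) :=
  MorphismProperty.of_isPullback (P := @IsOpenImmersion) (e.isPullback_chart j).flip inferInstance

theorem coeffMap_chart (j : Fin 4) :
    coeffMap π U (e.chart j) = (pullback.fst (terminal.from (U : Scheme.{u})) _).appTop.hom := by
  rw [coeffMap, chart_π]

theorem eval₂_chart (j : Fin 4) (p : MvPolynomial (Fin 4) Γ((U : Scheme.{u}), ⊤)) :
    eval₂ (coeffMap π U (e.chart j)) (relChartCoord U j) p = relChartEval U j p := by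
  rw [coeffMap_chart]
  rfl

theorem exists_chart_eq (p : (π ⁻¹ᵁ U : Scheme.{u})) : ∃ j z, e.chart j z = p := by
  have hp : e.coord p ∈ (⨆ j, (stdChart.{u} 3 j).opensRange : (ProjZ.{u} 3).Opens) := by
    rw [iSup_opensRange_stdChart]; trivial
  obtain ⟨j, hj⟩ := TopologicalSpace.Opens.mem_iSup.mp hp
  obtain ⟨y, hy⟩ := hj
  obtain ⟨z, hz, -⟩ := Scheme.exists_preimage_of_isPullback (e.isPullback_chart j) p y hy.symm
  exact ⟨j, z, hz⟩

/-- A point over `U` whose `j`-th coordinate is invertible lies in the `j`-th chart. -/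
theorem exists_comp_chart_eq {T : Scheme.{u}} (t : T ⟶ (π ⁻¹ᵁ U : Scheme.{u}))
    (x : Fin 4 → Γ(T, ⊤)) (hx : Unimodular x) (h : t ≫ e.coord = homogPoint x hx) {j : Fin 4}
    (hj : IsUnit (x j)) :
    ∃ b : T ⟶ RelChart 3 U j, b ≫ e.chart j = t ∧
      ∀ i, b.appTop.hom (relChartCoord (U : Scheme.{u}) j i) * x j = x i := by
  obtain ⟨b, hb₁, hb₂⟩ := RelChart.exists_lift (t ≫ π ∣_ U) x hj
  refine ⟨b, e.hom_ext ?_ ?_, hb₂⟩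
  · rw [Category.assoc, chart_π, hb₁]
  · rw [Category.assoc, chart_coord, h, comp_homogPoint]
    refine homogPoint_eq_of_isUnit _ _ (j := j) ?_ hj fun i => ?_
    · rw [relChartCoord_self, map_one]
      exact isUnit_one
    · rw [hb₂, relChartCoord_self, map_one, mul_one]

end Trivialization

theorem coeffMap_comp {P S T V : Scheme.{u}} (π : P ⟶ S) (U : S.Opens)
    (t : T ⟶ (π ⁻¹ᵁ U : Scheme.{u})) (b : V ⟶ T) :
    coeffMap π U (b ≫ t) = b.appTop.hom.comp (coeffMap π U t) := by
  rw [coeffMap, coeffMap, Category.assoc, Scheme.Hom.comp_appTop, CommRingCat.hom_comp]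

section CutOut

variable {P S : Scheme.{u}} {π : P ⟶ S} {U : S.Opens} {e : Trivialization π U}
  {I J : P.IdealSheafData} {s s' : Set (MvPolynomial (Fin 4) Γ((U : Scheme.{u}), ⊤))}

theorem IsCutOutBy.comap_chart [IsAffine (U : Scheme.{u})] (h : IsCutOutBy e I s) (j : Fin 4) :
    I.comap (e.chart j ≫ (π ⁻¹ᵁ U).ι) = ofIdealTop (Ideal.span (relChartEval U j '' s)) := by
  have := h _ (e.chart j) _ _ (e.chart_coord j)
  simpa only [e.eval₂_chart] using this

/-- Any point with values in `T` lies locally in a chart, where its coordinates are a unit times the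
chart coordinates. Homogeneous equations then change by a power of that unit, which does not affect
the ideal. -/
theorem isCutOutBy_of_forall_comap_chart [IsAffine (U : Scheme.{u})]
    (hs : ∀ q ∈ s, ∃ m, q.IsHomogeneous m)
    (h : ∀ j, I.comap (e.chart j ≫ (π ⁻¹ᵁ U).ι) =
      ofIdealTop (Ideal.span (relChartEval U j '' s))) : IsCutOutBy e I s := by
  intro T _ t x hx htx
  refine eq_of_forall_comap_eq fun p => ?_
  obtain ⟨j, hj⟩ := TopologicalSpace.Opens.mem_iSup.mp
    (show p ∈ ⨆ j, T.basicOpen (x j) by rw [hx.iSup_basicOpen]; trivial)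
  have : IsAffine (T.basicOpen (x j) : Scheme.{u}) := (isAffineOpen_top T).basicOpen (x j)
  refine ⟨_, this, (T.basicOpen (x j)).ι, inferInstance, by simpa using hj, ?_⟩
  set v := (T.basicOpen (x j)).ι with hv
  have hu : IsUnit (v.appTop.hom (x j)) := isUnit_appTop_basicOpen_ι (x j)
  have hvx : (v ≫ t) ≫ e.coord = homogPoint _ (hx.map v) := by
    rw [Category.assoc, htx, comp_homogPoint]
  obtain ⟨b, hb₁, hb₂⟩ := e.exists_comp_chart_eq (v ≫ t) _ _ hvx hu
  rw [← comap_comp, ← Category.assoc, ← hb₁, Category.assoc, comap_comp, h j, comap_ofIdealTop,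
    comap_ofIdealTop, Ideal.map_span, Ideal.map_span, ← Set.image_comp, ← Set.image_comp]
  congr 1
  symm
  refine span_image_eq_of_isUnit_mul _ _ _ fun q hq => ?_
  obtain ⟨m, hm⟩ := hs q hq
  refine ⟨_, hu.pow m, ?_⟩
  have hc : v.appTop.hom.comp (coeffMap π U t) =
      b.appTop.hom.comp (pullback.fst (terminal.from (U : Scheme.{u})) _).appTop.hom := by
    rw [← coeffMap_comp, ← hb₁, coeffMap_comp, e.coeffMap_chart]
  simp only [Function.comp_apply, relChartEval, coe_eval₂Hom, hom_eval₂]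
  rw [hc, ← eval₂_mul_of_isHomogeneous _ _ _ hm]
  congr 1
  funext i
  rw [mul_comm, hb₂]

theorem exists_mem_range_chart (e : Trivialization π U) {p : P} (hp : π p ∈ U) :
    ∃ j, p ∈ Set.range (e.chart j ≫ (π ⁻¹ᵁ U).ι) := by
  obtain ⟨j, z, hz⟩ := e.exists_chart_eq ⟨p, hp⟩
  exact ⟨j, z, by rw [Scheme.Hom.comp_apply, hz]; rfl⟩

end CutOut

/-- Inclusions of ideal sheaves can be checked on the standard charts. -/
theorem le_of_forall_comap_chart_le {P S : Scheme.{u}} {π : P ⟶ S} {I J : P.IdealSheafData}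
    (H : ∀ s : S, ∃ U : S.Opens, s ∈ U ∧ IsAffineOpen U ∧ ∃ e : Trivialization π U, ∀ j,
      I.comap (e.chart j ≫ (π ⁻¹ᵁ U).ι) ≤ J.comap (e.chart j ≫ (π ⁻¹ᵁ U).ι)) : I ≤ J := by
  refine le_of_forall_comap_le fun p => ?_
  obtain ⟨U, hU, hU', e, h⟩ := H (π p)
  obtain ⟨j, hj⟩ := exists_mem_range_chart e hU
  have : IsAffine (U : Scheme.{u}) := hU'
  exact ⟨_, inferInstance, e.chart j ≫ (π ⁻¹ᵁ U).ι, inferInstance, hj, h j⟩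

/-- Ideal sheaves that are locally cut out by the same equations are equal. -/
theorem eq_of_forall_isCutOutBy {P S : Scheme.{u}} {π : P ⟶ S} {I J : P.IdealSheafData}
    (H : ∀ s : S, ∃ U : S.Opens, s ∈ U ∧ IsAffineOpen U ∧ ∃ (e : Trivialization π U) (r : Set _),
      IsCutOutBy e I r ∧ IsCutOutBy e J r) : I = J := by
  refine le_antisymm (le_of_forall_comap_chart_le (π := π) fun s => ?_)
    (le_of_forall_comap_chart_le (π := π) fun s => ?_)
  all_goals
    obtain ⟨U, hU, hU', e, r, hI, hJ⟩ := H s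
    have : IsAffine (U : Scheme.{u}) := hU'
    refine ⟨U, hU, hU', e, fun j => ?_⟩
    rw [hI.comap_chart, hJ.comap_chart]

end Charts

/-! ### Base change of coordinates, cameras, conics and curves -/

section BaseChange

open MvPolynomial Scheme.IdealSheafData

/-- Over the open `U`, the closed subscheme of `ℙ²_S` with ideal sheaf `D` is the zero scheme
of `q`. -/
def IsPlaneCutOutBy {S : Scheme.{u}} (D : (ProjOver 2 S).IdealSheafData) (U : S.Opens)
    (q : MvPolynomial (Fin 3) Γ((U : Scheme.{u}), ⊤)) : Prop :=
  ∀ (T : Scheme.{u}) [IsAffine T] (a : T ⟶ (U : Scheme.{u})) (y : Fin 3 → Γ(T, ⊤))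
    (hy : Unimodular y), D.comap (toProjOver (a ≫ U.ι) (homogPoint y hy)) =
      ofIdealTop (Ideal.span {eval₂ a.appTop.hom y q})

theorem toProjOver_fst {n : ℕ} {S T : Scheme.{u}} (a : T ⟶ S) (b : T ⟶ ProjZ.{u} n) :
    toProjOver a b ≫ pullback.fst _ _ = a := pullback.lift_fst _ _ _

theorem toProjOver_snd {n : ℕ} {S T : Scheme.{u}} (a : T ⟶ S) (b : T ⟶ ProjZ.{u} n) :
    toProjOver a b ≫ pullback.snd _ _ = b := pullback.lift_snd _ _ _

theorem comp_toProjOver {n : ℕ} {S T V : Scheme.{u}} (v : V ⟶ T) (a : T ⟶ S) (b : T ⟶ ProjZ.{u} n) :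
    v ≫ toProjOver a b = toProjOver (v ≫ a) (v ≫ b) := by
  apply pullback.hom_ext
  · rw [Category.assoc, toProjOver_fst, toProjOver_fst]
  · rw [Category.assoc, toProjOver_snd, toProjOver_snd]

theorem toProjOver_comp_projOverMap {n : ℕ} {S S' T : Scheme.{u}} (a : T ⟶ S) (b : T ⟶ ProjZ.{u} n)
    (f : S ⟶ S') : toProjOver a b ≫ projOverMap n f = toProjOver (a ≫ f) b := by
  rw [projOverMap, comp_toProjOver, ← Category.assoc, toProjOver_fst, toProjOver_snd]

theorem IsPlaneCutOutBy.baseChange {S S' : Scheme.{u}} {D : (ProjOver 2 S').IdealSheafData}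
    {U : S'.Opens} {q : MvPolynomial (Fin 3) Γ((U : Scheme.{u}), ⊤)} (h : IsPlaneCutOutBy D U q)
    (f : S ⟶ S') {W : S.Opens} (hW : W ≤ f ⁻¹ᵁ U) :
    IsPlaneCutOutBy (D.comap (projOverMap 2 f)) W
      (MvPolynomial.map (f.resLE U W hW).appTop.hom q) := by
  intro T _ a y hy
  rw [← comap_comp, toProjOver_comp_projOverMap, Category.assoc, ← Scheme.Hom.resLE_comp_ι f hW,
    ← Category.assoc, h, eval₂_map, Scheme.Hom.comp_appTop, CommRingCat.hom_comp]

section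

variable {P S P' S' : Scheme.{u}} {π : P ⟶ S} {π' : P' ⟶ S'} {g : P ⟶ P'} {f : S ⟶ S'}

theorem isPullback_resLE (h : IsPullback g π π' f) {U : S'.Opens} {W : S.Opens} (hW : W ≤ f ⁻¹ᵁ U)
    (hW' : π ⁻¹ᵁ W ≤ g ⁻¹ᵁ π' ⁻¹ᵁ U) :
    IsPullback (g.resLE (π' ⁻¹ᵁ U) (π ⁻¹ᵁ W) hW') (π ∣_ W) (π' ∣_ U) (f.resLE U W hW) := by
  refine IsPullback.of_right (h₁₂ := (π' ⁻¹ᵁ U).ι) (v₁₃ := π') (h₂₂ := U.ι) ?_ ?_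
    (isPullback_morphismRestrict π' U).flip
  · rw [Scheme.Hom.resLE_comp_ι, Scheme.Hom.resLE_comp_ι]
    exact (isPullback_morphismRestrict π W).flip.paste_horiz h
  · rw [← cancel_mono U.ι, Category.assoc, Category.assoc, Scheme.Hom.resLE_comp_ι,
      morphismRestrict_ι, Scheme.Hom.resLE_comp_ι_assoc, morphismRestrict_ι_assoc, h.w]

theorem preimage_le_of_le (h : IsPullback g π π' f) {U : S'.Opens} {W : S.Opens}
    (hW : W ≤ f ⁻¹ᵁ U) : π ⁻¹ᵁ W ≤ g ⁻¹ᵁ π' ⁻¹ᵁ U := by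
  rw [← Scheme.Hom.comp_preimage, h.w, Scheme.Hom.comp_preimage]
  exact fun p hp => hW hp

/-- Base change of a trivialization. -/
def Trivialization.baseChange {U : S'.Opens} (e : Trivialization π' U) (h : IsPullback g π π' f)
    {W : S.Opens} (hW : W ≤ f ⁻¹ᵁ U) : Trivialization π W where
  coord := g.resLE (π' ⁻¹ᵁ U) (π ⁻¹ᵁ W) (preimage_le_of_le h hW) ≫ e.coord
  isPullback := by
    have h1 := (isPullback_resLE h hW (preimage_le_of_le h hW)).flip.paste_vert e.isPullback
    rwa [Subsingleton.elim (f.resLE U W hW ≫ terminal.from _) (terminal.from _)] at h1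

theorem coeffMap_resLE (h : IsPullback g π π' f) {U : S'.Opens}
    {W : S.Opens} (hW : W ≤ f ⁻¹ᵁ U) {T : Scheme.{u}} (t : T ⟶ (π ⁻¹ᵁ W : Scheme.{u})) :
    coeffMap π' U (t ≫ g.resLE (π' ⁻¹ᵁ U) (π ⁻¹ᵁ W) (preimage_le_of_le h hW)) =
      (coeffMap π W t).comp (f.resLE U W hW).appTop.hom := by
  rw [coeffMap, coeffMap, Category.assoc, (isPullback_resLE h hW _).w, ← Category.assoc,
    Scheme.Hom.comp_appTop, CommRingCat.hom_comp]

/-- Equations are tested on arbitrary affine points, so base change amounts to viewing a point over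
`W` as a point over `U`. -/
theorem IsCutOutBy.baseChange {U : S'.Opens} {e : Trivialization π' U} {I : P'.IdealSheafData}
    {s : Set (MvPolynomial (Fin 4) Γ((U : Scheme.{u}), ⊤))} (hs : IsCutOutBy e I s)
    (h : IsPullback g π π' f) {W : S.Opens} (hW : W ≤ f ⁻¹ᵁ U) :
    IsCutOutBy (e.baseChange h hW) (I.comap g)
      (MvPolynomial.map (f.resLE U W hW).appTop.hom '' s) := by
  intro T _ t x hx htx
  have h1 := hs T (t ≫ g.resLE (π' ⁻¹ᵁ U) (π ⁻¹ᵁ W) (preimage_le_of_le h hW)) x hx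
    (by rw [Category.assoc]; exact htx)
  rw [Category.assoc, Scheme.Hom.resLE_comp_ι, ← Category.assoc, comap_comp, coeffMap_resLE h] at h1
  rw [h1, ← Set.image_comp]
  congr 3
  funext p
  rw [Function.comp_apply, eval₂_map]

theorem CameraData.IsGivenBy.baseChange {U : S'.Opens} {e : Trivialization π' U}
    {φ' : CameraData π'} {A : Matrix (Fin 3) (Fin 4) Γ((U : Scheme.{u}), ⊤)}
    (hA : φ'.IsGivenBy e A) {φ : CameraData π} (h : IsPullback g π π' f)
    (hc : φ.center ≫ g = f ≫ φ'.center)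
    (hm : ∃ r : (φ.dom : Scheme.{u}) ⟶ (φ'.dom : Scheme.{u}),
      r ≫ φ'.dom.ι = φ.dom.ι ≫ g ∧ r ≫ φ'.map = φ.map) {W : S.Opens} (hW : W ≤ f ⁻¹ᵁ U) :
    φ.IsGivenBy (e.baseChange h hW) (A.map (f.resLE U W hW).appTop.hom) where
  surjective := surjective_mulVec_map _ hA.surjective
  center := by
    obtain ⟨c, hc', t, h1, h2, h3⟩ := hA.center
    refine ⟨_, hc'.map (f.resLE U W hW), (isPullback_resLE h hW (preimage_le_of_le h hW)).lift
      (f.resLE U W hW ≫ t) (𝟙 _) ?_, ?_, ?_, ?_⟩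
    · rw [← cancel_mono U.ι, Category.id_comp, Category.assoc, Category.assoc, morphismRestrict_ι,
        reassoc_of% h2, φ'.center_π, Category.comp_id]
    · have := congrArg (fun v => (f.resLE U W hW).appTop.hom ∘ v) h1
      funext i
      have h4 := congrFun this i
      simpa [Matrix.mulVec, dotProduct] using h4
    · refine h.hom_ext ?_ ?_
      · rw [Category.assoc, ← Scheme.Hom.resLE_comp_ι g (preimage_le_of_le h hW),
          IsPullback.lift_fst_assoc, Category.assoc, h2, Scheme.Hom.resLE_comp_ι_assoc,
          Category.assoc, hc]
      · rw [Category.assoc, ← morphismRestrict_ι π W, IsPullback.lift_snd_assoc, Category.id_comp,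
          Category.assoc, φ.center_π, Category.comp_id]
    · change _ ≫ _ ≫ e.coord = _
      rw [IsPullback.lift_fst_assoc, Category.assoc, h3, comp_homogPoint]
  map := by
    obtain ⟨r, hr₁, hr₂⟩ := hm
    intro T _ t x hx t' h1 h2
    obtain ⟨hy, h3⟩ := hA.map T (t ≫ g.resLE (π' ⁻¹ᵁ U) (π ⁻¹ᵁ W) (preimage_le_of_le h hW)) x hx
      (t' ≫ r) (by rw [Category.assoc]; exact h1) (by
        rw [Category.assoc, hr₁, reassoc_of% h2, Category.assoc, Scheme.Hom.resLE_comp_ι])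
    rw [Category.assoc, hr₂] at h3
    have h4 : A.map (coeffMap π' U
        (t ≫ g.resLE (π' ⁻¹ᵁ U) (π ⁻¹ᵁ W) (preimage_le_of_le h hW))) =
        (A.map (f.resLE U W hW).appTop.hom).map (coeffMap π W t) := by
      rw [coeffMap_resLE h, Matrix.map_map]
      rfl
    simp only [h4] at h3 hy
    exact ⟨hy, h3⟩

end

end BaseChange

/-! ### Linear cameras on the standard charts -/

section Cones

open MvPolynomial Scheme.IdealSheafData

/-- The image of the generic point of the `j`-th chart under the matrix `A`. -/
def relChartImage {U : Scheme.{u}} (A : Matrix (Fin 3) (Fin 4) Γ(U, ⊤)) (j : Fin 4) :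
    Fin 3 → Γ(RelChart 3 U j, ⊤) :=
  (A.map (pullback.fst (terminal.from U) _).appTop.hom).mulVec (relChartCoord U j)

theorem relChartEval_coneForm {U : Scheme.{u}} (A : Matrix (Fin 3) (Fin 4) Γ(U, ⊤))
    (q : MvPolynomial (Fin 3) Γ(U, ⊤)) (j : Fin 4) :
    relChartEval U j (coneForm A q) =
      eval₂ (pullback.fst (terminal.from U) _).appTop.hom (relChartImage A j) q :=
  eval₂_coneForm _ _ _ _

theorem relChartEval_linear {U : Scheme.{u}} (A : Matrix (Fin 3) (Fin 4) Γ(U, ⊤)) (j : Fin 4)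
    (i : Fin 3) : relChartEval U j (∑ k, C (A i k) * X k) = relChartImage A j i := by
  simp [relChartEval, relChartImage, Matrix.mulVec, dotProduct]

theorem map_mulVec_map {m n : ℕ} {R R' R'' : Type*} [CommRing R] [CommRing R'] [CommRing R'']
    (A : Matrix (Fin m) (Fin n) R) (f : R →+* R') (g : R' →+* R'') (x : Fin n → R') :
    (fun i => g ((A.map f).mulVec x i)) = (A.map (g.comp f)).mulVec (fun i => g (x i)) := by
  funext i
  simp [Matrix.mulVec, dotProduct]

theorem appTop_ne_zero_of_mem_basicOpen {V T : Scheme.{u}} (a : V ⟶ T) (f : Γ(T, ⊤)) (v : V)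
    (hv : a v ∈ T.basicOpen f) : a.appTop.hom f ≠ 0 := by
  intro h
  have h1 := Scheme.preimage_basicOpen_top a f
  have h2 : v ∈ V.basicOpen (a.appTop.hom f) := h1 ▸ hv
  rw [h, Scheme.basicOpen_zero] at h2
  exact h2

namespace CameraData.IsGivenBy

variable {P S : Scheme.{u}} {π : P ⟶ S} {φ : CameraData π} {U : S.Opens} {e : Trivialization π U}
  {A : Matrix (Fin 3) (Fin 4) Γ((U : Scheme.{u}), ⊤)}

theorem relChartImage_comp (j : Fin 4) {T : Scheme.{u}} (b : T ⟶ RelChart 3 (U : Scheme.{u}) j) :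
    (fun i => b.appTop.hom (relChartImage A j i)) =
      (A.map (coeffMap π U (b ≫ e.chart j))).mulVec
        (fun i => b.appTop.hom (relChartCoord (U : Scheme.{u}) j i)) := by
  rw [relChartImage, map_mulVec_map, coeffMap_comp, e.coeffMap_chart]

/-- The domain of a linear camera is the locus where its coordinates do not all vanish. -/
theorem preimage_dom (hA : φ.IsGivenBy e A) (j : Fin 4) :
    (e.chart j ≫ (π ⁻¹ᵁ U).ι) ⁻¹ᵁ φ.dom =
      ⨆ i, (RelChart 3 (U : Scheme.{u}) j).basicOpen (relChartImage A j i) := by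
  set T := RelChart 3 (U : Scheme.{u}) j
  refine TopologicalSpace.Opens.ext (Set.ext fun z => ?_)
  rw [SetLike.mem_coe, SetLike.mem_coe]
  constructor
  · intro hz
    -- Over the residue field at `z` the camera is defined, so its image coordinates generate the
    -- unit ideal and one of them is nonzero at `z`.
    let b := T.fromSpecResidueField z
    have hbz (v) : b v = z := T.fromSpecResidueField_apply z v
    have hr : Set.range (b ≫ e.chart j ≫ (π ⁻¹ᵁ U).ι) ⊆ Set.range φ.dom.ι := by
      rintro _ ⟨v, rfl⟩
      rw [Scheme.Opens.range_ι, Scheme.Hom.comp_apply, hbz]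
      exact hz
    obtain ⟨hy, -⟩ := hA.map _ (b ≫ e.chart j) _
      ((unimodular_relChartCoord (U : Scheme.{u}) j).map b)
      (IsOpenImmersion.lift φ.dom.ι (b ≫ e.chart j ≫ (π ⁻¹ᵁ U).ι) hr)
      (by rw [Category.assoc, e.chart_coord, comp_homogPoint])
      (by rw [IsOpenImmersion.lift_fac, Category.assoc])
    rw [← relChartImage_comp] at hy
    let v : Spec (T.residueField z) := IsLocalRing.closedPoint _
    obtain ⟨i, hi⟩ := TopologicalSpace.Opens.mem_iSup.mp
      (show v ∈ ⨆ i, (Spec (T.residueField z)).basicOpen (b.appTop.hom (relChartImage A j i)) by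
        rw [hy.iSup_basicOpen]; trivial)
    refine TopologicalSpace.Opens.mem_iSup.mpr ⟨i, ?_⟩
    rw [← Scheme.preimage_basicOpen_top] at hi
    rw [← hbz v]
    exact hi
  · intro hz
    obtain ⟨i, hi⟩ := TopologicalSpace.Opens.mem_iSup.mp hz
    by_contra hcon
    have h1 : (e.chart j ≫ (π ⁻¹ᵁ U).ι) z ∈ Set.range φ.center := by
      have h2 : (e.chart j ≫ (π ⁻¹ᵁ U).ι) z ∉ (φ.dom : Set P) := hcon
      rwa [φ.coe_dom, Set.notMem_compl_iff] at h2
    obtain ⟨s, hs⟩ := h1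
    obtain ⟨c, hc, t, hc₁, hc₂, hc₃⟩ := hA.center
    have hsU : s ∈ U := by
      have h3 : π (φ.center s) = s := by
        rw [← Scheme.Hom.comp_apply, φ.center_π]; rfl
      rw [← h3, hs]
      exact (e.chart j z).2
    let s' : (U : Scheme.{u}) := ⟨s, hsU⟩
    have h4 : e.chart j z = t s' := by
      refine (π ⁻¹ᵁ U).ι.isOpenEmbedding.injective ?_
      rw [← Scheme.Hom.comp_apply, ← Scheme.Hom.comp_apply, hc₂, ← hs, Scheme.Hom.comp_apply]
      rfl
    -- A field-valued point of this fibre product lies both over `z` and on the centre. There the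
    -- chart coordinates are proportional to `c`, so `A` kills them, contradicting that the `i`-th
    -- image coordinate is nonzero at `z`.
    let Z := pullback (e.chart j) t
    obtain ⟨(w : Z), hw₁, hw₂⟩ := Scheme.Pullback.exists_preimage_pullback z _ h4
    let k := Z.fromSpecResidueField w
    let a := k ≫ pullback.fst (e.chart j) t
    let b := k ≫ pullback.snd (e.chart j) t
    have hab : a ≫ e.chart j = b ≫ t := by
      simp only [a, b, Category.assoc, pullback.condition]
    let v : Spec (Z.residueField w) := IsLocalRing.closedPoint _
    have hav : a v = z := by
      rw [Scheme.Hom.comp_apply, Z.fromSpecResidueField_apply, hw₁]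
    refine appTop_ne_zero_of_mem_basicOpen a _ v (hav.symm ▸ hi) ?_
    have htπ : t ≫ π ∣_ U = 𝟙 _ := by
      rw [← cancel_mono U.ι, Category.assoc, morphismRestrict_ι, reassoc_of% hc₂, φ.center_π,
        Category.comp_id, Category.id_comp]
    have h5 := congrArg (· ≫ e.coord) hab
    simp only [Category.assoc, e.chart_coord, hc₃, comp_homogPoint] at h5
    obtain ⟨h6, h7⟩ := mul_eq_mul_of_homogPoint_eq h5 (j := j)
      (by rw [relChartCoord_self, map_one]; exact isUnit_one)
    simp only [relChartCoord_self, map_one, mul_one] at h7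
    have h8 := congrFun (relChartImage_comp (A := A) (e := e) j a) i
    have h9 : coeffMap π U (a ≫ e.chart j) = b.appTop.hom := by
      rw [hab, coeffMap, Category.assoc, htπ, Category.comp_id]
    have h10 := congrFun (map_mulVec_map A (RingHom.id _) b.appTop.hom c) i
    have h11 : (A.map (RingHom.id _)) = A := by ext; rfl
    rw [h11, hc₁, RingHom.comp_id, Pi.zero_apply, map_zero] at h10
    rw [h9] at h8
    refine h6.mul_left_cancel ?_
    rw [mul_zero]
    refine Eq.trans ?_ h10.symm
    rw [h8, ← smul_eq_mul, ← Pi.smul_apply, ← Matrix.mulVec_smul]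
    congr 2
    funext l
    rw [Pi.smul_apply, smul_eq_mul, mul_comm, h7]

theorem isCompact_preimage_dom [IsAffine (U : Scheme.{u})] (hA : φ.IsGivenBy e A) (j : Fin 4) :
    IsCompact (((e.chart j ≫ (π ⁻¹ᵁ U).ι) ⁻¹ᵁ φ.dom : (RelChart 3 (U : Scheme.{u}) j).Opens) :
      Set (RelChart 3 (U : Scheme.{u}) j)) := by
  rw [hA.preimage_dom j, TopologicalSpace.Opens.coe_iSup]
  exact isCompact_iUnion fun i =>
    ((isAffineOpen_top (RelChart 3 (U : Scheme.{u}) j)).basicOpen _).isCompact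

theorem eval₂_comp_relChartImage (j : Fin 4) {T : Scheme.{u}}
    (b : T ⟶ RelChart 3 (U : Scheme.{u}) j) (q : MvPolynomial (Fin 3) Γ((U : Scheme.{u}), ⊤)) :
    b.appTop.hom (relChartEval (U : Scheme.{u}) j (coneForm A q)) =
      eval₂ (b ≫ pullback.fst _ _).appTop.hom (fun i => b.appTop.hom (relChartImage A j i)) q := by
  rw [relChartEval_coneForm, hom_eval₂, Scheme.Hom.comp_appTop, CommRingCat.hom_comp]

end CameraData.IsGivenBy

theorem mem_span_singleton_of_isLocalization {R S : Type*} [CommRing R] [CommRing S] [Algebra R S]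
    (y : R) [IsLocalization.Away y S] {f Q : R} (hy : ∀ z, Q ∣ y * z → Q ∣ z)
    (h : algebraMap R S f ∈ Ideal.span {algebraMap R S Q}) : f ∈ Ideal.span {Q} := by
  have h1 : Ideal.span {algebraMap R S Q} = (Ideal.span {Q}).map (algebraMap R S) := by
    rw [Ideal.map_span, Set.image_singleton]
  rw [h1, IsLocalization.algebraMap_mem_map_algebraMap_iff (Submonoid.powers y)] at h
  obtain ⟨_, ⟨N, rfl⟩, hN⟩ := h
  rw [Ideal.mem_span_singleton] at hN ⊢
  simp only at hN
  induction N with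
  | zero => simpa using hN
  | succ N ih =>
    refine ih (hy _ ?_)
    rwa [← mul_assoc, ← pow_succ']

/-- Row `i` of `A` is a linear form that is nonzero in every fibre because `A` is surjective there,
and it never divides the cone. Hence the image coordinates are nonzerodivisors modulo the cone
equation. -/
theorem IsSmoothQuadratic.dvd_of_dvd_relChartImage_mul {U : Scheme.{u}} [IsAffine U]
    {q : MvPolynomial (Fin 3) Γ(U, ⊤)} (hq : IsSmoothQuadratic q)
    {A : Matrix (Fin 3) (Fin 4) Γ(U, ⊤)} (hA : Function.Surjective fun v => A.mulVec v)
    (j : Fin 4) (i : Fin 3) {z : Γ(RelChart 3 U j, ⊤)}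
    (h : relChartEval U j (coneForm A q) ∣ relChartImage A j i * z) :
    relChartEval U j (coneForm A q) ∣ z := by
  rw [← relChartEval_linear] at h
  have hl : (∑ k, C (A i k) * X k : MvPolynomial (Fin 4) Γ(U, ⊤)).IsHomogeneous 1 :=
    IsHomogeneous.sum _ _ _ fun k _ => isHomogeneous_C_mul_X _ _
  refine relChart_dvd_of_dvd_mul j hl (isHomogeneous_coneForm hq.1) (fun f => ?_) h
  refine dvd_of_dvd_linear_mul_of_forall_not_dvd hl fun K _ f => ⟨fun h0 => ?_, ?_⟩
  · obtain ⟨v, hv⟩ := surjective_mulVec_map f hA (Pi.single i 1)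
    have h1 := congrArg (eval v) h0
    have h2 := congrFun hv i
    simp only [Matrix.mulVec, dotProduct, Matrix.map_apply, Pi.single_eq_same] at h2
    simp [h2] at h1
  · exact hq.not_dvd_coneForm hA f (hl.map f)

end Cones

/-! ### The closed cone is cut out by the pulled-back quadratic form -/

section ConesOfCameras

open MvPolynomial Scheme.IdealSheafData

theorem Cam.exists_isGivenBy {n : ℕ} (X : Cam.{u} n) (i : Fin n) (s : X.base) :
    ∃ U : X.base.Opens, s ∈ U ∧ IsAffineOpen U ∧ ∃ (e : Trivialization X.π U) (A : _),
      (X.camera i).IsGivenBy e A := by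
  obtain ⟨U, hU, hU', e, he⟩ := X.locally_linear s
  obtain ⟨A, hA⟩ := he i
  exact ⟨U, hU, hU', e, A, hA⟩

/-- On a chart the complement of the centre is a union of three basic opens. Quasi-compactness is
what makes the scheme-theoretic closure compatible with restriction to charts. -/
instance {n : ℕ} (X : Cam.{u} n) (i : Fin n) : QuasiCompact (X.camera i).dom.ι := by
  have H (p : X.P) : ∃ W : X.P.affineOpens, p ∈ (W : X.P.Opens) ∧
      IsCompact ((W : Set X.P) ∩ (X.camera i).dom) := by
    obtain ⟨U, hU, hU', e, A, hA⟩ := X.exists_isGivenBy i (X.π p)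
    have : IsAffine (U : Scheme.{u}) := hU'
    obtain ⟨j, z, hz⟩ := exists_mem_range_chart e hU
    refine ⟨affineRange (e.chart j ≫ (X.π ⁻¹ᵁ U).ι), ⟨z, trivial, hz⟩, ?_⟩
    have h1 := (hA.isCompact_preimage_dom j).image (e.chart j ≫ (X.π ⁻¹ᵁ U).ι).continuous
    convert h1 using 1
    ext p
    constructor
    · rintro ⟨⟨z, -, rfl⟩, hz⟩
      exact ⟨z, hz, rfl⟩
    · rintro ⟨z, hz, rfl⟩
      exact ⟨⟨z, trivial, rfl⟩, hz⟩
  choose W hW hc using H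
  refine (@HasAffineProperty.iff_of_iSup_eq_top @QuasiCompact _
    instHasAffinePropertyQuasiCompactCompactSpaceCarrierCarrierCommRingCat _ _ _ _ W
    (top_le_iff.mp fun p _ => TopologicalSpace.Opens.mem_iSup.mpr ⟨p, hW p⟩)).mpr fun p => ?_
  refine isCompact_iff_compactSpace.mp ?_
  rw [(X.camera i).dom.ι.isOpenEmbedding.isInducing.isCompact_iff]
  convert hc p using 1
  ext x
  constructor
  · rintro ⟨z, hz, rfl⟩
    exact ⟨hz, z.2⟩
  · rintro ⟨h1, h2⟩
    exact ⟨⟨x, h2⟩, h1, rfl⟩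

theorem isLocalization_basicOpen_ι {T : Scheme.{u}} [IsAffine T] (f : Γ(T, ⊤)) :
    @IsLocalization.Away _ _ f Γ((T.basicOpen f : Scheme.{u}), ⊤) _
      (T.basicOpen f).ι.appTop.hom.toAlgebra := by
  rw [Scheme.Opens.ι_appTop]
  exact (isAffineOpen_top T).isLocalization_of_eq_basicOpen f _ (T.basicOpen f).ι_image_top

/-- The closed cone over a smooth conic is cut out by the pull back of its equation. -/
theorem CameraData.IsGivenBy.isCutOutBy_cone {P S : Scheme.{u}} {π : P ⟶ S} {φ : CameraData π}
    [QuasiCompact φ.dom.ι] {D : (ProjOver 2 S).IdealSheafData} {U : S.Opens} (hU : IsAffineOpen U)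
    {e : Trivialization π U} {A : Matrix (Fin 3) (Fin 4) Γ((U : Scheme.{u}), ⊤)}
    (hA : φ.IsGivenBy e A) {q : MvPolynomial (Fin 3) Γ((U : Scheme.{u}), ⊤)}
    (hq : IsSmoothQuadratic q) (hD : IsPlaneCutOutBy D U q) :
    IsCutOutBy e ((D.comap (toProjOver (φ.dom.ι ≫ π) φ.map)).map φ.dom.ι) {coneForm A q} := by
  have hUaff : IsAffine (U : Scheme.{u}) := hU
  refine isCutOutBy_of_forall_comap_chart
    (fun p hp => ⟨2, by rw [Set.mem_singleton_iff.mp hp]; exact isHomogeneous_coneForm hq.1⟩)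
    fun j => ?_
  rw [Set.image_singleton]
  let T := RelChart 3 (U : Scheme.{u}) j
  let t : T ⟶ P := e.chart j ≫ (π ⁻¹ᵁ U).ι
  have hbase : t ≫ π = pullback.fst _ _ ≫ U.ι := by
    rw [← e.chart_π, Category.assoc, Category.assoc, morphismRestrict_ι]
  let Q := relChartEval (U : Scheme.{u}) j (coneForm A q)
  let E : T.Opens := t ⁻¹ᵁ φ.dom
  have hE : E = ⨆ k, T.basicOpen (relChartImage A j k) := hA.preimage_dom j
  have hle (k) : T.basicOpen (relChartImage A j k) ≤ E := by
    rw [hE]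
    exact le_iSup (fun k => T.basicOpen (relChartImage A j k)) k
  let v (k) := T.homOfLE (hle k)
  have hv (k) : v k ≫ E.ι = (T.basicOpen (relChartImage A j k)).ι := T.homOfLE_ι (hle k)
  have hVaff (k) : IsAffine (T.basicOpen (relChartImage A j k) : Scheme.{u}) :=
    (isAffineOpen_top T).basicOpen _
  have hcomap (k) (K : Ideal Γ(T, ⊤)) : ((ofIdealTop K).comap E.ι).comap (v k) =
      ofIdealTop (K.map (T.basicOpen (relChartImage A j k)).ι.appTop.hom) := by
    rw [← comap_comp, hv, comap_ofIdealTop]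
  set D' := D.comap (toProjOver (φ.dom.ι ≫ π) φ.map) with hD'
  -- The closure taken in `P` restricts to the closure taken inside the chart.
  have h1 : (D'.map φ.dom.ι).comap t = (D'.comap (t ∣_ φ.dom)).map E.ι :=
    comap_map_of_isPullback (isPullback_morphismRestrict t φ.dom).flip D'
  have h2 : D'.comap (t ∣_ φ.dom) = (ofIdealTop (Ideal.span {Q})).comap E.ι := by
    refine eq_of_forall_comap_eq fun p => ?_
    have hp : E.ι p ∈ ⨆ k, T.basicOpen (relChartImage A j k) := hE ▸ p.2
    obtain ⟨k, hk⟩ := TopologicalSpace.Opens.mem_iSup.mp hp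
    let p' : (T.basicOpen (relChartImage A j k) : Scheme.{u}) := ⟨E.ι p, hk⟩
    refine ⟨_, hVaff k, v k, inferInstance, ⟨p', ?_⟩, ?_⟩
    · refine E.ι.isOpenEmbedding.injective ?_
      rw [← Scheme.Hom.comp_apply, hv]
      rfl
    · rw [hcomap, hD', ← Scheme.IdealSheafData.comap_comp, ← Scheme.IdealSheafData.comap_comp, Ideal.map_span, Set.image_singleton]
      have hv' := hv k
      set b := (T.basicOpen (relChartImage A j k)).ι with hb
      have hvt : v k ≫ (t ∣_ φ.dom) ≫ φ.dom.ι = b ≫ t := by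
        rw [morphismRestrict_ι, ← hv', Category.assoc]
      obtain ⟨hy, h3⟩ := hA.map _ (b ≫ e.chart j) _
        ((unimodular_relChartCoord (U : Scheme.{u}) j).map b) (v k ≫ (t ∣_ φ.dom))
        (by rw [Category.assoc, e.chart_coord, comp_homogPoint])
        (by rw [Category.assoc, hvt, Category.assoc])
      have h4 : (v k ≫ (t ∣_ φ.dom)) ≫ toProjOver (φ.dom.ι ≫ π) φ.map =
          toProjOver ((b ≫ pullback.fst _ _) ≫ U.ι) (homogPoint _ hy) := by
        rw [comp_toProjOver, h3, Category.assoc, reassoc_of% hvt, hbase, Category.assoc]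
      have h5 : b.appTop.hom Q = _ := CameraData.IsGivenBy.eval₂_comp_relChartImage j b q
      rw [h4, hD, h5]
      simp only [← CameraData.IsGivenBy.relChartImage_comp]
  rw [h1, h2]
  refine le_antisymm ?_ (le_map_iff_comap_le.mpr le_rfl)
  rw [← ofIdealTop_ideal_top (((ofIdealTop (Ideal.span {Q})).comap E.ι).map E.ι),
    ofIdealTop_le_ofIdealTop]
  set K := (((ofIdealTop (Ideal.span {Q})).comap E.ι).map E.ι).ideal ⟨⊤, isAffineOpen_top T⟩
  have h3 : (ofIdealTop K).comap E.ι ≤ (ofIdealTop (Ideal.span {Q})).comap E.ι := by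
    rw [ofIdealTop_ideal_top]
    exact comap_map_le _ _
  -- One basic open of the domain suffices: a function in the closure ideal is a multiple of `Q`
  -- once the image coordinate `0` is inverted, and that coordinate is a nonzerodivisor modulo `Q`.
  have h4 := comap_mono (v 0) h3
  simp only [hcomap, ofIdealTop_le_ofIdealTop, Ideal.map_span, Set.image_singleton] at h4
  intro f hf
  let := (T.basicOpen (relChartImage A j 0)).ι.appTop.hom.toAlgebra
  have := isLocalization_basicOpen_ι (T := T) (relChartImage A j 0)
  exact mem_span_singleton_of_isLocalization _
    (fun z hz => hq.dvd_of_dvd_relChartImage_mul hA.surjective j 0 hz)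
    (h4 (Ideal.mem_map_of_mem _ hf))

theorem CamConics.isCutOutBy_cone {n : ℕ} (X : CamConics.{u} n) (i : Fin n)
    {U : X.toCam.base.Opens} (hU : IsAffineOpen U) {e : Trivialization X.toCam.π U}
    {A : Matrix (Fin 3) (Fin 4) Γ((U : Scheme.{u}), ⊤)} (hA : (X.toCam.camera i).IsGivenBy e A)
    {q : MvPolynomial (Fin 3) Γ((U : Scheme.{u}), ⊤)} (hq : IsSmoothQuadratic q)
    (hD : IsPlaneCutOutBy (X.conic i) U q) : IsCutOutBy e (X.cone i) {coneForm A q} :=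
  hA.isCutOutBy_cone hU hq hD

end ConesOfCameras

/-! ### Local models of calibrations and of their residual curves -/

section LocalModels

theorem isAffine_relChart (U : Scheme.{u}) [IsAffine U] (j : Fin 4) : IsAffine (RelChart 3 U j) :=
  inferInstance

open MvPolynomial Scheme.IdealSheafData

theorem Unimodular.comp_ne_zero {n : ℕ} {U : Scheme.{u}} {c : Fin n → Γ(U, ⊤)} (hc : Unimodular c)
    {K : Type*} [Field K] (f : Γ(U, ⊤) →+* K) : f ∘ c ≠ 0 := by
  intro h0
  have h1 : Ideal.span (Set.range c) ≤ RingHom.ker f := by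
    rw [Ideal.span_le]
    rintro _ ⟨i, rfl⟩
    exact congrFun h0 i
  rw [hc] at h1
  exact one_ne_zero ((map_one f).symm.trans (h1 (show (1 : Γ(U, ⊤)) ∈ ⊤ from trivial)))

theorem mulVec_comp_eq_zero {m n : ℕ} {R R' : Type*} [CommRing R] [CommRing R']
    {A : Matrix (Fin m) (Fin n) R} {c : Fin n → R} (h : A.mulVec c = 0) (f : R →+* R') :
    (A.map f).mulVec (f ∘ c) = 0 := by
  funext i
  rw [← RingHom.map_mulVec, h, Pi.zero_apply, Pi.zero_apply, map_zero]

theorem CameraData.section_π {P S : Scheme.{u}} {π : P ⟶ S} (φ : CameraData π) {U : S.Opens}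
    {t : (U : Scheme.{u}) ⟶ (π ⁻¹ᵁ U : Scheme.{u})} (ht : t ≫ (π ⁻¹ᵁ U).ι = U.ι ≫ φ.center) :
    t ≫ π ∣_ U = 𝟙 _ := by
  rw [← cancel_mono U.ι, Category.assoc, morphismRestrict_ι, reassoc_of% ht, φ.center_π,
    Category.comp_id, Category.id_comp]

/-- If the centres of two linear cameras are disjoint, then in no fibre the centre of the second
one lies in the kernel of the first one. -/
theorem CameraData.IsGivenBy.exists_forall_mulVec_ne_zero {P S : Scheme.{u}} {π : P ⟶ S}
    {φ₀ φ₁ : CameraData π} {U : S.Opens} (hU : IsAffineOpen U) {e : Trivialization π U}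
    {A₀ A₁ : Matrix (Fin 3) (Fin 4) Γ((U : Scheme.{u}), ⊤)} (h₀ : φ₀.IsGivenBy e A₀)
    (h₁ : φ₁.IsGivenBy e A₁) (hdisj : Disjoint (Set.range φ₀.center) (Set.range φ₁.center)) :
    ∃ c : Fin 4 → Γ((U : Scheme.{u}), ⊤), A₁.mulVec c = 0 ∧
      ∀ (K : Type u) [Field K] (f : Γ((U : Scheme.{u}), ⊤) →+* K),
        (A₀.map f).mulVec (f ∘ c) ≠ 0 := by
  have hUaff : IsAffine (U : Scheme.{u}) := hU
  obtain ⟨c₀, hc₀, t₀, hA₀, ht₀, hx₀⟩ := h₀.center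
  obtain ⟨c₁, hc₁, t₁, hA₁, ht₁, hx₁⟩ := h₁.center
  refine ⟨c₁, hA₁, fun K _ f hcon => ?_⟩
  -- The kernel of `A₀` over `K` is a line, so the two centres would have proportional coordinates
  -- there and would define the same `K`-point of `P`.
  obtain ⟨r, hr⟩ := exists_smul_eq_of_mulVec_eq_zero (surjective_mulVec_map f h₀.surjective)
    (hc₀.comp_ne_zero f) (mulVec_comp_eq_zero hA₀ f) hcon
  obtain ⟨j, hj⟩ := Function.ne_iff.mp (hc₁.comp_ne_zero f)
  have hj' : f (c₀ j) ≠ 0 := fun h => hj (by rw [← hr]; simp [h])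
  let γ := Scheme.ΓSpecIso (CommRingCat.of K)
  obtain ⟨a, ha⟩ := exists_appTop_eq (U := (U : Scheme.{u})) (γ.inv.hom.comp f)
  have h2 : a ≫ t₁ = a ≫ t₀ := by
    refine e.hom_ext ?_ ?_
    · rw [Category.assoc, Category.assoc, φ₀.section_π ht₀, φ₁.section_π ht₁]
    · rw [Category.assoc, Category.assoc, hx₀, hx₁, comp_homogPoint, comp_homogPoint]
      refine homogPoint_eq_of_isUnit _ _ (j := j) ?_ ?_ fun i => ?_
      · rw [ha]
        exact (isUnit_iff_ne_zero.mpr hj).map γ.inv.hom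
      · rw [ha]
        exact (isUnit_iff_ne_zero.mpr hj').map γ.inv.hom
      · rw [ha]
        have hi := congrFun hr i
        have hjj := congrFun hr j
        simp only [Pi.smul_apply, Function.comp_apply, smul_eq_mul] at hi hjj
        have hij : f (c₁ i) * f (c₀ j) = f (c₀ i) * f (c₁ j) := by
          rw [← hi, ← hjj]
          ring
        exact (map_mul γ.inv.hom _ _).symm.trans
          ((congrArg γ.inv.hom hij).trans (map_mul γ.inv.hom _ _))
  let p : Spec (CommRingCat.of K) := IsLocalRing.closedPoint K
  have h3 (φ : CameraData π) (t) (ht : t ≫ (π ⁻¹ᵁ U).ι = U.ι ≫ φ.center) :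
      (a ≫ t ≫ (π ⁻¹ᵁ U).ι) p ∈ Set.range φ.center := by
    rw [ht]
    exact ⟨(a ≫ U.ι) p, by rw [← Scheme.Hom.comp_apply, Category.assoc]⟩
  refine Set.disjoint_left.mp hdisj (h3 φ₀ t₀ ht₀) ?_
  rw [← Category.assoc, ← h2, Category.assoc]
  exact h3 φ₁ t₁ ht₁

theorem IsCutOutBy.congr {P S : Scheme.{u}} {π : P ⟶ S} {U : S.Opens} {e : Trivialization π U}
    {I : P.IdealSheafData} {s s' : Set (MvPolynomial (Fin 4) Γ((U : Scheme.{u}), ⊤))}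
    (h : IsCutOutBy e I s) (hs : Ideal.span s = Ideal.span s') : IsCutOutBy e I s' := by
  intro T _ t x hx htx
  rw [h T t x hx htx]
  have := congrArg (Ideal.map (eval₂Hom (coeffMap π U t) x)) hs
  rw [Ideal.map_span, Ideal.map_span] at this
  exact congrArg ofIdealTop this

theorem iSup_span_singleton_fin_two {B : Type*} [CommRing B] (f : Fin 2 → B) :
    ⨆ i, Ideal.span {f i} = Ideal.span {f 0, f 1} := by
  rw [← Ideal.span_iUnion]
  congr 1
  ext x
  simp [Fin.exists_fin_two, eq_comm]

/-- Coordinates in which the cameras, the plane conics, the curve with ideal sheaf `C` and its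
residual curve are given by equations. -/
structure IsLocalModel (X : CamConics.{u} 2) (C : X.toCam.P.IdealSheafData)
    {U : X.toCam.base.Opens} (e : Trivialization X.toCam.π U)
    (A : Fin 2 → Matrix (Fin 3) (Fin 4) Γ((U : Scheme.{u}), ⊤))
    (q : Fin 2 → MvPolynomial (Fin 3) Γ((U : Scheme.{u}), ⊤))
    (h h' : MvPolynomial (Fin 4) Γ((U : Scheme.{u}), ⊤)) : Prop where
  isAffineOpen : IsAffineOpen U
  isGivenBy : ∀ i, (X.toCam.camera i).IsGivenBy e (A i)
  smooth : ∀ i, IsSmoothQuadratic (q i)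
  conic : ∀ i, IsPlaneCutOutBy (X.conic i) U (q i)
  residualPair : IsResidualPair (fun i => coneForm (A i) (q i)) h h'
  curve : IsCutOutBy e C {h, coneForm (A 0) (q 0)}

namespace IsLocalModel

variable {X : CamConics.{u} 2} {C : X.toCam.P.IdealSheafData} {U : X.toCam.base.Opens}
  {e : Trivialization X.toCam.π U} {A : Fin 2 → Matrix (Fin 3) (Fin 4) Γ((U : Scheme.{u}), ⊤)}
  {q : Fin 2 → MvPolynomial (Fin 3) Γ((U : Scheme.{u}), ⊤)}
  {h h' : MvPolynomial (Fin 4) Γ((U : Scheme.{u}), ⊤)}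

theorem cone (M : IsLocalModel X C e A q h h') (i : Fin 2) :
    IsCutOutBy e (X.cone i) {coneForm (A i) (q i)} :=
  X.isCutOutBy_cone i M.isAffineOpen (M.isGivenBy i) (M.smooth i) (M.conic i)

theorem comap_coneInter (M : IsLocalModel X C e A q h h') (j : Fin 4) :
    X.coneInter.comap (e.chart j ≫ (X.toCam.π ⁻¹ᵁ U).ι) =
      ofIdealTop (Ideal.span {relChartEval (U : Scheme.{u}) j (coneForm (A 0) (q 0)),
        relChartEval (U : Scheme.{u}) j (coneForm (A 1) (q 1))}) := by
  have : IsAffine (U : Scheme.{u}) := M.isAffineOpen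
  rw [CamConics.coneInter, comap_iSup]
  have h1 (i) : (X.cone i).comap (e.chart j ≫ (X.toCam.π ⁻¹ᵁ U).ι) =
      ofIdealTop (Ideal.span {relChartEval (U : Scheme.{u}) j (coneForm (A i) (q i))}) := by
    rw [(M.cone i).comap_chart, Set.image_singleton]
  rw [iSup_congr h1, iSup_ofIdealTop, iSup_span_singleton_fin_two]

theorem comap_curve (M : IsLocalModel X C e A q h h') (j : Fin 4) :
    C.comap (e.chart j ≫ (X.toCam.π ⁻¹ᵁ U).ι) =
      ofIdealTop (Ideal.span {relChartEval (U : Scheme.{u}) j h,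
        relChartEval (U : Scheme.{u}) j (coneForm (A 0) (q 0))}) := by
  have : IsAffine (U : Scheme.{u}) := M.isAffineOpen
  rw [M.curve.comap_chart, Set.image_pair]

/-- The residual curve is cut out by the residual equations. -/
theorem residual (M : IsLocalModel X C e A q h h') (hC : ∀ V, (C.ideal V).FG) :
    IsLocalModel X (residualIdeal X.coneInter C) e A q h' h where
  __ := M
  residualPair := M.residualPair.symm
  curve := by
    have : IsAffine (U : Scheme.{u}) := M.isAffineOpen
    obtain ⟨a, b, ha, hb, hab⟩ := M.residualPair.mul_eq
    refine isCutOutBy_of_forall_comap_chart ?_ fun j => ?_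
    · rintro p (rfl | rfl)
      · exact ⟨1, M.residualPair.right.1⟩
      · exact ⟨2, M.residualPair.right.2.1⟩
    · rw [Set.image_pair]
      refine comap_residualIdeal _ hC (M.comap_coneInter j) (M.comap_curve j) ?_
      refine mem_span_pair_iff_mul_mem (a := relChartEval (U : Scheme.{u}) j (MvPolynomial.C a))
        (b := relChartEval (U : Scheme.{u}) j (MvPolynomial.C b))
        ((hb.map MvPolynomial.C).map (relChartEval (U : Scheme.{u}) j)) ?_ fun f hf => ?_
      · rw [← map_mul, ← map_mul, ← map_mul, ← map_sub, hab]
      · exact relChart_dvd_of_dvd_mul j M.residualPair.left.1 M.residualPair.left.2.1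
          (fun f hf => dvd_of_dvd_linear_mul_of_forall_not_dvd M.residualPair.left.1
            M.residualPair.left.2.2 hf) hf

/-- Since `b` is a unit, the relation between `h * h'` and the two cone forms puts the second cone
form into `(h, Q₀)`. -/
theorem cone_le (M : IsLocalModel X C e A q h h') (i : Fin 2) (j : Fin 4) :
    (X.cone i).comap (e.chart j ≫ (X.toCam.π ⁻¹ᵁ U).ι) ≤
      C.comap (e.chart j ≫ (X.toCam.π ⁻¹ᵁ U).ι) := by
  have : IsAffine (U : Scheme.{u}) := M.isAffineOpen
  obtain ⟨a, b, ha, hb, hab⟩ := M.residualPair.mul_eq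
  rw [(M.cone i).comap_chart, M.comap_curve, ofIdealTop_le_ofIdealTop, Set.image_singleton,
    Ideal.span_singleton_le_iff_mem]
  have h0 : coneForm (A 0) (q 0) ∈ Ideal.span {h, coneForm (A 0) (q 0)} :=
    Ideal.subset_span (Set.mem_insert_of_mem _ rfl)
  have h1 : coneForm (A i) (q i) ∈ Ideal.span {h, coneForm (A 0) (q 0)} := by
    fin_cases i
    · exact h0
    · refine (Ideal.unit_mul_mem_iff_mem _ (hb.map MvPolynomial.C)).mp ?_
      refine Ideal.mem_span_pair.mpr ⟨-h', MvPolynomial.C a, ?_⟩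
      simp only [Fin.mk_one]
      linear_combination -hab
  have h2 := Ideal.mem_map_of_mem (relChartEval (U : Scheme.{u}) j) h1
  rwa [Ideal.map_span, Set.image_pair] at h2

theorem fg_comap_curve (M : IsLocalModel X C e A q h h') (j : Fin 4) :
    ((C.comap (e.chart j ≫ (X.toCam.π ⁻¹ᵁ U).ι)).ideal
      ⟨⊤, @isAffineOpen_top _ (@isAffine_relChart _ M.isAffineOpen j)⟩).FG := by
  have : IsAffine (U : Scheme.{u}) := M.isAffineOpen
  rw [M.comap_curve, ideal_top_ofIdealTop]
  exact Submodule.fg_span (Set.toFinite _)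

theorem baseChange {Y : CamConics.{u} 2} {D : Y.toCam.P.IdealSheafData}
    {V : Y.toCam.base.Opens} {e : Trivialization Y.toCam.π V}
    {A : Fin 2 → Matrix (Fin 3) (Fin 4) Γ((V : Scheme.{u}), ⊤)}
    {q : Fin 2 → MvPolynomial (Fin 3) Γ((V : Scheme.{u}), ⊤)}
    {h h' : MvPolynomial (Fin 4) Γ((V : Scheme.{u}), ⊤)} (M : IsLocalModel Y D e A q h h')
    (f : X ⟶ Y) (hU : IsAffineOpen U) (hle : U ≤ f.toCam.base ⁻¹ᵁ V) :
    IsLocalModel X (D.comap f.toCam.hom) (e.baseChange f.toCam.isPullback hle)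
      (fun i => (A i).map (f.toCam.base.resLE V U hle).appTop.hom)
      (fun i => MvPolynomial.map (f.toCam.base.resLE V U hle).appTop.hom (q i))
      (MvPolynomial.map (f.toCam.base.resLE V U hle).appTop.hom h)
      (MvPolynomial.map (f.toCam.base.resLE V U hle).appTop.hom h') where
  isAffineOpen := hU
  isGivenBy i := (M.isGivenBy i).baseChange f.toCam.isPullback (f.toCam.center i) (f.toCam.map i) hle
  smooth i := (M.smooth i).map _
  conic i := by
    rw [f.conic i]
    exact (M.conic i).baseChange f.toCam.base hle
  residualPair := by
    simp only [← map_coneForm]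
    exact M.residualPair.map _
  curve := by
    have := M.curve.baseChange f.toCam.isPullback hle
    rwa [Set.image_pair, map_coneForm] at this

end IsLocalModel

/-- The curve `C` has a local model at every point of the base. -/
def HasLocalModels (X : CamConics.{u} 2) (C : X.toCam.P.IdealSheafData) : Prop :=
  ∀ s : X.toCam.base, ∃ U : X.toCam.base.Opens, s ∈ U ∧
    ∃ (e : Trivialization X.toCam.π U) (A : _) (q : _) (h h' : _), IsLocalModel X C e A q h h'

namespace HasLocalModels

variable {X : CamConics.{u} 2} {C : X.toCam.P.IdealSheafData}

theorem fg (H : HasLocalModels X C) (V) : (C.ideal V).FG := by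
  refine fg_ideal_of_forall_fg_comap (fun p => ?_) V
  obtain ⟨U, hU, e, A, q, h, h', M⟩ := H (X.toCam.π p)
  have : IsAffine (U : Scheme.{u}) := M.isAffineOpen
  obtain ⟨j, hj⟩ := exists_mem_range_chart e hU
  exact ⟨_, inferInstance, e.chart j ≫ (X.toCam.π ⁻¹ᵁ U).ι, inferInstance, hj, M.fg_comap_curve j⟩

theorem isCalibration (H : HasLocalModels X C) : X.IsCalibration C where
  degree_two s := by
    obtain ⟨U, hU, e, A, q, h, h', M⟩ := H s
    exact ⟨U, hU, M.isAffineOpen, e, fun i => ⟨_, M.isGivenBy i⟩, h, _, M.residualPair.left, M.curve⟩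
  subset_cone i := by
    refine le_of_forall_comap_chart_le (π := X.toCam.π) fun s => ?_
    obtain ⟨U, hU, e, A, q, h, h', M⟩ := H s
    exact ⟨U, hU, M.isAffineOpen, e, M.cone_le i⟩

theorem residual (H : HasLocalModels X C) : HasLocalModels X (residualIdeal X.coneInter C) := by
  intro s
  obtain ⟨U, hU, e, A, q, h, h', M⟩ := H s
  exact ⟨U, hU, e, A, q, h', h, M.residual H.fg⟩

/-- Passing to the residual curve exchanges `h` and `h'`, so doing it twice restores the equations
of `C`. -/
theorem residual_residual (H : HasLocalModels X C) :
    residualIdeal X.coneInter (residualIdeal X.coneInter C) = C := by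
  refine eq_of_forall_isCutOutBy (π := X.toCam.π) fun s => ?_
  obtain ⟨U, hU, e, A, q, h, h', M⟩ := H s
  exact ⟨U, hU, M.isAffineOpen, e, _, ((M.residual H.fg).residual H.residual.fg).curve, M.curve⟩

/-- Ideal quotients need not commute with base change; here both sides are cut out by the pullbacks
of `h'` and `Q₀`. -/
theorem residual_comap {Y : CamConics.{u} 2} {D : Y.toCam.P.IdealSheafData}
    (H : HasLocalModels Y D) (HX : HasLocalModels X C) (f : X ⟶ Y) (hf : C = D.comap f.toCam.hom) :
    residualIdeal X.coneInter C = (residualIdeal Y.coneInter D).comap f.toCam.hom := by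
  refine eq_of_forall_isCutOutBy (π := X.toCam.π) fun s => ?_
  obtain ⟨V, hV, e, A, q, h, h', M⟩ := H (f.toCam.base s)
  obtain ⟨U, hU, hsU, hle⟩ := exists_isAffineOpen_mem_and_subset
    (U := f.toCam.base ⁻¹ᵁ V) (x := s) hV
  have M' := M.baseChange f hU hle
  have M'' := (M.residual H.fg).baseChange f hU hle
  rw [← hf] at M'
  exact ⟨U, hsU, hU, _, _, (M'.residual HX.fg).curve, M''.curve⟩

end HasLocalModels

/-- On the charts the inclusions of `C` in the cones give membership in `(h, p)` up to powers of the
variables; saturation removes the powers, and disjointness of the centres supplies the vertex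
condition. -/
theorem exists_isLocalModel {X : CamConics.{u} 2} {C : X.toCam.P.IdealSheafData}
    {U : X.toCam.base.Opens} (hU : IsAffineOpen U) {e : Trivialization X.toCam.π U}
    {A : Fin 2 → Matrix (Fin 3) (Fin 4) Γ((U : Scheme.{u}), ⊤)}
    (hA : ∀ i, (X.toCam.camera i).IsGivenBy e (A i))
    {q : Fin 2 → MvPolynomial (Fin 3) Γ((U : Scheme.{u}), ⊤)} (hq : ∀ i, IsSmoothQuadratic (q i))
    (hD : ∀ i, IsPlaneCutOutBy (X.conic i) U (q i))
    {h p : MvPolynomial (Fin 4) Γ((U : Scheme.{u}), ⊤)} (hp : IsConicEquations h p)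
    (hC : IsCutOutBy e C {h, p}) (hle : ∀ i, X.cone i ≤ C) :
    ∃ h', IsLocalModel X C e A q h h' := by
  have : IsAffine (U : Scheme.{u}) := hU
  have hs : ∀ f ∈ ({h, p} : Set _), ∃ m, MvPolynomial.IsHomogeneous f m := by
    rintro f (rfl | rfl)
    exacts [⟨1, hp.1⟩, ⟨2, hp.2.1⟩]
  have hmem (i) : coneForm (A i) (q i) ∈ Ideal.span {h, p} := by
    refine hp.mem_of_pow_mul_mem fun j => ?_
    refine exists_pow_mul_mem_span_of_relChartEval_mem j hs (isHomogeneous_coneForm (hq i).1) ?_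
    have h1 := comap_mono (e.chart j ≫ (X.toCam.π ⁻¹ᵁ U).ι) (hle i)
    simp only [(X.isCutOutBy_cone i hU (hA i) (hq i) (hD i)).comap_chart, hC.comap_chart,
      ofIdealTop_le_ofIdealTop, Set.image_singleton, Ideal.span_singleton_le_iff_mem] at h1
    exact h1
  obtain ⟨c, hc, hc'⟩ := (hA 0).exists_forall_mulVec_ne_zero hU (hA 1)
    (X.toCam.general 0 1 (by decide))
  obtain ⟨hspan, h', hr⟩ := exists_isResidualPair (fun i => (hA i).surjective) hq hp hmem hc hc'
  exact ⟨h', hU, hA, hq, hD, hr, hC.congr hspan⟩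

theorem CamConics.IsCalibration.hasLocalModels {X : CamConics.{u} 2} {C : X.toCam.P.IdealSheafData}
    (H : X.IsCalibration C) : HasLocalModels X C := by
  intro s
  obtain ⟨U, hU, hUaff, e, he, h, p, hp, hCut⟩ := H.degree_two s
  choose A hA using he
  choose V hV hVaff q hq hD using fun i => X.smooth i s
  obtain ⟨W, hW, hsW, hle⟩ := exists_isAffineOpen_mem_and_subset
    (U := U ⊓ (V 0 ⊓ V 1)) (x := s) ⟨hU, hV 0, hV 1⟩
  -- Coordinates for the curve and equations for the two conics live over different opens;
  -- restriction to the common open `W` is base change along the identity.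
  have hpb : IsPullback (𝟙 X.toCam.P) X.toCam.π X.toCam.π (𝟙 X.toCam.base) :=
    IsPullback.of_horiz_isIso ⟨by simp⟩
  have hWU : W ≤ (𝟙 X.toCam.base : _ ⟶ _) ⁻¹ᵁ U := fun x hx => (hle hx).1
  have hWV (i) : W ≤ (𝟙 X.toCam.base : _ ⟶ _) ⁻¹ᵁ V i := fun x hx => by
    fin_cases i
    exacts [(hle hx).2.1, (hle hx).2.2]
  have hA' (i) := (hA i).baseChange (φ := X.toCam.camera i) hpb (by simp) ⟨𝟙 _, by simp, by simp⟩ hWU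
  have hD' (i) : IsPlaneCutOutBy (X.conic i) W
      (MvPolynomial.map ((𝟙 X.toCam.base : _ ⟶ _).resLE (V i) W (hWV i)).appTop.hom (q i)) := by
    have := IsPlaneCutOutBy.baseChange (hD i) (𝟙 X.toCam.base) (hWV i)
    rwa [projOverMap_id, Scheme.IdealSheafData.comap_id] at this
  have hCut' := hCut.baseChange hpb hWU
  rw [Scheme.IdealSheafData.comap_id, Set.image_pair] at hCut'
  obtain ⟨h', M⟩ := exists_isLocalModel hW hA' (fun i => (hq i).map _) hD' (hp.map _) hCut'
    H.subset_cone
  exact ⟨W, hsW, _, _, _, _, h', M⟩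

end LocalModels

section Rigidity

open MvPolynomial

theorem relChartEval_ne_zero {n : ℕ} {U : Scheme.{u}} [IsAffine U] [IsDomain Γ(U, ⊤)]
    (j : Fin (n + 1)) {p : MvPolynomial (Fin (n + 1)) Γ(U, ⊤)} {m : ℕ} (hp : p.IsHomogeneous m)
    (h0 : p ≠ 0) : relChartEval U j p ≠ 0 := by
  obtain ⟨σ, -, -, -, hσ⟩ := exists_relChart_retraction U j
  intro h
  have h1 := hσ p m hp
  rw [h, map_zero, mul_zero] at h1
  refine h0 (IsLocalization.injective (Localization.Away (X j : MvPolynomial (Fin (n + 1)) Γ(U, ⊤)))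
    (powers_le_nonZeroDivisors_of_noZeroDivisors (X_ne_zero j)) ?_)
  rw [h1, map_zero]

/-- The generic point of an integral scheme. -/
theorem exists_dominant_point (T : Scheme.{u}) [IsIntegral T] :
    ∃ (K : Type u) (_ : Field K) (η : Spec (CommRingCat.of K) ⟶ T), IsDominant η ∧
      ∀ f : Γ(T, ⊤), f ≠ 0 → η.appTop.hom f ≠ 0 := by
  let ξ := genericPoint T
  let η : Spec (CommRingCat.of (T.residueField ξ)) ⟶ T := T.fromSpecResidueField ξ
  refine ⟨T.residueField ξ, inferInstance, η, ⟨?_⟩, fun f hf => ?_⟩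
  · have h1 : Set.range η = {ξ} := T.range_fromSpecResidueField ξ
    rw [DenseRange, h1, dense_iff_closure_eq]
    exact genericPoint_spec T
  · let v : Spec (CommRingCat.of (T.residueField ξ)) := IsLocalRing.closedPoint _
    refine appTop_ne_zero_of_mem_basicOpen η f v ?_
    have h1 : η v = ξ := T.fromSpecResidueField_apply ξ v
    rw [h1]
    refine ((genericPoint_spec T).mem_open_set_iff (T.basicOpen f).isOpen).mpr ?_
    rw [Set.univ_inter]
    refine Set.nonempty_iff_ne_empty.mpr fun h => ?_
    exact hf ((basicOpen_eq_bot_iff f).mp (TopologicalSpace.Opens.ext h))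

section

variable {n : ℕ} {K : Type u} [Field K]

/-- The values of global functions on the spectrum of a field. -/
def specValue (K : Type u) [Field K] : Γ(Spec (CommRingCat.of K), ⊤) ≃+* K :=
  (Scheme.ΓSpecIso (CommRingCat.of K)).commRingCatIsoToRingEquiv

theorem isUnit_of_specValue_ne_zero {f : Γ(Spec (CommRingCat.of K), ⊤)} (h : specValue K f ≠ 0) :
    IsUnit f := by
  have := (isUnit_iff_ne_zero.mpr h).map (specValue K).symm
  rwa [RingEquiv.symm_apply_apply] at this

theorem exists_specValue_ne_zero {x : Fin n → Γ(Spec (CommRingCat.of K), ⊤)} (hx : Unimodular x) :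
    ∃ j, specValue K (x j) ≠ 0 := by
  by_contra! h
  exact hx.comp_ne_zero (specValue K).toRingHom (funext h)

theorem exists_smul_eq_of_homogPoint_eq {x y : Fin (n + 1) → Γ(Spec (CommRingCat.of K), ⊤)}
    {hx : Unimodular x} {hy : Unimodular y} (h : homogPoint x hx = homogPoint y hy) :
    ∃ r : K, specValue K ∘ y = r • (specValue K ∘ x) := by
  obtain ⟨j, hj⟩ := exists_specValue_ne_zero hx
  obtain ⟨-, h1⟩ := mul_eq_mul_of_homogPoint_eq h (isUnit_of_specValue_ne_zero hj)
  refine ⟨specValue K (y j) / specValue K (x j), funext fun i => ?_⟩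
  have h2 := congrArg (specValue K) (h1 i)
  rw [map_mul, map_mul] at h2
  simp only [Function.comp_apply, Pi.smul_apply, smul_eq_mul]
  field_simp
  linear_combination -h2

theorem homogPoint_eq_of_smul_eq {x y : Fin (n + 1) → Γ(Spec (CommRingCat.of K), ⊤)}
    (hx : Unimodular x) (hy : Unimodular y) {r : K}
    (h : specValue K ∘ y = r • (specValue K ∘ x)) : homogPoint x hx = homogPoint y hy := by
  obtain ⟨j, hj⟩ := exists_specValue_ne_zero hy
  have h1 (i) : specValue K (y i) = r * specValue K (x i) := congrFun h i
  have hj' : specValue K (x j) ≠ 0 := fun h0 => hj (by rw [h1, h0, mul_zero])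
  refine homogPoint_eq_of_isUnit hx hy (isUnit_of_specValue_ne_zero hj')
    (isUnit_of_specValue_ne_zero hj) fun i => (specValue K).injective ?_
  rw [map_mul, map_mul, h1, h1]
  ring

end

/-- A point outside the line joining the centres of two cameras is determined by its images. -/
theorem eq_smul_of_mulVec_eq_smul {K : Type*} [Field K] {A₀ A₁ : Matrix (Fin 3) (Fin 4) K}
    (h₀ : Function.Surjective fun v => A₀.mulVec v) (h₁ : Function.Surjective fun v => A₁.mulVec v)
    {c₀ c₁ x y : Fin 4 → K} (hc₀ : c₀ ≠ 0) (hA₀ : A₀.mulVec c₀ = 0) (hA₁ : A₁.mulVec c₁ = 0)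
    (hA : A₀.mulVec c₁ ≠ 0) (l : (Fin 4 → K) →ₗ[K] K) (hl₀ : l c₀ = 0) (hl₁ : l c₁ = 0)
    (hx : l x ≠ 0) {r₀ r₁ : K} (hr₀ : A₀.mulVec y = r₀ • A₀.mulVec x)
    (hr₁ : A₁.mulVec y = r₁ • A₁.mulVec x) : y = r₀ • x := by
  have hc₁ : c₁ ≠ 0 := fun h => hA (by rw [h, Matrix.mulVec_zero])
  obtain ⟨s₀, hs₀⟩ := exists_smul_eq_of_mulVec_eq_zero h₀ hc₀ hA₀ (v := y - r₀ • x)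
    (by rw [Matrix.mulVec_sub, Matrix.mulVec_smul, hr₀, sub_self])
  obtain ⟨s₁, hs₁⟩ := exists_smul_eq_of_mulVec_eq_zero h₁ hc₁ hA₁ (v := y - r₁ • x)
    (by rw [Matrix.mulVec_sub, Matrix.mulVec_smul, hr₁, sub_self])
  -- `l` kills both centres but not `x`, so it forces the two scale factors to agree. Then `y - r₀
  -- x` lies in both kernels, which meet only in zero.
  have hr : r₀ = r₁ := by
    have h2 := congrArg l hs₀
    have h3 := congrArg l hs₁
    simp only [map_smul, map_sub, hl₀, hl₁, smul_eq_mul, mul_zero] at h2 h3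
    have h4 : (r₀ - r₁) * l x = 0 := by linear_combination h2 - h3
    exact sub_eq_zero.mp ((mul_eq_zero.mp h4).resolve_right hx)
  have h5 : s₁ • A₀.mulVec c₁ = 0 := by
    rw [← Matrix.mulVec_smul, hs₁, ← hr, ← hs₀, Matrix.mulVec_smul, hA₀, smul_zero]
  have h6 : s₁ = 0 := (smul_eq_zero.mp h5).resolve_right hA
  rw [h6, zero_smul] at hs₁
  rw [hr]
  exact (sub_eq_zero.mp hs₁.symm)

/-- The linear form whose zero locus is the plane spanned by the centre of `A`, a point `c` and the
preimage of a line through the image of `c`. -/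
def joinForm {R : Type*} [CommRing R] (A : Matrix (Fin 3) (Fin 4) R) (c : Fin 4 → R)
    (a b : Fin 3) : MvPolynomial (Fin 4) R :=
  C (A.mulVec c b) * ∑ k, C (A a k) * X k - C (A.mulVec c a) * ∑ k, C (A b k) * X k

theorem isHomogeneous_joinForm {R : Type*} [CommRing R] (A : Matrix (Fin 3) (Fin 4) R)
    (c : Fin 4 → R) (a b : Fin 3) : (joinForm A c a b).IsHomogeneous 1 :=
  have h (i) : (∑ k, C (A i k) * X k : MvPolynomial (Fin 4) R).IsHomogeneous 1 :=
    IsHomogeneous.sum _ _ _ fun _ _ => isHomogeneous_C_mul_X _ _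
  ((h a).C_mul _).sub ((h b).C_mul _)

theorem eval₂_joinForm {R R' : Type*} [CommRing R] [CommRing R'] (f : R →+* R')
    (A : Matrix (Fin 3) (Fin 4) R) (c : Fin 4 → R) (a b : Fin 3) (x : Fin 4 → R') :
    eval₂ f x (joinForm A c a b) = f (A.mulVec c b) * (A.map f).mulVec x a -
      f (A.mulVec c a) * (A.map f).mulVec x b := by
  simp [joinForm, eval₂_sub, eval₂_mul, eval₂_sum, Matrix.mulVec, dotProduct]

theorem joinForm_ne_zero {R : Type*} [CommRing R] {A : Matrix (Fin 3) (Fin 4) R}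
    (hA : Function.Surjective fun v => A.mulVec v) {c : Fin 4 → R} {a b : Fin 3} (hab : a ≠ b)
    (h : A.mulVec c a ≠ 0) : joinForm A c a b ≠ 0 := by
  obtain ⟨v, hv⟩ := hA (Pi.single b 1)
  intro h0
  have h1 := eval₂_joinForm (RingHom.id R) A c a b v
  have h2 : A.map (RingHom.id R) = A := by ext; rfl
  simp only at hv
  rw [h0, h2, hv, Pi.single_eq_of_ne hab, Pi.single_eq_same] at h1
  exact h (by simpa using h1)

/-- An endomorphism of `P` over the base that is compatible with two cameras with disjoint centres
is the identity. -/
theorem chart_comp_eq {P S : Scheme.{u}} {π : P ⟶ S} {φ : Fin 2 → CameraData π} {U : S.Opens}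
    (hU : IsAffineOpen U) [IsDomain Γ((U : Scheme.{u}), ⊤)] {e : Trivialization π U}
    {A : Fin 2 → Matrix (Fin 3) (Fin 4) Γ((U : Scheme.{u}), ⊤)} (hA : ∀ i, (φ i).IsGivenBy e (A i))
    (hdisj : Disjoint (Set.range (φ 0).center) (Set.range (φ 1).center)) (g : P ⟶ P)
    (hg : g ≫ π = π) (hm : ∀ i, ∃ r : ((φ i).dom : Scheme.{u}) ⟶ ((φ i).dom : Scheme.{u}),
      r ≫ (φ i).dom.ι = (φ i).dom.ι ≫ g ∧ r ≫ (φ i).map = (φ i).map) (j : Fin 4) :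
    (e.chart j ≫ (π ⁻¹ᵁ U).ι) ≫ g = e.chart j ≫ (π ⁻¹ᵁ U).ι := by
  have hUaff : IsAffine (U : Scheme.{u}) := hU
  let R := Γ((U : Scheme.{u}), ⊤)
  let T := RelChart 3 (U : Scheme.{u}) j
  have hTdom : IsDomain Γ(T, ⊤) := isDomain_relChart _ j
  have : Nonempty T := ⟨T.isoSpec.inv (Classical.arbitrary (PrimeSpectrum Γ(T, ⊤)))⟩
  have hT : IsIntegral T := isIntegral_of_isAffine_of_isDomain T
  let t : T ⟶ P := e.chart j ≫ (π ⁻¹ᵁ U).ι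
  obtain ⟨K, _, η, hη, hη'⟩ := exists_dominant_point T
  have hr : Set.range (t ≫ g) ⊆ Set.range (π ⁻¹ᵁ U).ι := by
    rintro _ ⟨z, rfl⟩
    rw [Scheme.Opens.range_ι]
    have h1 : π ((t ≫ g) z) = π (t z) := by
      rw [← Scheme.Hom.comp_apply, Category.assoc, hg, Scheme.Hom.comp_apply]
    have h2 : π (t z) ∈ U := (e.chart j z).2
    change π ((t ≫ g) z) ∈ U
    rwa [h1]
  let t' : T ⟶ (π ⁻¹ᵁ U : Scheme.{u}) := IsOpenImmersion.lift (π ⁻¹ᵁ U).ι (t ≫ g) hr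
  have ht' : t' ≫ (π ⁻¹ᵁ U).ι = t ≫ g := IsOpenImmersion.lift_fac _ _ _
  have ht'π : t' ≫ π ∣_ U = e.chart j ≫ π ∣_ U := by
    rw [← cancel_mono U.ι, Category.assoc, Category.assoc, morphismRestrict_ι, reassoc_of% ht', hg]
    simp [t]
  suffices h : t' = e.chart j by
    change t ≫ g = _
    rw [← ht', h]
  -- The chart is integral and projective space is separated, so it suffices to compare the two maps
  -- at the generic point.
  refine e.hom_ext ht'π (ext_of_isDominant η ?_)
  let x (i) := η.appTop.hom (relChartCoord (U : Scheme.{u}) j i)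
  have hx : Unimodular x := (unimodular_relChartCoord (U : Scheme.{u}) j).map η
  have hxη : (η ≫ e.chart j) ≫ e.coord = homogPoint x hx := by
    rw [Category.assoc, e.chart_coord, comp_homogPoint]
  obtain ⟨y, hy, hyη⟩ := exists_eq_homogPoint ((η ≫ t') ≫ e.coord)
  have hcoeff : coeffMap π U (η ≫ t') = coeffMap π U (η ≫ e.chart j) := by
    rw [coeffMap, coeffMap, Category.assoc, Category.assoc, ht'π]
  let f : R →+* K := (specValue K).toRingHom.comp (coeffMap π U (η ≫ e.chart j))
  have hval (B : Matrix (Fin 3) (Fin 4) R) (z : Fin 4 → Γ(Spec (CommRingCat.of K), ⊤)) :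
      specValue K ∘ (B.map (coeffMap π U (η ≫ e.chart j))).mulVec z =
        (B.map f).mulVec (specValue K ∘ z) :=
    map_mulVec_map B (coeffMap π U (η ≫ e.chart j)) (specValue K).toRingHom z
  have hev (p : MvPolynomial (Fin 4) R) : eval₂ f (specValue K ∘ x) p =
      specValue K (η.appTop.hom (relChartEval (U : Scheme.{u}) j p)) := by
    have h1 : f = ((specValue K).toRingHom.comp η.appTop.hom).comp
        (pullback.fst (terminal.from (U : Scheme.{u})) _).appTop.hom := by
      simp only [f]
      rw [coeffMap_comp, e.coeffMap_chart, RingHom.comp_assoc]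
    rw [h1]
    exact (hom_eval₂ _ _ _ _).symm
  -- The image coordinate `0` is a nonzero function on the chart, so the camera is defined at the
  -- generic point; compatibility of `g` with the camera makes the images of `x` and `y`
  -- proportional.
  have key (i) : ∃ r : K, ((A i).map f).mulVec (specValue K ∘ y) =
      r • ((A i).map f).mulVec (specValue K ∘ x) := by
    have h0 : relChartImage (A i) j 0 ≠ 0 := by
      rw [← relChartEval_linear]
      refine relChartEval_ne_zero j
        (IsHomogeneous.sum _ _ _ fun _ _ => isHomogeneous_C_mul_X _ _) fun h => ?_
      obtain ⟨v, hv⟩ := (hA i).surjective (Pi.single 0 1)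
      have h1 := congrArg (eval v) h
      have h2 := congrFun hv 0
      simp only [Matrix.mulVec, dotProduct, Pi.single_eq_same] at h2
      simp [h2] at h1
    have hu : IsUnit (η.appTop.hom (relChartImage (A i) j 0)) :=
      isUnit_of_specValue_ne_zero ((specValue K).map_ne_zero_iff.mpr (hη' _ h0))
    have hdom : Set.range (η ≫ t) ⊆ Set.range (φ i).dom.ι := by
      rintro _ ⟨v, rfl⟩
      rw [Scheme.Opens.range_ι]
      have h3 : η v ∈ t ⁻¹ᵁ (φ i).dom := by
        rw [(hA i).preimage_dom j]
        refine TopologicalSpace.Opens.mem_iSup.mpr ⟨0, ?_⟩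
        have h6 : v ∈ η ⁻¹ᵁ T.basicOpen (relChartImage (A i) j 0) := by
          rw [Scheme.preimage_basicOpen_top, Scheme.basicOpen_of_isUnit _ hu]
          trivial
        exact h6
      exact h3
    let d := IsOpenImmersion.lift (φ i).dom.ι (η ≫ t) hdom
    have hd : d ≫ (φ i).dom.ι = η ≫ t := IsOpenImmersion.lift_fac _ _ _
    obtain ⟨r, hr₁, hr₂⟩ := hm i
    obtain ⟨hAx, h4⟩ := (hA i).map _ (η ≫ e.chart j) x hx d hxη (by rw [hd, Category.assoc])
    obtain ⟨hAy, h5⟩ := (hA i).map _ (η ≫ t') y hy (d ≫ r) hyη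
      (by rw [Category.assoc, Category.assoc, ht', hr₁, reassoc_of% hd])
    rw [Category.assoc, hr₂, h4] at h5
    obtain ⟨s, hs⟩ := exists_smul_eq_of_homogPoint_eq h5
    rw [hcoeff, hval, hval] at hs
    exact ⟨s, hs⟩
  obtain ⟨r₀, hr₀⟩ := key 0
  obtain ⟨r₁, hr₁⟩ := key 1
  obtain ⟨c₁, hc₁, hA₁⟩ := (hA 0).exists_forall_mulVec_ne_zero hU (hA 1) hdisj
  obtain ⟨c₀, hc₀, hA₀⟩ := (hA 1).exists_forall_mulVec_ne_zero hU (hA 0) hdisj.symm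
  obtain ⟨a, ha⟩ := Function.ne_iff.mp (hA₁ K f)
  have ha' : f ((A 0).mulVec c₁ a) ≠ 0 := by
    rwa [RingHom.map_mulVec]
  have hne : ∀ a : Fin 3, ∃ b, a ≠ b := by decide
  obtain ⟨b, hab⟩ := hne a
  let p := joinForm (A 0) c₁ a b
  -- A plane through both centres. Its equation is a nonzero polynomial, hence nonzero at the
  -- generic point, which therefore lies off the line joining the centres.
  let l : (Fin 4 → K) →ₗ[K] K := f ((A 0).mulVec c₁ b) • LinearMap.proj a ∘ₗ ((A 0).map f).mulVecLin -
    f ((A 0).mulVec c₁ a) • LinearMap.proj b ∘ₗ ((A 0).map f).mulVecLin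
  have hl (v) : l v = f ((A 0).mulVec c₁ b) * ((A 0).map f).mulVec v a -
      f ((A 0).mulVec c₁ a) * ((A 0).map f).mulVec v b := rfl
  have hyx : specValue K ∘ y = r₀ • (specValue K ∘ x) := by
    refine eq_smul_of_mulVec_eq_smul (surjective_mulVec_map f (hA 0).surjective)
      (surjective_mulVec_map f (hA 1).surjective) (c₀ := f ∘ c₀) (c₁ := f ∘ c₁) ?_
      (mulVec_comp_eq_zero hc₀ f) (mulVec_comp_eq_zero hc₁ f) (hA₁ K f) l ?_ ?_ ?_ hr₀ hr₁
    · intro h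
      exact hA₀ K f (by rw [h, Matrix.mulVec_zero])
    · rw [hl, mulVec_comp_eq_zero hc₀ f]
      simp
    · rw [hl, RingHom.map_mulVec, RingHom.map_mulVec]
      ring
    · rw [hl, ← eval₂_joinForm, hev]
      refine (specValue K).map_ne_zero_iff.mpr (hη' _ ?_)
      refine relChartEval_ne_zero j (isHomogeneous_joinForm _ _ _ _)
        (joinForm_ne_zero (hA 0).surjective hab fun h => ha' (by rw [h, map_zero]))
  rw [← Category.assoc, ← Category.assoc, hyη, hxη]
  exact (homogPoint_eq_of_smul_eq hx hy hyx).symm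

end Rigidity

/-! ### The involution and the absence of fixed points -/

section Involution

open MvPolynomial Scheme.IdealSheafData

/-- If two is nonzero on an integral base, then the residual curve is different from the curve: otherwise the two
cones would be tangent along a plane section, and would have a common vertex. -/
theorem IsLocalModel.exists_comap_residualIdeal_ne {X : CamConics.{u} 2}
    {D : X.toCam.P.IdealSheafData} {U : X.toCam.base.Opens} {e : Trivialization X.toCam.π U}
    {A : Fin 2 → Matrix (Fin 3) (Fin 4) Γ((U : Scheme.{u}), ⊤)}
    {q : Fin 2 → MvPolynomial (Fin 3) Γ((U : Scheme.{u}), ⊤)}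
    {h h' : MvPolynomial (Fin 4) Γ((U : Scheme.{u}), ⊤)} (M : IsLocalModel X D e A q h h')
    (hD : ∀ V, (D.ideal V).FG) [IsDomain Γ((U : Scheme.{u}), ⊤)]
    (h2 : (2 : Γ((U : Scheme.{u}), ⊤)) ≠ 0) :
    ∃ j, (residualIdeal X.coneInter D).comap (e.chart j ≫ (X.toCam.π ⁻¹ᵁ U).ι) ≠
      D.comap (e.chart j ≫ (X.toCam.π ⁻¹ᵁ U).ι) := by
  have : IsAffine (U : Scheme.{u}) := M.isAffineOpen
  by_contra! hcon
  have hs : ∀ f ∈ ({h, coneForm (A 0) (q 0)} : Set _), ∃ m, MvPolynomial.IsHomogeneous f m := by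
    rintro f (rfl | rfl)
    exacts [⟨1, M.residualPair.left.1⟩, ⟨2, M.residualPair.left.2.1⟩]
  -- Equality of the two curves on all charts puts `h'` into the saturated ideal `(h, Q₀)`; being
  -- linear, it must be a scalar multiple of `h`.
  have hmem : h' ∈ Ideal.span {h, coneForm (A 0) (q 0)} := by
    refine M.residualPair.left.mem_of_pow_mul_mem fun j => ?_
    refine exists_pow_mul_mem_span_of_relChartEval_mem j hs M.residualPair.right.1 ?_
    have h1 := hcon j
    rw [(M.residual hD).comap_curve, M.comap_curve] at h1
    rw [Set.image_pair, ← ofIdealTop_injective h1]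
    exact Ideal.subset_span (Set.mem_insert _ _)
  obtain ⟨r, hr⟩ := exists_of_linear_mem_span M.residualPair.left.1 M.residualPair.left.2.1
    M.residualPair.right.1 hmem
  obtain ⟨a, b, ha, hb, hab⟩ := M.residualPair.mul_eq
  let K := FractionRing Γ((U : Scheme.{u}), ⊤)
  let f : Γ((U : Scheme.{u}), ⊤) →+* K := algebraMap _ _
  have hf : Function.Injective f := IsFractionRing.injective _ _
  have hfa : f a ≠ 0 := (ha.map f).ne_zero
  have hfb : f b ≠ 0 := (hb.map f).ne_zero
  -- Over the fraction field, `a Q₀ - b Q₁ = r h²` is solved for `Q₀`.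
  have H : map f (coneForm (A 0) (q 0)) = C (f b / f a) * map f (coneForm (A 1) (q 1)) +
      C (f r / f a) * (map f h * map f h) := by
    have h3 := congrArg (map f) hab
    rw [hr] at h3
    simp only [map_mul, map_sub, map_C] at h3
    have h4 : (C (f a)⁻¹ * C (f a) : MvPolynomial (Fin 4) K) = 1 := by
      rw [← C_mul, inv_mul_cancel₀ hfa, C_1]
    simp only [div_eq_mul_inv, C_mul]
    linear_combination (-C (f a)⁻¹) * h3 - map f (coneForm (A 0) (q 0)) * h4
  have hdisj := X.toCam.general 0 1 (by decide)
  obtain ⟨c₁, hc₁, hA₁⟩ := (M.isGivenBy 0).exists_forall_mulVec_ne_zero M.isAffineOpen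
    (M.isGivenBy 1) hdisj
  obtain ⟨c₀, hc₀, hA₀⟩ := (M.isGivenBy 1).exists_forall_mulVec_ne_zero M.isAffineOpen
    (M.isGivenBy 0) hdisj.symm
  have h2' : (2 : K) ≠ 0 := by
    rw [← map_ofNat f 2]
    exact (map_ne_zero_iff f hf).mpr h2
  rcases (M.smooth 0).exists_common_vertex (M.smooth 1) (M.isGivenBy 0).surjective
    (M.isGivenBy 1).surjective h2' f (div_ne_zero hfb hfa) (M.residualPair.left.1.map f) H
    (mulVec_comp_eq_zero hc₀ f) (mulVec_comp_eq_zero hc₁ f) with h | h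
  · exact hA₁ K f h
  · exact hA₀ K f h

/-- The residual curve of a calibrating curve `D` over an integral base in which two is nonzero is
not the pullback of `D` under an automorphism of the camera configuration over the base. -/
theorem CamConics.IsCalibration.residualIdeal_ne_comap {X : CamConics.{u} 2}
    {D : X.toCam.P.IdealSheafData} (H : X.IsCalibration D) [IsIntegral X.toCam.base]
    (h2 : (2 : Γ(X.toCam.base, ⊤)) ≠ 0) (g : X.toCam ⟶ X.toCam) (hg : g.base = 𝟙 _) :
    residualIdeal X.coneInter D ≠ D.comap g.hom := by
  intro hcon
  obtain ⟨U, hU, e, A, q, h, h', M⟩ := H.hasLocalModels (Classical.arbitrary X.toCam.base)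
  have : Nonempty U := ⟨⟨_, hU⟩⟩
  have : Nonempty (U.ι ''ᵁ ⊤) := ⟨⟨_, ⟨_, hU⟩, trivial, rfl⟩⟩
  have hdom : IsDomain Γ((U : Scheme.{u}), ⊤) := inferInstance
  have h2U : (2 : Γ((U : Scheme.{u}), ⊤)) ≠ 0 := by
    have hinj : Function.Injective U.ι.appTop.hom :=
      Scheme.Opens.ι_appTop U ▸ map_injective_of_isIntegral X.toCam.base _
    rw [← map_ofNat U.ι.appTop.hom 2]
    exact (map_ne_zero_iff _ hinj).mpr h2
  obtain ⟨j, hj⟩ := M.exists_comap_residualIdeal_ne H.hasLocalModels.fg h2U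
  refine hj ?_
  have hgπ : g.hom ≫ X.toCam.π = X.toCam.π := by
    rw [g.isPullback.w, hg, Category.comp_id]
  -- By rigidity `g.hom` restricts to the identity on the chart, so pulling `D` back along it
  -- changes nothing there.
  rw [hcon, ← Scheme.IdealSheafData.comap_comp, chart_comp_eq M.isAffineOpen M.isGivenBy
    (X.toCam.general 0 1 (by decide)) g.hom hgπ g.map j]

/-- The involution of the stack of calibrated pairs of cameras that replaces the calibrating curve
by its residual curve in the intersection of the two cones. -/
def residualInvolution : CalCam.{u} 2 ⥤ CalCam.{u} 2 where
  obj X := ⟨X.toCamConics, residualIdeal X.toCamConics.coneInter X.curve,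
    X.isCalibration.hasLocalModels.residual.isCalibration⟩
  map {X Y} f := ⟨f.toCamConics, Y.isCalibration.hasLocalModels.residual_comap
    X.isCalibration.hasLocalModels f.toCamConics f.curve⟩

theorem CalCam.ext_of_curve_eq {n : ℕ} {X : CamConics.{u} n} {D E : X.toCam.P.IdealSheafData}
    (hD : X.IsCalibration D) (hE : X.IsCalibration E) (h : D = E) :
    (⟨X, D, hD⟩ : CalCam n) = ⟨X, E, hE⟩ := by
  subst h
  rfl

theorem residualInvolution_comp_self :
    residualInvolution ⋙ residualInvolution = 𝟭 (CalCam.{u} 2) := by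
  have hobj (X : CalCam.{u} 2) : (residualInvolution ⋙ residualInvolution).obj X = X :=
    CalCam.ext_of_curve_eq _ X.isCalibration X.isCalibration.hasLocalModels.residual_residual
  have hdec {X Y : CalCam.{u} 2} (f : X ⟶ Y) : f.toCamConics = (decalibration 2).map f := rfl
  refine CategoryTheory.Functor.ext hobj fun X Y f => CalCam.Hom.ext ?_
  -- After forgetting the curves, the object identifications become equalities of an object with
  -- itself, so the transport maps are identities.
  rw [hdec, hdec, Functor.map_comp, Functor.map_comp, eqToHom_map, eqToHom_map]
  erw [eqToHom_refl, eqToHom_refl, Category.comp_id, Category.id_comp]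
  rfl

end Involution

end CalibratedCameras

end

open CalibratedCameras

theorem proposition4 :
    ∃ χ : CalCam.{u} 2 ⥤ CalCam.{u} 2,
      -- `χ` is a morphism over `Cam_2 × 𝒞²`, hence over `Cam_2`
      χ ⋙ decalibration 2 = decalibration 2 ∧
      -- `χ` is an involution
      χ ⋙ χ = 𝟭 (CalCam.{u} 2) ∧
      -- `χ` replaces the calibrating curve by the residual one in the intersection of the cones
      (∀ X : CalCam.{u} 2,
        ∃ h : X.toCamConics.IsCalibration (residualIdeal X.toCamConics.coneInter X.curve),
          χ.obj X = ⟨X.toCamConics, residualIdeal X.toCamConics.coneInter X.curve, h⟩) ∧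
      -- `χ` has no fixed points with values in a field of characteristic different from two
      (∀ (K : Type u) [Field K], (2 : K) ≠ 0 → ∀ (X : CalCam.{u} 2) (f : χ.obj X ≅ X),
        ¬ (calCamBase.{u} 2).IsHomLift (𝟙 (Spec (CommRingCat.of K))) f.hom) := by
  refine ⟨residualInvolution, rfl, residualInvolution_comp_self, fun X => ⟨_, rfl⟩, ?_⟩
  intro K _ h2 X f hlift
  have hbase : X.toCamConics.toCam.base = Spec (CommRingCat.of K) :=
    IsHomLift.codomain_eq (calCamBase.{u} 2) (𝟙 (Spec (CommRingCat.of K))) f.hom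
  have hX : IsIntegral X.toCamConics.toCam.base := hbase ▸ inferInstance
  have h2X : (2 : Γ(X.toCamConics.toCam.base, ⊤)) ≠ 0 := by
    rw [hbase, ← map_ofNat (Scheme.ΓSpecIso (CommRingCat.of K)).inv.hom 2]
    exact (map_ne_zero_iff _ ((Scheme.ΓSpecIso (CommRingCat.of K)).symm
      |>.commRingCatIsoToRingEquiv.injective)).mpr h2
  -- Lifting the identity of `Spec K` determines the base component only up to transport along
  -- equalities of objects, which here compose to the identity.
  have hid : f.hom.toCamConics.toCam.base = 𝟙 X.toCamConics.toCam.base := by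
    have h := IsHomLift.fac' (calCamBase.{u} 2) (𝟙 (Spec (CommRingCat.of K))) f.hom
    rw [Category.id_comp, eqToHom_trans] at h
    exact h
  exact X.isCalibration.residualIdeal_ne_comap h2X f.hom.toCamConics.toCam hid f.hom.curve
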